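/- **Setting.** Let $(\Omega,\mathcal A,\mathbb P)$ be a probability space. For each $n\ge 2$ let $p=p_n\ge 2$, $\gamma_n=p/n$, let $\Sigma_n\in\mathbb R^{p\times p}$, and let $Z=Z_n$ (an $n\times p$ matrix), $\beta=\beta_n$ (in $\mathbb R^p$) and $u=u_n$ (in $\mathbb R^n$) be random. Put $X=Z\Sigma_n^{1/2}$ with the positive semidefinite square root, $y=X\beta+u$ and $\hat\Sigma_n=n^{-1}X^\top X$. For a symmetric $p\times p$ matrix $A$ with eigenvalues $s_i(A)$ (with multiplicity) put $F_A(x)=\frac1p\#\{i: s_i(A)\le x\}$, and let $s_{\max}(A)$ be its largest eigenvalue. Assume: * (A1) $\gamma_n\to\gamma\in(0,\infty)$. * (A2) The $\Sigma_n$ are symmetric positive semidefinite, $\sup_n\|\Sigma_n\|_2<\infty$ (spectral norm), and $F_{\Sigma_n}(0)\ne1$ for every $n$. * (A3) For each $n$ the entries $z_{ij}$ of $Z_n$ are independent real random variables with $\mathbb E z_{ij}=0$, $\mathbb E z_{ij}^2=1$ and distributions absolutely continuous with respect to Lebesgue measure, and $\sup_{n}\max_{i,j}\mathbb E|z_{ij}|^{4+\varepsilon}<\infty$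 for some $\varepsilon>0$. * (A4) $F_{\Sigma_n}$ converges weakly to a cumulative distribution function $H$ supported on $[0,\infty)$ with $H(0)\neq1$. * (A5) There are $\tau,\sigma>0$, not depending on $n$, such that for each $n$ the entries of $\beta$ are independent with $\mathbb E\beta_i=0$, $\mathbb E\beta_i^2=\tau^2/p$, and $\sup_n\max_i p^2\,\mathbb E\beta_i^4<\infty$; the entries of $u$ are independent with $\mathbb Eu_i=0$, $\mathbb Eu_i^2=\sigma^2$, and $\sup_n\max_i\mathbb Eu_i^4<\infty$; and $u,Z,\beta$ are jointly independent for every $n$. For $\lambda>0$, $\eta>0$ and $\theta=\theta_n\in\mathbb R^p$, regularized gradient descent (RGD) is $\hat\beta_0(\lambda,\eta)=\theta$, $$\hat\beta_{t+1}(\lambda,\eta)=\hat\beta_t(\lambda,\eta)-\frac{\eta}{n}\Bigl(-X^\top\bigl(y-X\hat\beta_t(\lambda,\eta)\bigr)+n\lambda\hat\beta_t(\lambda,\eta)\Bigr),\qquad t=0,1,2,\dots$$ The generalization error of an estimator $\hat b$ is the conditional expectation of a nonnegative random variable $$\mathrm R_{\Sigma_n}(\hat b)=\mathbb E\bigl((\hat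 b-\beta)^\top\Sigma_n(\hat b-\beta)\,\big|\,X\bigr)\in[0,\infty].$$ Put $\lambda_n^*=\frac{\sigma^2}{\tau^2}\gamma_n$, $\hat m_1=\frac1p\operatorname{tr}\hat\Sigma_n$, $\hat m_2=\frac1p\operatorname{tr}\hat\Sigma_n^2$, $\tilde m_2=\hat m_2-\gamma_n\hat m_1^2$ (which is almost surely positive), $$\hat\tau_n^2=\frac1{\tilde m_2}\frac{\|X^\top y\|_2^2}{n^2}-\frac{\gamma_n\hat m_1}{\tilde m_2}\frac{\|y\|_2^2}{n},\qquad \hat\sigma_n^2=\frac{\|y\|_2^2}{n}\Bigl(1+\gamma_n\frac{\hat m_1^2}{\tilde m_2}\Bigr)-\frac{\|X^\top y\|_2^2}{n^2}\frac{\hat m_1}{\tilde m_2},$$ and let $\hat\lambda_n=\bigl(\frac{\hat\sigma_n^2}{\hat\tau_n^2}\gamma_n\vee\lambda_1\bigr)\wedge\lambda_2$, where $0<\lambda_1<\lambda_2<\infty$ are constants with $\frac{\sigma^2}{\tau^2}\gamma\in(\lambda_1,\lambda_2)$. A quotient with denominator $0$ is read as $0$. **Theorem.** Assume (A1)–(A5).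 Let $\theta_n\in\mathbb R^{p_n}$ be deterministic with $\sup_n\|\theta_n\|_2<\infty$, let $\hat s_1=\hat s_1(X)\ge0$ be, for each $n$, any measurable function of $X$, and put $\hat\eta_n(\lambda)=(\hat s_1+\lambda)^{-1}$. Then for all $n\ge2$ and $t$ the risks $\mathrm R_{\Sigma_n}(\hat\beta_t(\hat\lambda_n,\hat\eta_n(\hat\lambda_n)))$ and $\mathrm R_{\Sigma_n}(\hat\beta_t(\lambda_n^*,\hat\eta_n(\lambda_n^*)))$ are almost surely finite, and for every $t\in\mathbb N$ $$\bigl|\mathrm R_{\Sigma_n}(\hat\beta_t(\hat\lambda_n,\hat\eta_n(\hat\lambda_n)))-\mathrm R_{\Sigma_n}(\hat\beta_t(\lambda_n^*,\hat\eta_n(\lambda_n^*)))\bigr|\overset{\mathbb P}{\longrightarrow}0\qquad\text{as }n\to\infty.$$ If moreover $\mathbb P(s_{\max}(\hat\Sigma_n)<\hat s_1<K)\to1$ as $n\to\infty$ for some constant $K>0$, then $$\sup_{t\in\mathbb N}\bigl|\mathrm R_{\Sigma_n}(\hat\beta_t(\hat\lambda_n,\hat\eta_n(\hat\lambda_n)))-\mathrm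 R_{\Sigma_n}(\hat\beta_t(\lambda_n^*,\hat\eta_n(\lambda_n^*)))\bigr|\overset{\mathbb P}{\longrightarrow}0\qquad\text{as }n\to\infty.$$ -/

import Mathlib

open MeasureTheory ProbabilityTheory Filter Topology Matrix
open scoped ENNReal

namespace RGD

noncomputable section

/-! ### Deterministic objects: spectra, gradient descent, plug-in estimators -/

/-- The aspect ratio `γₙ = p / n`. -/
def aspect (n p : ℕ) : ℝ := (p : ℝ) / (n : ℝ)

/-- The sample covariance matrix `n⁻¹ Xᵀ X`. -/
def sampleCov {n p : ℕ} (X : Matrix (Fin n) (Fin p) ℝ) : Matrix (Fin p) (Fin p) ℝ :=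
  (n : ℝ)⁻¹ • (Xᵀ * X)

/-- The empirical spectral distribution function `F_A(x) = p⁻¹ #{i | sᵢ(A) ≤ x}` of a symmetric
`p × p` matrix; the eigenvalues are listed with multiplicity, as the roots of the characteristic
polynomial. -/
def esd {p : ℕ} (A : Matrix (Fin p) (Fin p) ℝ) (x : ℝ) : ℝ :=
  (Multiset.countP (fun s => s ≤ x) A.charpoly.roots : ℝ) / (p : ℝ)

/-- The largest eigenvalue of a symmetric matrix. -/
def sMax {p : ℕ} (A : Matrix (Fin p) (Fin p) ℝ) : ℝ := sSup (spectrum ℝ A)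

section
open scoped MatrixOrder

/-- The unique positive semidefinite square root of a positive semidefinite matrix. -/
def psdSqrt {p : ℕ} (A : Matrix (Fin p) (Fin p) ℝ) : Matrix (Fin p) (Fin p) ℝ := CFC.sqrt A

end

/-- The gradient at `b` of `L(b) = ‖y - X b‖² / (2 n) + lam ‖b‖² / 2`. -/
def gradLoss {n p : ℕ} (X : Matrix (Fin n) (Fin p) ℝ) (y : Fin n → ℝ) (lam : ℝ)
    (b : Fin p → ℝ) : Fin p → ℝ :=
  (n : ℝ)⁻¹ • (-(Xᵀ *ᵥ (y - X *ᵥ b)) + ((n : ℝ) * lam) • b)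

/-- The regularized gradient descent iterates with penalty `lam`, step size `eta` and
initialization `θ`. -/
def rgd {n p : ℕ} (X : Matrix (Fin n) (Fin p) ℝ) (y : Fin n → ℝ) (lam eta : ℝ)
    (θ : Fin p → ℝ) : ℕ → Fin p → ℝ
  | 0 => θ
  | t + 1 => rgd X y lam eta θ t - eta • gradLoss X y lam (rgd X y lam eta θ t)

/-- `m̂₁ = p⁻¹ tr Σ̂`. -/
def mHat1 {n p : ℕ} (X : Matrix (Fin n) (Fin p) ℝ) : ℝ := (sampleCov X).trace / (p : ℝ)

/-- `m̂₂ = p⁻¹ tr Σ̂²`. -/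
def mHat2 {n p : ℕ} (X : Matrix (Fin n) (Fin p) ℝ) : ℝ :=
  (sampleCov X * sampleCov X).trace / (p : ℝ)

/-- `m̃₂ = m̂₂ - γₙ m̂₁²`. -/
def mTilde2 {n p : ℕ} (X : Matrix (Fin n) (Fin p) ℝ) : ℝ :=
  mHat2 X - aspect n p * mHat1 X ^ 2

/-- The estimator of the signal strength `τ²` (meaningful when `m̃₂ ≠ 0`). -/
def tauSqHat {n p : ℕ} (X : Matrix (Fin n) (Fin p) ℝ) (y : Fin n → ℝ) : ℝ :=
  1 / mTilde2 X * (((Xᵀ *ᵥ y) ⬝ᵥ (Xᵀ *ᵥ y)) / (n : ℝ) ^ 2)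
    - aspect n p * mHat1 X / mTilde2 X * ((y ⬝ᵥ y) / (n : ℝ))

/-- The estimator of the noise level `σ²` (meaningful when `m̃₂ ≠ 0`). -/
def sigmaSqHat {n p : ℕ} (X : Matrix (Fin n) (Fin p) ℝ) (y : Fin n → ℝ) : ℝ :=
  (y ⬝ᵥ y) / (n : ℝ) * (1 + aspect n p * (mHat1 X ^ 2 / mTilde2 X))
    - ((Xᵀ *ᵥ y) ⬝ᵥ (Xᵀ *ᵥ y)) / (n : ℝ) ^ 2 * (mHat1 X / mTilde2 X)

/-- The plug-in penalty, truncated to `[lam1, lam2]`. -/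
def lamHat {n p : ℕ} (lam1 lam2 : ℝ) (X : Matrix (Fin n) (Fin p) ℝ) (y : Fin n → ℝ) : ℝ :=
  min (max (sigmaSqHat X y / tauSqHat X y * aspect n p) lam1) lam2

/-- The oracle penalty `(σ² / τ²) γₙ`. -/
def lamStar (σ τ : ℝ) (n p : ℕ) : ℝ := σ ^ 2 / τ ^ 2 * aspect n p

/-! ### Random objects -/

section
variable {Ω : Type*} {n p : ℕ}

/-- The design `X = Z Σ^{1/2}`. -/
def design (Sigma : Matrix (Fin p) (Fin p) ℝ) (Z : Ω → Fin n → Fin p → ℝ) (ω : Ω) :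
    Matrix (Fin n) (Fin p) ℝ :=
  Matrix.of (Z ω) * psdSqrt Sigma

/-- The response `y = X β + u`. -/
def response (Sigma : Matrix (Fin p) (Fin p) ℝ) (Z : Ω → Fin n → Fin p → ℝ)
    (β : Ω → Fin p → ℝ) (u : Ω → Fin n → ℝ) (ω : Ω) : Fin n → ℝ :=
  design Sigma Z ω *ᵥ β ω + u ω

/-- The σ-algebra generated by (the entries of) a random matrix. -/
abbrev sigmaAlg (X : Ω → Matrix (Fin n) (Fin p) ℝ) : MeasurableSpace Ω :=
  MeasurableSpace.comap (fun ω (i : Fin n) (j : Fin p) => X ω i j) inferInstance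

/-- The generalization error `E((b - β)ᵀ Σ (b - β) | X)` of an estimator `b`, as a conditional
expectation of a nonnegative random variable, with values in `[0, ∞]` (no integrability of the
quadratic form is needed). -/
def risk [MeasurableSpace Ω] (P : Measure Ω) (Sigma : Matrix (Fin p) (Fin p) ℝ)
    (X : Ω → Matrix (Fin n) (Fin p) ℝ) (β b : Ω → Fin p → ℝ) : Ω → ℝ≥0∞ :=
  condLExp (sigmaAlg X) P
    (fun ω => ENNReal.ofReal ((b ω - β ω) ⬝ᵥ (Sigma *ᵥ (b ω - β ω))))

/-- The risk after `t` steps of gradient descent with the (possibly data-dependent) penalty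
`lam` and the step size `(s₁(X) + lam)⁻¹`. -/
def rgdRisk [MeasurableSpace Ω] (P : Measure Ω) (Sigma : Matrix (Fin p) (Fin p) ℝ)
    (Z : Ω → Fin n → Fin p → ℝ) (β : Ω → Fin p → ℝ) (u : Ω → Fin n → ℝ)
    (s₁ : (Fin n → Fin p → ℝ) → ℝ) (θ : Fin p → ℝ) (lam : Ω → ℝ) (t : ℕ) : Ω → ℝ≥0∞ :=
  risk P Sigma (design Sigma Z) β (fun ω =>
    rgd (design Sigma Z ω) (response Sigma Z β u ω) (lam ω)
      (s₁ (fun i j => design Sigma Z ω i j) + lam ω)⁻¹ θ t)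

/-- The risk after `t` steps with the plug-in penalty. -/
def pluginRisk [MeasurableSpace Ω] (P : Measure Ω) (Sigma : Matrix (Fin p) (Fin p) ℝ)
    (Z : Ω → Fin n → Fin p → ℝ) (β : Ω → Fin p → ℝ) (u : Ω → Fin n → ℝ)
    (s₁ : (Fin n → Fin p → ℝ) → ℝ) (θ : Fin p → ℝ) (lam1 lam2 : ℝ) (t : ℕ) : Ω → ℝ≥0∞ :=
  rgdRisk P Sigma Z β u s₁ θ
    (fun ω => lamHat lam1 lam2 (design Sigma Z ω) (response Sigma Z β u ω)) t

/-- The risk after `t` steps with the oracle penalty. -/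
def oracleRisk [MeasurableSpace Ω] (P : Measure Ω) (Sigma : Matrix (Fin p) (Fin p) ℝ)
    (Z : Ω → Fin n → Fin p → ℝ) (β : Ω → Fin p → ℝ) (u : Ω → Fin n → ℝ)
    (s₁ : (Fin n → Fin p → ℝ) → ℝ) (θ : Fin p → ℝ) (σ τ : ℝ) (t : ℕ) : Ω → ℝ≥0∞ :=
  rgdRisk P Sigma Z β u s₁ θ (fun _ => lamStar σ τ n p) t

end

/-! ### The model assumptions (for sample sizes and dimensions at least two) -/

/-- `p = pₙ ≥ 2` and `pₙ / n → γ ∈ (0, ∞)`. -/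
structure ProportionalGrowth (p : ℕ → ℕ) (γ : ℝ) : Prop where
  two_le : ∀ n ≥ 2, 2 ≤ p n
  pos : 0 < γ
  tendsto : Tendsto (fun n => aspect n (p n)) atTop (𝓝 γ)

/-- Symmetric positive semidefinite population covariances with uniformly bounded spectral norm,
none of which has all of its spectrum at zero. -/
structure BoundedCovariance (p : ℕ → ℕ) (Sigma : ∀ n, Matrix (Fin (p n)) (Fin (p n)) ℝ) :
    Prop where
  posSemidef : ∀ n ≥ 2, (Sigma n).PosSemidef
  bounded : ∃ C : ℝ, ∀ n ≥ 2, ‖Matrix.toEuclideanCLM (𝕜 := ℝ) (Sigma n)‖ ≤ C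
  esd_zero_ne_one : ∀ n ≥ 2, esd (Sigma n) 0 ≠ 1

/-- For each `n` the entries of `Zₙ` are independent, standardized and absolutely continuous,
with uniformly bounded moments of some order `4 + ε`. -/
structure DesignEntries {Ω : Type*} [MeasurableSpace Ω] (P : Measure Ω) (p : ℕ → ℕ)
    (Z : ∀ n, Ω → Fin n → Fin (p n) → ℝ) : Prop where
  measurable : ∀ n ≥ 2, Measurable (Z n)
  indep : ∀ n ≥ 2, iIndepFun (fun (ij : Fin n × Fin (p n)) ω => Z n ω ij.1 ij.2) P
  mean : ∀ n ≥ 2, ∀ i j, ∫ ω, Z n ω i j ∂P = 0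
  second_moment : ∀ n ≥ 2, ∀ i j, ∫ ω, Z n ω i j ^ 2 ∂P = 1
  moment : ∃ ε : ℝ, 0 < ε ∧ ∃ M : ℝ, ∀ n ≥ 2, ∀ i j,
    Integrable (fun ω => |Z n ω i j| ^ (4 + ε)) P ∧ ∫ ω, |Z n ω i j| ^ (4 + ε) ∂P ≤ M
  absolutelyContinuous : ∀ n ≥ 2, ∀ i j, P.map (fun ω => Z n ω i j) ≪ volume

/-- The spectral distribution functions of `Σₙ` converge weakly to the distribution function of a
probability measure `H` supported on `[0, ∞)` with `H(0) ≠ 1`. -/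
structure SpectralLimit (p : ℕ → ℕ) (Sigma : ∀ n, Matrix (Fin (p n)) (Fin (p n)) ℝ)
    (H : Measure ℝ) : Prop where
  isProbabilityMeasure : IsProbabilityMeasure H
  support : H (Set.Iio 0) = 0
  cdf_zero_ne_one : cdf H 0 ≠ 1
  tendsto : ∀ x : ℝ, ContinuousAt (cdf H) x →
    Tendsto (fun n => esd (Sigma n) x) atTop (𝓝 (cdf H x))

/-- Random effects `βₙ` and noise `uₙ`: independent centred entries of variance `τ² / pₙ` and `σ²`
with suitably bounded fourth moments, and joint independence of `uₙ`, `Zₙ` and `βₙ`. -/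
structure RandomEffects {Ω : Type*} [MeasurableSpace Ω] (P : Measure Ω) (p : ℕ → ℕ)
    (Z : ∀ n, Ω → Fin n → Fin (p n) → ℝ) (β : ∀ n, Ω → Fin (p n) → ℝ)
    (u : ∀ n, Ω → Fin n → ℝ) (σ τ : ℝ) : Prop where
  tau_pos : 0 < τ
  sigma_pos : 0 < σ
  measurable_beta : ∀ n ≥ 2, Measurable (β n)
  indep_beta : ∀ n ≥ 2, iIndepFun (fun (j : Fin (p n)) ω => β n ω j) P
  mean_beta : ∀ n ≥ 2, ∀ j, ∫ ω, β n ω j ∂P = 0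
  second_moment_beta : ∀ n ≥ 2, ∀ j, ∫ ω, β n ω j ^ 2 ∂P = τ ^ 2 / (p n : ℝ)
  fourth_moment_beta : ∃ ν : ℝ, ∀ n ≥ 2, ∀ j,
    Integrable (fun ω => β n ω j ^ 4) P ∧ (p n : ℝ) ^ 2 * ∫ ω, β n ω j ^ 4 ∂P ≤ ν
  measurable_noise : ∀ n ≥ 2, Measurable (u n)
  indep_noise : ∀ n ≥ 2, iIndepFun (fun (i : Fin n) ω => u n ω i) P
  mean_noise : ∀ n ≥ 2, ∀ i, ∫ ω, u n ω i ∂P = 0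
  second_moment_noise : ∀ n ≥ 2, ∀ i, ∫ ω, u n ω i ^ 2 ∂P = σ ^ 2
  fourth_moment_noise : ∃ ν : ℝ, ∀ n ≥ 2, ∀ i,
    Integrable (fun ω => u n ω i ^ 4) P ∧ ∫ ω, u n ω i ^ 4 ∂P ≤ ν
  jointly_indep : ∀ n ≥ 2, iIndep ![MeasurableSpace.comap (u n) inferInstance,
    MeasurableSpace.comap (Z n) inferInstance, MeasurableSpace.comap (β n) inferInstance] P

end

end RGD

namespace RGD

/-! ### Spectral calculus for symmetric real matrices -/

section Spectral

variable {ι : Type*} [Fintype ι] [DecidableEq ι] {A : Matrix ι ι ℝ}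

/-! Everything is done conditionally on the design: given `X`, the response is one linear image of a
vector of independent standardized variables (the rescaled `β` and `u`), and the risk averages a
quadratic form over it.

Deterministic part. The numbers `‖y‖² / n` and `‖Xᵀy‖² / n²` have conditional means that are linear
in `(τ², σ²)`, and the estimators solve this two by two system, whose determinant is `m̃₂`. If `m̃₂
≥ c` and `Σ̂ ≤ s`, the clipped penalty therefore differs from the oracle penalty by at most a
constant times `s²` times the deviations of the two statistics (`abs_lamHat_sub_lamStar_le`). With
step `(s₁ + λ)⁻¹` the update is `b ↦ (s₁ + λ)⁻¹ ((s₁ - Σ̂) b + n⁻¹ Xᵀ y)`, so `λ` acts only through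
a scalar factor, and a discrete Gronwall argument makes the iterates Lipschitz in `λ`
(`StepBound.euNorm_rgd_sub_le`). Hence the two losses differ by at most a constant times `|λ̂ - λ*|
(1 + ρ)²`, where `ρ` is the size of `β` and `u` (`abs_loss_sub_le`).

Probabilistic part. The variance bound for quadratic forms (`StdEntries.integral_quadForm_sq_le`)
gives mean square deviations of order `s⁴ / n`, while `(1 + ρ)⁴` has bounded mean. A weighted
arithmetic-geometric inequality then makes the expected loss gap of order `n^(-1/2)` times powers of
`s`, on an event determined by `X`. Since that event is measurable with respect to `X`, the bound
passes to the conditional expectations and Markov's inequality ends the argument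
(`measure_iSup_condLExp_gap_le`).

Two facts about the design make the event likely. First, `Σ̂ ≤ C n^(2a)` with high probability for
every `a > 0`. This is weaker than boundedness, but for fixed `t` the constants grow like a fixed
power of `s`, so a small `a` is absorbed by `n^(-1/2)`. It follows from truncating the rows of `Z`
and bounding trace moments of a sum of independent rank one matrices: removing one row from the sum
costs a shift by a multiple of the identity (`dotProduct_rankOne_pow_le`), after which independence
applies. Second, `m̃₂` stays away from zero: by Cauchy-Schwarz it dominates the squared inner
products between two disjoint halves of the rows of `X`, which concentrate around a multiple of `tr
Σ²`, and the limit `H ≠ δ₀` bounds `tr Σ² / p` from below.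

For the statement uniform in `t`, the extra hypothesis gives `Σ̂ ≤ s₁ ≤ K`. The update is then a
contraction with a fixed rate below one, so all constants are independent of `t` and `n`. -/

open Polynomial in
theorem aeval_diagonal (d : ι → ℝ) (P : ℝ[X]) :
    aeval (diagonal d) P = diagonal (fun i => P.eval (d i)) := by
  have h := aeval_algHom_apply (Matrix.diagonalAlgHom (n := ι) (α := ℝ) ℝ) d P
  simp only [Matrix.diagonalAlgHom_apply] at h
  rw [h]
  congr 1
  ext i
  have := (aeval_algHom_apply (Pi.evalAlgHom ℝ (fun _ : ι => ℝ) i) d P).symm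
  simp at this ⊢

/-- The squared coordinates of `v` in the eigenbasis of `A`. -/
noncomputable def spectralWeight (hA : A.IsHermitian) (v : ι → ℝ) (i : ι) : ℝ :=
  ((star (hA.eigenvectorUnitary : Matrix ι ι ℝ)) *ᵥ v) i ^ 2

theorem spectralWeight_nonneg (hA : A.IsHermitian) (v : ι → ℝ) (i : ι) :
    0 ≤ spectralWeight hA v i := sq_nonneg _

open Polynomial in
theorem aeval_eq_conj (hA : A.IsHermitian) (P : ℝ[X]) :
    aeval A P = (hA.eigenvectorUnitary : Matrix ι ι ℝ) *
      diagonal (fun i => P.eval (hA.eigenvalues i)) *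
      star (hA.eigenvectorUnitary : Matrix ι ι ℝ) := by
  conv_lhs => rw [hA.spectral_theorem]
  have := aeval_algHom_apply
    ((Unitary.conjStarAlgAut ℝ (Matrix ι ι ℝ) hA.eigenvectorUnitary).toStarAlgHom.toAlgHom)
    (diagonal (RCLike.ofReal ∘ hA.eigenvalues)) P
  rw [aeval_diagonal] at this
  simpa [Unitary.conjStarAlgAut_apply] using this

-- The quadratic form of `P(A)` at `v` is the integral of `P` against the spectral measure of `A` at
-- `v`. Inequalities between polynomials in one symmetric matrix, tested at one vector, thus become
-- scalar ones.
open Polynomial in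
theorem dotProduct_aeval_mulVec (hA : A.IsHermitian) (P : ℝ[X]) (v : ι → ℝ) :
    v ⬝ᵥ (aeval A P *ᵥ v) = ∑ i, spectralWeight hA v i * P.eval (hA.eigenvalues i) := by
  rw [aeval_eq_conj hA, ← mulVec_mulVec, ← mulVec_mulVec, dotProduct_mulVec]
  have : v ᵥ* (hA.eigenvectorUnitary : Matrix ι ι ℝ) =
      (star (hA.eigenvectorUnitary : Matrix ι ι ℝ)) *ᵥ v := by
    rw [star_eq_conjTranspose, conjTranspose_eq_transpose_of_trivial, mulVec_transpose]
  rw [this, dotProduct]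
  refine Finset.sum_congr rfl fun i _ => ?_
  rw [mulVec_diagonal, spectralWeight]
  ring

open Polynomial in
theorem trace_aeval (hA : A.IsHermitian) (P : ℝ[X]) :
    (aeval A P).trace = ∑ i, P.eval (hA.eigenvalues i) := by
  rw [aeval_eq_conj hA, trace_mul_cycle]
  simp

theorem dotProduct_pow_mulVec (hA : A.IsHermitian) (k : ℕ) (v : ι → ℝ) :
    v ⬝ᵥ (A ^ k *ᵥ v) = ∑ i, spectralWeight hA v i * hA.eigenvalues i ^ k := by
  simpa using dotProduct_aeval_mulVec hA (Polynomial.X ^ k) v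

theorem dotProduct_self_eq_sum_spectralWeight (hA : A.IsHermitian) (v : ι → ℝ) :
    v ⬝ᵥ v = ∑ i, spectralWeight hA v i := by
  simpa using dotProduct_pow_mulVec hA 0 v

theorem dotProduct_mulVec_eq_sum_spectralWeight (hA : A.IsHermitian) (v : ι → ℝ) :
    v ⬝ᵥ (A *ᵥ v) = ∑ i, spectralWeight hA v i * hA.eigenvalues i := by
  simpa using dotProduct_pow_mulVec hA 1 v

theorem trace_pow_eq_sum (hA : A.IsHermitian) (k : ℕ) :
    (A ^ k).trace = ∑ i, hA.eigenvalues i ^ k := by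
  simpa using trace_aeval hA (Polynomial.X ^ k)

/-- Quadratic form bounds on a symmetric matrix bound its eigenvalues. -/
theorem eigenvalues_le_of_forall_dotProduct_le (hA : A.IsHermitian) {s : ℝ}
    (h : ∀ v, v ⬝ᵥ (A *ᵥ v) ≤ s * (v ⬝ᵥ v)) (i : ι) : hA.eigenvalues i ≤ s := by
  have h1 := h (hA.eigenvectorBasis i)
  rw [hA.mulVec_eigenvectorBasis, dotProduct_smul] at h1
  have h2 : (hA.eigenvectorBasis i : ι → ℝ) ⬝ᵥ (hA.eigenvectorBasis i : ι → ℝ) = 1 := by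
    have h3 := hA.eigenvectorBasis.orthonormal.1 i
    have h4 := EuclideanSpace.real_norm_sq_eq (hA.eigenvectorBasis i)
    rw [h3] at h4
    simp only [dotProduct, ← sq]
    linarith
  simpa [h2] using h1

theorem dotProduct_mulVec_le_of_eigenvalues_le (hA : A.IsHermitian) {s : ℝ}
    (h : ∀ i, hA.eigenvalues i ≤ s) (v : ι → ℝ) : v ⬝ᵥ (A *ᵥ v) ≤ s * (v ⬝ᵥ v) := by
  rw [dotProduct_mulVec_eq_sum_spectralWeight hA, dotProduct_self_eq_sum_spectralWeight hA,
    Finset.mul_sum]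
  refine Finset.sum_le_sum fun i _ => ?_
  rw [mul_comm]
  exact mul_le_mul_of_nonneg_right (h i) (spectralWeight_nonneg _ _ _)

/-- A symmetric matrix whose quadratic form is bounded by `q` has operator norm at most `q`. -/
theorem mulVec_dotProduct_mulVec_le (hA : A.IsHermitian) {q : ℝ}
    (h : ∀ v, |v ⬝ᵥ (A *ᵥ v)| ≤ q * (v ⬝ᵥ v)) (v : ι → ℝ) :
    (A *ᵥ v) ⬝ᵥ (A *ᵥ v) ≤ q ^ 2 * (v ⬝ᵥ v) := by
  have h1 : (A *ᵥ v) ⬝ᵥ (A *ᵥ v) = v ⬝ᵥ (A ^ 2 *ᵥ v) := by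
    have hT : Aᵀ = A := by simpa using hA.eq
    rw [pow_two, ← mulVec_mulVec, dotProduct_mulVec v, ← mulVec_transpose, hT]
  have hu := eigenvalues_le_of_forall_dotProduct_le hA fun v => (le_abs_self _).trans (h v)
  have hl : ∀ i, -q ≤ hA.eigenvalues i := by
    intro i
    have h1 := h (hA.eigenvectorBasis i)
    rw [hA.mulVec_eigenvectorBasis, dotProduct_smul] at h1
    have h2 : (hA.eigenvectorBasis i : ι → ℝ) ⬝ᵥ (hA.eigenvectorBasis i : ι → ℝ) = 1 := by
      have h3 := hA.eigenvectorBasis.orthonormal.1 i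
      have h4 := EuclideanSpace.real_norm_sq_eq (hA.eigenvectorBasis i)
      rw [h3] at h4
      simp only [dotProduct, ← sq]
      linarith
    rw [h2] at h1
    simpa using neg_le_of_abs_le h1
  rw [h1, dotProduct_pow_mulVec hA, dotProduct_self_eq_sum_spectralWeight hA, Finset.mul_sum]
  refine Finset.sum_le_sum fun i _ => ?_
  rw [mul_comm]
  refine mul_le_mul_of_nonneg_right ?_ (spectralWeight_nonneg _ _ _)
  exact sq_le_sq' (hl i) (hu i)

/-- A positive semidefinite matrix is dominated by any `s` with `tr A ^ k ≤ s ^ k`, `k ≠ 0`. -/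
theorem dotProduct_mulVec_le_of_trace_pow_le (hA : A.PosSemidef) {s : ℝ} (hs : 0 ≤ s) {k : ℕ}
    (hk : k ≠ 0) (h : (A ^ k).trace ≤ s ^ k) (v : ι → ℝ) :
    v ⬝ᵥ (A *ᵥ v) ≤ s * (v ⬝ᵥ v) := by
  refine dotProduct_mulVec_le_of_eigenvalues_le hA.1 (fun i => ?_) v
  refine le_of_pow_le_pow_left₀ hk hs (le_trans ?_ h)
  rw [trace_pow_eq_sum hA.1]
  exact Finset.single_le_sum (f := fun i => hA.1.eigenvalues i ^ k)
    (fun j _ => pow_nonneg (hA.eigenvalues_nonneg j) k) (Finset.mem_univ i)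

theorem trace_pow_le (hA : A.PosSemidef) {s : ℝ}
    (h : ∀ v, v ⬝ᵥ (A *ᵥ v) ≤ s * (v ⬝ᵥ v)) (k : ℕ) :
    (A ^ k).trace ≤ Fintype.card ι * s ^ k := by
  rw [trace_pow_eq_sum hA.1]
  refine (Finset.sum_le_card_nsmul _ _ (s ^ k) fun i _ => ?_).trans (by simp)
  exact pow_le_pow_left₀ (hA.eigenvalues_nonneg i)
    (eigenvalues_le_of_forall_dotProduct_le hA.1 h i) k

theorem trace_pow_nonneg (hA : A.PosSemidef) (k : ℕ) : 0 ≤ (A ^ k).trace := by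
  rw [trace_pow_eq_sum hA.1]
  exact Finset.sum_nonneg fun i _ => pow_nonneg (hA.eigenvalues_nonneg i) k

/-- Chebyshev's inequality for two increasing functions of a positive semidefinite matrix. -/
theorem pow_mul_shift_pow_chebyshev (hA : A.PosSemidef) {L : ℝ} (hL : 0 ≤ L) (j k : ℕ)
    (v : ι → ℝ) :
    (v ⬝ᵥ (A ^ j *ᵥ v)) * (v ⬝ᵥ ((A + L • 1) ^ k *ᵥ v)) ≤
      (v ⬝ᵥ v) * (v ⬝ᵥ ((A ^ j * (A + L • 1) ^ k) *ᵥ v)) := by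
  have e1 := dotProduct_aeval_mulVec hA.1 ((Polynomial.X + Polynomial.C L) ^ k) v
  have e2 := dotProduct_aeval_mulVec hA.1
    (Polynomial.X ^ j * (Polynomial.X + Polynomial.C L) ^ k) v
  have hc : (algebraMap ℝ (Matrix ι ι ℝ)) L = L • 1 := Algebra.algebraMap_eq_smul_one L
  simp only [map_pow, map_add, map_mul, Polynomial.aeval_X, Polynomial.aeval_C, hc,
    Polynomial.eval_pow, Polynomial.eval_mul, Polynomial.eval_add, Polynomial.eval_X,
    Polynomial.eval_C] at e1 e2
  rw [e1, e2, dotProduct_pow_mulVec hA.1, dotProduct_self_eq_sum_spectralWeight hA.1]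
  set w := spectralWeight hA.1 v
  set μ := hA.1.eigenvalues
  -- Symmetrized form of Chebyshev's sum inequality: `μ ↦ μ ^ j` and `μ ↦ (μ + L) ^ k` both increase
  -- on `[0, ∞)`, so the two differences have the same sign for every pair of eigenvalues.
  have key : 0 ≤ ∑ i, ∑ l, w i * w l *
      ((μ i ^ j - μ l ^ j) * ((μ i + L) ^ k - (μ l + L) ^ k)) := by
    refine Finset.sum_nonneg fun i _ => Finset.sum_nonneg fun l _ => ?_
    refine mul_nonneg (mul_nonneg (spectralWeight_nonneg _ _ _) (spectralWeight_nonneg _ _ _)) ?_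
    have hi : 0 ≤ μ i := hA.eigenvalues_nonneg i
    have hl : 0 ≤ μ l := hA.eigenvalues_nonneg l
    rcases le_total (μ i) (μ l) with h | h
    · exact mul_nonneg_of_nonpos_of_nonpos (sub_nonpos.2 (pow_le_pow_left₀ hi h _))
        (sub_nonpos.2 (pow_le_pow_left₀ (by linarith) (by linarith) _))
    · exact mul_nonneg (sub_nonneg.2 (pow_le_pow_left₀ hl h _))
        (sub_nonneg.2 (pow_le_pow_left₀ (by linarith) (by linarith) _))
  have expand : ∑ i, ∑ l, w i * w l * ((μ i ^ j - μ l ^ j) * ((μ i + L) ^ k - (μ l + L) ^ k)) =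
      2 * ((∑ i, w i) * ∑ i, w i * (μ i ^ j * (μ i + L) ^ k)) -
      2 * ((∑ i, w i * μ i ^ j) * ∑ i, w i * (μ i + L) ^ k) := by
    have h1 : ∀ f g : ι → ℝ, (∑ i, f i) * ∑ i, g i = ∑ i, ∑ l, f i * g l :=
      fun f g => Finset.sum_mul_sum _ _ _ _
    have h2 : ∀ f g : ι → ℝ, (∑ i, f i) * ∑ i, g i = ∑ i, ∑ l, f l * g i := by
      intro f g
      rw [h1, Finset.sum_comm]
    rw [two_mul, two_mul]
    nth_rewrite 1 [h1]
    nth_rewrite 1 [h2]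
    nth_rewrite 1 [h1]
    nth_rewrite 1 [h2]
    simp only [← Finset.sum_add_distrib, ← Finset.sum_sub_distrib]
    refine Finset.sum_congr rfl fun i _ => Finset.sum_congr rfl fun l _ => ?_
    ring
  linarith

/-- Noncommutative telescoping, exchanging the factors `A` for `B` one at a time. -/
theorem pow_eq_pow_add_sum (A B : Matrix ι ι ℝ) (m : ℕ) :
    A ^ m = B ^ m + ∑ j ∈ Finset.range m, B ^ j * (A - B) * A ^ (m - 1 - j) := by
  induction m with
  | zero => simp
  | succ m ih =>
    rw [Finset.sum_range_succ']
    have h : ∀ j ∈ Finset.range m, B ^ (j + 1) * (A - B) * A ^ (m + 1 - 1 - (j + 1)) =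
        B * (B ^ j * (A - B) * A ^ (m - 1 - j)) := by
      intro j hj
      rw [pow_succ', show m + 1 - 1 - (j + 1) = m - 1 - j by omega]
      noncomm_ring
    rw [Finset.sum_congr rfl h, ← Finset.mul_sum, pow_succ' A, pow_succ' B]
    simp only [pow_zero, one_mul, Nat.add_sub_cancel, Nat.sub_zero]
    have : (∑ j ∈ Finset.range m, B ^ j * (A - B) * A ^ (m - 1 - j)) = A ^ m - B ^ m :=
      eq_sub_of_add_eq' ih.symm
    rw [this]
    noncomm_ring

/-- A rank one perturbation by `z zᵀ` of a positive semidefinite matrix increases the quadratic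
forms of its powers at `z` no more than the shift by `L ≥ ‖z‖²`. -/
theorem dotProduct_rankOne_pow_le (hA : A.PosSemidef) {z : ι → ℝ} {L : ℝ} (hL : z ⬝ᵥ z ≤ L)
    (m : ℕ) :
    z ⬝ᵥ ((A + vecMulVec z z) ^ m *ᵥ z) ≤ z ⬝ᵥ ((A + L • 1) ^ m *ᵥ z) := by
  have hz : 0 ≤ z ⬝ᵥ z := by simpa using dotProduct_star_self_nonneg z
  have hL0 : 0 ≤ L := hz.trans hL
  induction m using Nat.strong_induction_on with
  | _ m ih =>
    have e1 := pow_eq_pow_add_sum (A + vecMulVec z z) A m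
    have e2 := pow_eq_pow_add_sum (A + L • 1) A m
    rw [e1, e2]
    simp only [add_mulVec, dotProduct_add, add_sub_cancel_left, sum_mulVec, dotProduct_sum]
    -- Powers are not operator monotone, so `z zᵀ ≤ L` alone is not enough. Testing at `z` itself
    -- helps: in the telescoped sums `z zᵀ` splits the form into a product of two forms at `z`. The
    -- induction hypothesis handles one factor, and Chebyshev's inequality merges the product at the
    -- price `z ⬝ᵥ z ≤ L`.
    refine add_le_add le_rfl (Finset.sum_le_sum fun j hj => ?_)
    have hj' : j < m := Finset.mem_range.1 hj
    have hb : 0 ≤ z ⬝ᵥ (A ^ j *ᵥ z) := by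
      rw [dotProduct_pow_mulVec hA.1]
      exact Finset.sum_nonneg fun i _ => mul_nonneg (spectralWeight_nonneg _ _ _)
        (pow_nonneg (hA.eigenvalues_nonneg i) _)
    have l1 : z ⬝ᵥ ((A ^ j * vecMulVec z z * (A + vecMulVec z z) ^ (m - 1 - j)) *ᵥ z) =
        (z ⬝ᵥ (A ^ j *ᵥ z)) * (z ⬝ᵥ ((A + vecMulVec z z) ^ (m - 1 - j) *ᵥ z)) := by
      rw [← mulVec_mulVec, ← mulVec_mulVec, vecMulVec_mulVec, mulVec_smul, dotProduct_smul]
      simp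
    have l2 : z ⬝ᵥ ((A ^ j * L • 1 * (A + L • 1) ^ (m - 1 - j)) *ᵥ z) =
        L * (z ⬝ᵥ ((A ^ j * (A + L • 1) ^ (m - 1 - j)) *ᵥ z)) := by
      rw [mul_smul_comm, mul_one, smul_mul_assoc, smul_mulVec, dotProduct_smul, smul_eq_mul]
    have hc := pow_mul_shift_pow_chebyshev hA hL0 j (m - 1 - j) z
    have hpos : 0 ≤ z ⬝ᵥ ((A ^ j * (A + L • 1) ^ (m - 1 - j)) *ᵥ z) := by
      have e2 := dotProduct_aeval_mulVec hA.1
        (Polynomial.X ^ j * (Polynomial.X + Polynomial.C L) ^ (m - 1 - j)) z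
      have hc : (algebraMap ℝ (Matrix ι ι ℝ)) L = L • 1 := Algebra.algebraMap_eq_smul_one L
      simp only [map_pow, map_add, map_mul, Polynomial.aeval_X, Polynomial.aeval_C, hc,
        Polynomial.eval_pow, Polynomial.eval_mul, Polynomial.eval_add, Polynomial.eval_X,
        Polynomial.eval_C] at e2
      rw [e2]
      exact Finset.sum_nonneg fun i _ => mul_nonneg (spectralWeight_nonneg _ _ _)
        (mul_nonneg (pow_nonneg (hA.eigenvalues_nonneg i) _)
          (pow_nonneg (add_nonneg (hA.eigenvalues_nonneg i) hL0) _))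
    rw [l1, l2]
    calc _ ≤ (z ⬝ᵥ (A ^ j *ᵥ z)) * (z ⬝ᵥ ((A + L • 1) ^ (m - 1 - j) *ᵥ z)) :=
          mul_le_mul_of_nonneg_left (ih _ (by omega)) hb
      _ ≤ _ := hc
      _ ≤ _ := mul_le_mul_of_nonneg_right hL hpos

end Spectral

/-! ### Euclidean norms and sample covariance matrices -/

section EuclideanNorm

variable {ι κ : Type*} [Fintype ι] [Fintype κ]

/-- The Euclidean norm of a real vector. -/
noncomputable def euNorm (v : ι → ℝ) : ℝ := ‖(WithLp.toLp 2 v : EuclideanSpace ℝ ι)‖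

theorem euNorm_nonneg (v : ι → ℝ) : 0 ≤ euNorm v := norm_nonneg _

theorem euNorm_sq (v : ι → ℝ) : euNorm v ^ 2 = v ⬝ᵥ v := by
  rw [euNorm, EuclideanSpace.real_norm_sq_eq]
  simp [dotProduct, sq]

theorem euNorm_add_le (v w : ι → ℝ) : euNorm (v + w) ≤ euNorm v + euNorm w := by
  simpa [euNorm] using norm_add_le (WithLp.toLp 2 v : EuclideanSpace ℝ ι) (WithLp.toLp 2 w)

theorem euNorm_sub_le (v w : ι → ℝ) : euNorm (v - w) ≤ euNorm v + euNorm w := by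
  simpa [euNorm] using norm_sub_le (WithLp.toLp 2 v : EuclideanSpace ℝ ι) (WithLp.toLp 2 w)

theorem euNorm_smul (c : ℝ) (v : ι → ℝ) : euNorm (c • v) = |c| * euNorm v := by
  simp [euNorm, norm_smul]

theorem euNorm_zero : euNorm (0 : ι → ℝ) = 0 := by simp [euNorm]

theorem dotProduct_le_euNorm (v w : ι → ℝ) : v ⬝ᵥ w ≤ euNorm v * euNorm w := by
  have := real_inner_le_norm (WithLp.toLp 2 w : EuclideanSpace ℝ ι) (WithLp.toLp 2 v)
  rw [EuclideanSpace.inner_eq_star_dotProduct] at this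
  simpa [euNorm, mul_comm] using this

theorem abs_dotProduct_le_euNorm (v w : ι → ℝ) : |v ⬝ᵥ w| ≤ euNorm v * euNorm w := by
  have := abs_real_inner_le_norm (WithLp.toLp 2 w : EuclideanSpace ℝ ι) (WithLp.toLp 2 v)
  rw [EuclideanSpace.inner_eq_star_dotProduct] at this
  simpa [euNorm, mul_comm] using this

theorem euNorm_le_iff {v : ι → ℝ} {c : ℝ} (hc : 0 ≤ c) : euNorm v ≤ c ↔ v ⬝ᵥ v ≤ c ^ 2 := by
  rw [← euNorm_sq, sq_le_sq₀ (euNorm_nonneg v) hc]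

theorem mulVec_dotProduct_eq (A : Matrix κ ι ℝ) (v : ι → ℝ) (w : κ → ℝ) :
    (A *ᵥ v) ⬝ᵥ w = v ⬝ᵥ (Aᵀ *ᵥ w) := by
  rw [dotProduct_comm, dotProduct_mulVec, dotProduct_comm, ← mulVec_transpose]

theorem euNorm_mulVec_le [DecidableEq ι] {A : Matrix ι ι ℝ} (hA : A.IsHermitian) {q : ℝ}
    (hq : 0 ≤ q) (h : ∀ v, |v ⬝ᵥ (A *ᵥ v)| ≤ q * (v ⬝ᵥ v)) (v : ι → ℝ) :
    euNorm (A *ᵥ v) ≤ q * euNorm v := by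
  rw [euNorm_le_iff (mul_nonneg hq (euNorm_nonneg v)), mul_pow, euNorm_sq]
  exact mulVec_dotProduct_mulVec_le hA h v

/-- A bound on the operator norm of a matrix passes to its transpose. -/
theorem euNorm_transpose_mulVec_le {A : Matrix κ ι ℝ} {q : ℝ} (hq : 0 ≤ q)
    (h : ∀ v, euNorm (A *ᵥ v) ≤ q * euNorm v) (w : κ → ℝ) :
    euNorm (Aᵀ *ᵥ w) ≤ q * euNorm w := by
  rcases (euNorm_nonneg (Aᵀ *ᵥ w)).eq_or_lt with h0 | h0
  · rw [← h0]
    exact mul_nonneg hq (euNorm_nonneg w)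
  -- `‖Aᵀ w‖² = ⟨w, A Aᵀ w⟩`; one factor `‖Aᵀ w‖`, positive here, is then cancelled.
  have h1 : euNorm (Aᵀ *ᵥ w) ^ 2 ≤ q * euNorm (Aᵀ *ᵥ w) * euNorm w := by
    rw [euNorm_sq, mulVec_dotProduct_eq, transpose_transpose]
    calc _ ≤ euNorm w * euNorm (A *ᵥ (Aᵀ *ᵥ w)) := dotProduct_le_euNorm _ _
      _ ≤ euNorm w * (q * euNorm (Aᵀ *ᵥ w)) :=
        mul_le_mul_of_nonneg_left (h _) (euNorm_nonneg w)
      _ = _ := by ring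
  nlinarith

theorem dotProduct_mulVec_le_of_norm_le {p : ℕ} {A : Matrix (Fin p) (Fin p) ℝ} {C : ℝ}
    (h : ‖Matrix.toEuclideanCLM (𝕜 := ℝ) A‖ ≤ C) (v : Fin p → ℝ) :
    v ⬝ᵥ (A *ᵥ v) ≤ C * (v ⬝ᵥ v) := by
  have h1 : euNorm (A *ᵥ v) ≤ C * euNorm v := by
    have := (Matrix.toEuclideanCLM (𝕜 := ℝ) A).le_of_opNorm_le h (WithLp.toLp 2 v)
    simpa [euNorm] using this
  calc v ⬝ᵥ (A *ᵥ v) ≤ euNorm v * euNorm (A *ᵥ v) := dotProduct_le_euNorm _ _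
    _ ≤ euNorm v * (C * euNorm v) := mul_le_mul_of_nonneg_left h1 (euNorm_nonneg v)
    _ = C * (v ⬝ᵥ v) := by rw [← euNorm_sq]; ring

end EuclideanNorm

/-! ### Square roots, sample covariances and the Gram matrix of the rows. -/

section Covariance

variable {n p : ℕ}

open scoped MatrixOrder in
theorem psdSqrt_mul_self {A : Matrix (Fin p) (Fin p) ℝ} (hA : A.PosSemidef) :
    psdSqrt A * psdSqrt A = A :=
  CFC.sqrt_mul_sqrt_self A (Matrix.nonneg_iff_posSemidef.2 hA)

open scoped MatrixOrder in
theorem psdSqrt_transpose (A : Matrix (Fin p) (Fin p) ℝ) : (psdSqrt A)ᵀ = psdSqrt A := by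
  have h := (Matrix.nonneg_iff_posSemidef.1 (CFC.sqrt_nonneg A)).1
  simpa [psdSqrt] using h.eq

theorem sampleCov_posSemidef (X : Matrix (Fin n) (Fin p) ℝ) : (sampleCov X).PosSemidef := by
  have h := Matrix.posSemidef_conjTranspose_mul_self X
  rw [conjTranspose_eq_transpose_of_trivial] at h
  exact h.smul (by positivity)

theorem dotProduct_sampleCov_mulVec (X : Matrix (Fin n) (Fin p) ℝ) (v : Fin p → ℝ) :
    v ⬝ᵥ (sampleCov X *ᵥ v) = (n : ℝ)⁻¹ * ((X *ᵥ v) ⬝ᵥ (X *ᵥ v)) := by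
  rw [sampleCov, smul_mulVec, dotProduct_smul, ← mulVec_mulVec, mulVec_dotProduct_eq, smul_eq_mul]

theorem dotProduct_mulVec_le_sMax {A : Matrix (Fin p) (Fin p) ℝ} (hA : A.IsHermitian)
    (v : Fin p → ℝ) : v ⬝ᵥ (A *ᵥ v) ≤ sMax A * (v ⬝ᵥ v) := by
  refine dotProduct_mulVec_le_of_eigenvalues_le hA (fun i => ?_) v
  rw [sMax, hA.spectrum_real_eq_range_eigenvalues]
  exact le_csSup (Set.finite_range _).bddAbove ⟨i, rfl⟩

/-- If the spectral distribution function of `A` is not one at `x`, then `tr A²` is large. -/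
theorem trace_sq_ge_of_esd {A : Matrix (Fin p) (Fin p) ℝ} (hA : A.PosSemidef) (hp : 0 < p)
    {x : ℝ} (hx : 0 ≤ x) : p * x ^ 2 * (1 - esd A x) ≤ (A ^ 2).trace := by
  have hcount : (Multiset.countP (fun s => s ≤ x) A.charpoly.roots : ℝ) =
      ∑ i, if hA.1.eigenvalues i ≤ x then (1 : ℝ) else 0 := by
    rw [hA.1.roots_charpoly_eq_eigenvalues, Multiset.countP_map, Finset.sum_boole]
    simp [Finset.card, Finset.filter]
  rw [trace_pow_eq_sum hA.1, esd, hcount]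
  have hp' : (p : ℝ) ≠ 0 := by positivity
  have : (p : ℝ) * x ^ 2 * (1 - (∑ i, if hA.1.eigenvalues i ≤ x then (1 : ℝ) else 0) / p) =
      ∑ i, x ^ 2 * (1 - if hA.1.eigenvalues i ≤ x then (1 : ℝ) else 0) := by
    rw [← Finset.mul_sum, Finset.sum_sub_distrib]
    simp only [Finset.sum_const, Finset.card_univ, Fintype.card_fin, nsmul_eq_mul, mul_one]
    field_simp
  rw [this]
  refine Finset.sum_le_sum fun i _ => ?_
  split_ifs with h
  · simpa using sq_nonneg _
  · have := pow_le_pow_left₀ hx (not_le.1 h).le 2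
    simpa using this

/-- The traces are moved to `X Xᵀ`, whose entries are the inner products of the rows; this is the
form in which independence of rows is usable for `m̃₂`. -/
theorem sampleCov_trace (X : Matrix (Fin n) (Fin p) ℝ) :
    (sampleCov X).trace = (n : ℝ)⁻¹ * (X * Xᵀ).trace := by
  rw [sampleCov, trace_smul, trace_mul_comm, smul_eq_mul]

theorem sampleCov_mul_trace (X : Matrix (Fin n) (Fin p) ℝ) :
    (sampleCov X * sampleCov X).trace = (n : ℝ)⁻¹ ^ 2 * ((X * Xᵀ) * (X * Xᵀ)).trace := by
  rw [sampleCov, smul_mul_smul_comm, trace_smul, smul_eq_mul, sq]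
  congr 1
  rw [← Matrix.mul_assoc, trace_mul_comm]
  simp only [Matrix.mul_assoc]

theorem trace_sq_eq_sum_sq {ι : Type*} [Fintype ι] {A : Matrix ι ι ℝ} (hA : Aᵀ = A) :
    (A * A).trace = ∑ i, ∑ k, A i k ^ 2 := by
  simp only [trace, diag_apply, mul_apply]
  refine Finset.sum_congr rfl fun i _ => Finset.sum_congr rfl fun k _ => ?_
  rw [sq, show A k i = A i k from congr_fun (congr_fun hA i) k]

/-- `m̃₂` dominates the average squared inner products between two disjoint groups of rows. -/
theorem mTilde2_ge (X : Matrix (Fin n) (Fin p) ℝ) (hn : 0 < n) (hp : 0 < p)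
    (S : Finset (Fin n)) :
    (∑ i ∈ S, ∑ k ∈ Sᶜ, (X * Xᵀ) i k ^ 2) / ((n : ℝ) ^ 2 * p) ≤ mTilde2 X := by
  have hn' : (0 : ℝ) < n := by exact_mod_cast hn
  have hp' : (0 : ℝ) < p := by exact_mod_cast hp
  set W := X * Xᵀ with hW
  have hWs : Wᵀ = W := by rw [hW, transpose_mul, transpose_transpose]
  have e : mTilde2 X = (∑ i, ∑ k, W i k ^ 2 - (∑ i, W i i) ^ 2 / n) / ((n : ℝ) ^ 2 * p) := by
    rw [mTilde2, mHat2, mHat1, aspect, sampleCov_trace, sampleCov_mul_trace,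
      ← hW, trace_sq_eq_sum_sq hWs]
    simp only [trace, diag_apply]
    field_simp
  rw [e]
  refine div_le_div_of_nonneg_right ?_ (by positivity)
  -- The term subtracted in `m̃₂` depends only on the diagonal of the Gram matrix, and by
  -- Cauchy-Schwarz the squared diagonal entries already cover it. The off-diagonal squares are left
  -- over.
  have hcs : (∑ i, W i i) ^ 2 / n ≤ ∑ i, W i i ^ 2 := by
    rw [div_le_iff₀ hn']
    have := sq_sum_le_card_mul_sum_sq (s := Finset.univ) (f := fun i => W i i)
    simpa [mul_comm] using this
  have hsplit : ∑ i ∈ S, ∑ k ∈ Sᶜ, W i k ^ 2 + ∑ i, W i i ^ 2 ≤ ∑ i, ∑ k, W i k ^ 2 := by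
    have h1 : ∑ i ∈ S, ∑ k ∈ Sᶜ, W i k ^ 2 =
        ∑ i, if i ∈ S then ∑ k ∈ Sᶜ, W i k ^ 2 else 0 := by simp
    rw [h1, ← Finset.sum_add_distrib]
    refine Finset.sum_le_sum fun i _ => ?_
    split_ifs with h
    · have hi : i ∉ Sᶜ := by simpa using h
      rw [add_comm, ← Finset.sum_insert (f := fun k => W i k ^ 2) hi]
      exact Finset.sum_le_sum_of_subset_of_nonneg (Finset.subset_univ _) fun _ _ _ => sq_nonneg _
    · rw [zero_add]
      exact Finset.single_le_sum (f := fun k => W i k ^ 2) (fun _ _ => sq_nonneg _)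
        (Finset.mem_univ i)
  linarith

end Covariance

/-! ### Quadratic forms in independent standardized variables -/

section QuadraticForm

variable {Ω : Type*} [MeasurableSpace Ω] {P : Measure Ω}

/-- A random vector with independent standardized entries whose fourth moments are at most `M`. -/
structure StdEntries {ι : Type*} (P : Measure Ω) (ξ : Ω → ι → ℝ) (M : ℝ) : Prop where
  measurable : ∀ i, Measurable fun ω => ξ ω i
  indep : iIndepFun (fun i ω => ξ ω i) P
  mean : ∀ i, ∫ ω, ξ ω i ∂P = 0
  second_moment : ∀ i, ∫ ω, ξ ω i ^ 2 ∂P = 1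
  integrable_fourth : ∀ i, Integrable (fun ω => ξ ω i ^ 4) P
  fourth_moment : ∀ i, ∫ ω, ξ ω i ^ 4 ∂P ≤ M

namespace StdEntries

variable {ι κ : Type*} {ξ : Ω → ι → ℝ} {M : ℝ}

theorem precomp (h : StdEntries P ξ M) {f : κ → ι} (hf : Function.Injective f) :
    StdEntries P (fun ω k => ξ ω (f k)) M where
  measurable _ := h.measurable _
  indep := h.indep.precomp hf
  mean _ := h.mean _
  second_moment _ := h.second_moment _
  integrable_fourth _ := h.integrable_fourth _
  fourth_moment _ := h.fourth_moment _

theorem memLp_four (h : StdEntries P ξ M) (i : ι) : MemLp (fun ω => ξ ω i) 4 P := by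
  rw [← integrable_norm_rpow_iff (h.measurable i).aestronglyMeasurable (by norm_num) (by norm_num)]
  convert h.integrable_fourth i using 2 with ω
  rw [ENNReal.toReal_ofNat, Real.norm_eq_abs, Real.rpow_ofNat]
  exact Even.pow_abs (by decide) _

/-- Hölder with exponents `4, 4, 2`: fourth moments alone make all products of four entries
integrable, without any independence. -/
theorem memLp_mul (h : StdEntries P ξ M) (i j : ι) :
    MemLp (fun ω => ξ ω i * ξ ω j) 2 P := by
  have : ENNReal.HolderTriple 4 4 2 := ⟨by
    rw [show (4 : ℝ≥0∞) = 2 * 2 by norm_num, ENNReal.mul_inv (by simp) (by simp), ← mul_add,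
      ENNReal.inv_two_add_inv_two, mul_one]⟩
  exact (h.memLp_four j).mul (h.memLp_four i)

theorem integrable_mul_mul (h : StdEntries P ξ M) (i j k l : ι) :
    Integrable (fun ω => ξ ω i * ξ ω j * (ξ ω k * ξ ω l)) P :=
  (h.memLp_mul i j).integrable_mul (h.memLp_mul k l)

theorem fourth_nonneg (h : StdEntries P ξ M) (i : ι) : 0 ≤ M :=
  (integral_nonneg fun ω => by positivity).trans (h.fourth_moment i)

theorem integral_mul [DecidableEq ι] (h : StdEntries P ξ M) (i j : ι) :
    ∫ ω, ξ ω i * ξ ω j ∂P = if i = j then 1 else 0 := by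
  split_ifs with hij
  · subst hij
    simpa [sq] using h.second_moment i
  · have := (h.indep.indepFun hij).integral_fun_mul_eq_mul_integral
      (h.measurable i).aestronglyMeasurable (h.measurable j).aestronglyMeasurable
    rw [this, h.mean, zero_mul]

theorem integral_sq_mul_sq (h : StdEntries P ξ M) {i k : ι} (hk : i ≠ k) :
    ∫ ω, ξ ω i * ξ ω i * (ξ ω k * ξ ω k) ∂P = 1 := by
  have h1 := (h.indep.indepFun hk).comp (φ := fun x => x * x) (ψ := fun x => x * x)
    (by fun_prop) (by fun_prop)
  have h2 := h1.integral_fun_mul_eq_mul_integral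
    ((h.measurable i).mul (h.measurable i)).aestronglyMeasurable
    ((h.measurable k).mul (h.measurable k)).aestronglyMeasurable
  classical
  have h3 := h.integral_mul i i
  have h4 := h.integral_mul k k
  simp only [Function.comp_def, if_true] at h2 h3 h4
  rw [h2, h3, h4, one_mul]

/-- The entry with the isolated index is independent of the other three jointly, which may coincide
among themselves, and has mean zero. -/
theorem integral_mul_mul_eq_zero (h : StdEntries P ξ M) {i j k l : ι} (hj : i ≠ j)
    (hk : i ≠ k) (hl : i ≠ l) : ∫ ω, ξ ω i * ξ ω j * (ξ ω k * ξ ω l) ∂P = 0 := by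
  classical
  have h1 := h.indep.indepFun_finset {i} {j, k, l} (by simp [hj, hk, hl]) h.measurable
  have m1 : Measurable fun f : ({i} : Finset ι) → ℝ => f ⟨i, by simp⟩ := measurable_pi_apply _
  have m2 : Measurable fun f : ({j, k, l} : Finset ι) → ℝ =>
      f ⟨j, by simp⟩ * (f ⟨k, by simp⟩ * f ⟨l, by simp⟩) := by fun_prop
  have h2 := h1.comp m1 m2
  have h3 := h2.integral_fun_mul_eq_mul_integral
    ((h.measurable i).aestronglyMeasurable)
    (((h.measurable j).mul ((h.measurable k).mul (h.measurable l))).aestronglyMeasurable)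
  simp only [Function.comp_def] at h3
  rw [h.mean, zero_mul] at h3
  rw [← h3]
  refine integral_congr_ae (ae_of_all _ fun ω => ?_)
  simp only
  ring

/-- Wick's formula with its non-Gaussian correction: three pairings, plus the fourth cumulant when
all indices agree, where the pairings already contribute `3`. -/
theorem integral_mul_mul [DecidableEq ι] (h : StdEntries P ξ M) (i j k l : ι) :
    ∫ ω, ξ ω i * ξ ω j * (ξ ω k * ξ ω l) ∂P =
      (if i = j then if k = l then 1 else 0 else 0) +
      (if i = k then if j = l then 1 else 0 else 0) +
      (if i = l then if j = k then 1 else 0 else 0) +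
      (if i = j then if i = k then if i = l then ∫ ω, ξ ω i ^ 4 ∂P - 3 else 0 else 0 else 0) := by
  have sw : ∀ a b c d a' b' c' d' : ι,
      (∀ ω, ξ ω a * ξ ω b * (ξ ω c * ξ ω d) = ξ ω a' * ξ ω b' * (ξ ω c' * ξ ω d')) →
      ∫ ω, ξ ω a * ξ ω b * (ξ ω c * ξ ω d) ∂P = ∫ ω, ξ ω a' * ξ ω b' * (ξ ω c' * ξ ω d') ∂P :=
    fun a b c d a' b' c' d' hh => integral_congr_ae (ae_of_all _ hh)
  by_cases hij : i = j
  · subst hij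
    by_cases hik : i = k
    · subst hik
      by_cases hil : i = l
      · subst hil
        have : ∫ ω, ξ ω i * ξ ω i * (ξ ω i * ξ ω i) ∂P = ∫ ω, ξ ω i ^ 4 ∂P :=
          integral_congr_ae (ae_of_all _ fun ω => by ring)
        simp only [if_true, this]
        ring
      · rw [sw i i i l l i i i (fun ω => by ring),
          h.integral_mul_mul_eq_zero (Ne.symm hil) (Ne.symm hil) (Ne.symm hil)]
        simp [hil]
    · by_cases hkl : k = l
      · subst hkl
        rw [h.integral_sq_mul_sq hik]
        simp [hik]
      · rw [sw i i k l k i i l (fun ω => by ring),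
          h.integral_mul_mul_eq_zero (Ne.symm hik) (Ne.symm hik) hkl]
        simp [hik, hkl]
  · by_cases hik : i = k
    · subst hik
      by_cases hjl : j = l
      · subst hjl
        rw [sw i j i j i i j j (fun ω => by ring), h.integral_sq_mul_sq hij]
        simp [hij]
      · rw [sw i j i l j i i l (fun ω => by ring),
          h.integral_mul_mul_eq_zero (Ne.symm hij) (Ne.symm hij) hjl]
        simp [hij, hjl, Ne.symm hij]
    · by_cases hil : i = l
      · subst hil
        by_cases hjk : j = k
        · subst hjk
          rw [sw i j j i i i j j (fun ω => by ring), h.integral_sq_mul_sq hij]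
          simp [hij]
        · rw [sw i j k i j i k i (fun ω => by ring),
            h.integral_mul_mul_eq_zero (Ne.symm hij) hjk (Ne.symm hij)]
          simp [hij, hjk, hik]
      · rw [h.integral_mul_mul_eq_zero hij hik hil]
        simp [hij, hik, hil]

variable [IsProbabilityMeasure P]

theorem integrable_mul (h : StdEntries P ξ M) (i j : ι) :
    Integrable (fun ω => ξ ω i * ξ ω j) P :=
  (h.memLp_mul i j).integrable (by norm_num)

variable [Fintype ι]

/-- The variance of a quadratic form is at most a multiple of the squared Frobenius norm. -/
theorem integral_quadForm_sq_le (h : StdEntries P ξ M) {A : Matrix ι ι ℝ} (hA : Aᵀ = A) :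
    Integrable (fun ω => (ξ ω ⬝ᵥ (A *ᵥ ξ ω) - A.trace) ^ 2) P ∧
    ∫ ω, (ξ ω ⬝ᵥ (A *ᵥ ξ ω) - A.trace) ^ 2 ∂P ≤ (M + 2) * (A * A).trace := by
  classical
  have hsym : ∀ i j, A j i = A i j := fun i j => congr_fun (congr_fun hA i) j
  have e : ∀ ω, (ξ ω ⬝ᵥ (A *ᵥ ξ ω) - A.trace) ^ 2 =
      ∑ x : ι × ι, ∑ y : ι × ι, A x.1 x.2 * A y.1 y.2 *
        ((ξ ω x.1 * ξ ω x.2 - if x.1 = x.2 then 1 else 0) *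
          (ξ ω y.1 * ξ ω y.2 - if y.1 = y.2 then 1 else 0)) := by
    intro ω
    have : ξ ω ⬝ᵥ (A *ᵥ ξ ω) - A.trace =
        ∑ x : ι × ι, A x.1 x.2 * (ξ ω x.1 * ξ ω x.2 - if x.1 = x.2 then 1 else 0) := by
      rw [Fintype.sum_prod_type]
      simp only [dotProduct, mulVec, trace, diag_apply, Finset.mul_sum, mul_sub,
        Finset.sum_sub_distrib, mul_ite, mul_one, mul_zero, Finset.sum_ite_eq, Finset.mem_univ,
        if_true]
      congr 1
      exact Finset.sum_congr rfl fun i _ => Finset.sum_congr rfl fun j _ => by ring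
    rw [this, sq, Finset.sum_mul_sum]
    exact Finset.sum_congr rfl fun i _ => Finset.sum_congr rfl fun j _ => by ring
  have hL2 : ∀ x : ι × ι, MemLp (fun ω => ξ ω x.1 * ξ ω x.2 - if x.1 = x.2 then 1 else 0) 2 P :=
    fun x => (h.memLp_mul x.1 x.2).sub (memLp_const _)
  have hint : ∀ x y : ι × ι, Integrable (fun ω => A x.1 x.2 * A y.1 y.2 *
        ((ξ ω x.1 * ξ ω x.2 - if x.1 = x.2 then 1 else 0) *
          (ξ ω y.1 * ξ ω y.2 - if y.1 = y.2 then 1 else 0))) P :=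
    fun x y => ((hL2 x).integrable_mul (hL2 y)).const_mul _
  -- Centring removes the pairing inside each product. The two crossed pairings give `2 tr A²` by
  -- symmetry, and the cumulant term is at most `M ∑ Aᵢᵢ² ≤ M tr A²`.
  have hval : ∀ x y : ι × ι, ∫ ω, A x.1 x.2 * A y.1 y.2 *
        ((ξ ω x.1 * ξ ω x.2 - if x.1 = x.2 then 1 else 0) *
          (ξ ω y.1 * ξ ω y.2 - if y.1 = y.2 then 1 else 0)) ∂P =
      A x.1 x.2 * A y.1 y.2 * ((if x.1 = y.1 then if x.2 = y.2 then 1 else 0 else 0) +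
      (if x.1 = y.2 then if x.2 = y.1 then 1 else 0 else 0) +
      (if x.1 = x.2 then if x.1 = y.1 then if x.1 = y.2 then ∫ ω, ξ ω x.1 ^ 4 ∂P - 3
        else 0 else 0 else 0)) := by
    intro x y
    rw [integral_const_mul]
    congr 1
    set a : ℝ := if x.1 = x.2 then 1 else 0 with ha
    set b : ℝ := if y.1 = y.2 then 1 else 0 with hb
    have e1 : ∀ ω, (ξ ω x.1 * ξ ω x.2 - a) * (ξ ω y.1 * ξ ω y.2 - b) =
        ξ ω x.1 * ξ ω x.2 * (ξ ω y.1 * ξ ω y.2) - b * (ξ ω x.1 * ξ ω x.2) -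
          a * (ξ ω y.1 * ξ ω y.2) + a * b := fun ω => by ring
    simp only [e1]
    rw [integral_add, integral_sub, integral_sub, integral_const_mul, integral_const_mul,
      h.integral_mul, h.integral_mul, ← ha, ← hb, h.integral_mul_mul]
    · have : (if x.1 = x.2 then if y.1 = y.2 then (1 : ℝ) else 0 else 0) = a * b := by
        rw [ha, hb]; split_ifs <;> simp
      rw [this]
      simp
      ring
    · exact h.integrable_mul_mul _ _ _ _
    · exact (h.integrable_mul _ _).const_mul _
    · exact (h.integrable_mul_mul _ _ _ _).sub ((h.integrable_mul _ _).const_mul _)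
    · exact (h.integrable_mul _ _).const_mul _
    · exact ((h.integrable_mul_mul _ _ _ _).sub ((h.integrable_mul _ _).const_mul _)).sub
        ((h.integrable_mul _ _).const_mul _)
    · exact integrable_const _
  have hsum : ∀ x ∈ (Finset.univ : Finset (ι × ι)), Integrable (fun ω => ∑ y : ι × ι,
      A x.1 x.2 * A y.1 y.2 * ((ξ ω x.1 * ξ ω x.2 - if x.1 = x.2 then 1 else 0) *
          (ξ ω y.1 * ξ ω y.2 - if y.1 = y.2 then 1 else 0))) P :=
    fun x _ => integrable_finsetSum _ fun y _ => hint x y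
  simp only [e]
  refine ⟨integrable_finsetSum _ hsum, ?_⟩
  rw [integral_finsetSum _ hsum]
  simp_rw [integral_finsetSum _ (fun y _ => hint _ y), hval]
  rw [trace_sq_eq_sum_sq hA, Fintype.sum_prod_type, Finset.mul_sum]
  refine Finset.sum_le_sum fun i _ => ?_
  rw [Finset.mul_sum]
  refine Finset.sum_le_sum fun j _ => ?_
  rw [Fintype.sum_prod_type]
  simp only [mul_add, Finset.sum_add_distrib, mul_ite, mul_one, mul_zero, Finset.sum_ite_eq,
    Finset.mem_univ, if_true]
  have h1 : ∑ x, ∑ x_1, (if i = x then if j = x_1 then A i j * A x x_1 else 0 else 0) =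
      A i j * A i j := by
    rw [Finset.sum_eq_single i] <;> simp +contextual [eq_comm]
  have h3 : ∑ x, ∑ x_1, (if i = j then if i = x then if i = x_1 then
      A i j * A x x_1 * (∫ ω, ξ ω i ^ 4 ∂P - 3) else 0 else 0 else 0) ≤ M * A i j ^ 2 := by
    by_cases hij : i = j
    · subst hij
      rw [Finset.sum_eq_single i]
      · simp only [if_true, Finset.sum_ite_eq, Finset.mem_univ]
        nlinarith [h.fourth_moment i, sq_nonneg (A i i)]
      · intro b _ hb
        simp [Ne.symm hb]
      · simp
    · simp only [hij, if_false, Finset.sum_const_zero]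
      exact mul_nonneg (h.fourth_nonneg i) (sq_nonneg _)
  rw [h1, hsym i j]
  nlinarith [h3]

/-- The variance of a squared norm `‖N ξ‖²`. -/
theorem lintegral_sqNorm_sub_trace_sq_le [Fintype κ] (h : StdEntries P ξ M)
    (N : Matrix κ ι ℝ) :
    ∫⁻ ω, ENNReal.ofReal (((N *ᵥ ξ ω) ⬝ᵥ (N *ᵥ ξ ω) - (N * Nᵀ).trace) ^ 2) ∂P ≤
      ENNReal.ofReal ((M + 2) * ((N * Nᵀ) * (N * Nᵀ)).trace) := by
  have hA : (Nᵀ * N)ᵀ = Nᵀ * N := by rw [transpose_mul, transpose_transpose]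
  obtain ⟨h1, h2⟩ := h.integral_quadForm_sq_le hA
  have e1 : ∀ v : ι → ℝ, (N *ᵥ v) ⬝ᵥ (N *ᵥ v) = v ⬝ᵥ ((Nᵀ * N) *ᵥ v) := fun v => by
    rw [mulVec_dotProduct_eq, mulVec_mulVec]
  have e2 : ((N * Nᵀ) * (N * Nᵀ)).trace = ((Nᵀ * N) * (Nᵀ * N)).trace := by
    rw [Matrix.mul_assoc, trace_mul_comm]
    simp only [Matrix.mul_assoc]
  simp only [e1, e2, trace_mul_comm N]
  rw [← ofReal_integral_eq_lintegral_ofReal h1 (ae_of_all _ fun ω => sq_nonneg _)]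
  exact ENNReal.ofReal_le_ofReal h2

end StdEntries

end QuadraticForm

/-! ### Conditioning on an independent variable -/

section Conditioning

variable {Ω α β : Type*} [MeasurableSpace Ω] [MeasurableSpace α] [MeasurableSpace β]
  {P : Measure Ω} [IsProbabilityMeasure P]

/-- Fubini for the joint law, a product by independence: `W` is frozen, the bound is proved for each
value, and the bound is averaged. This is how all conditioning on the design or on a block of rows
is carried out. -/
theorem lintegral_le_of_indepFun {W : Ω → α} {ξ : Ω → β} (hW : Measurable W)
    (hξ : Measurable ξ) (hind : IndepFun W ξ P) {F : α → β → ℝ≥0∞}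
    (hF : Measurable (Function.uncurry F)) {G : α → ℝ≥0∞} (hG : Measurable G)
    (h : ∀ w, ∫⁻ ω, F w (ξ ω) ∂P ≤ G w) :
    ∫⁻ ω, F (W ω) (ξ ω) ∂P ≤ ∫⁻ ω, G (W ω) ∂P := by
  have h1 := (indepFun_iff_map_prod_eq_prod_map_map hW.aemeasurable hξ.aemeasurable).1 hind
  have := Measure.isProbabilityMeasure_map (μ := P) hW.aemeasurable
  have := Measure.isProbabilityMeasure_map (μ := P) hξ.aemeasurable
  calc ∫⁻ ω, F (W ω) (ξ ω) ∂P
      = ∫⁻ x, Function.uncurry F x ∂(P.map fun ω => (W ω, ξ ω)) :=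
        (lintegral_map hF (hW.prodMk hξ)).symm
    _ = ∫⁻ w, ∫⁻ x, F w x ∂(P.map ξ) ∂(P.map W) := by
        rw [h1, lintegral_prod _ hF.aemeasurable]
        rfl
    _ = ∫⁻ w, ∫⁻ ω, F w (ξ ω) ∂P ∂(P.map W) := by
        refine lintegral_congr fun w => ?_
        exact lintegral_map (hF.comp measurable_prodMk_left) hξ
    _ ≤ ∫⁻ w, G w ∂(P.map W) := lintegral_mono h
    _ = ∫⁻ ω, G (W ω) ∂P := lintegral_map hG hW

end Conditioning

/-! ### A bound for the norm of a matrix with independent rows -/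

section RowSums

variable {Ω : Type*} [MeasurableSpace Ω] {P : Measure Ω} {ι κ : Type*} [Fintype κ]

theorem dotProduct_gram_mulVec (R : Matrix κ κ ℝ) (x : κ → ℝ) :
    x ⬝ᵥ ((Rᵀ * R) *ᵥ x) = ∑ r, (R r ⬝ᵥ x) ^ 2 := by
  rw [← mulVec_mulVec, ← mulVec_dotProduct_eq]
  simp [dotProduct, mulVec, sq]

open scoped MatrixOrder in
/-- A random vector with covariance at most the identity satisfies `E xᵀ N x ≤ tr N`. -/
theorem lintegral_quadForm_le_trace [DecidableEq κ] {w : Ω → κ → ℝ} (hw : Measurable w)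
    (hcov : ∀ x, ∫⁻ ω, ENNReal.ofReal ((x ⬝ᵥ w ω) ^ 2) ∂P ≤ ENNReal.ofReal (x ⬝ᵥ x))
    {N : Matrix κ κ ℝ} (hN : N.PosSemidef) :
    ∫⁻ ω, ENNReal.ofReal (w ω ⬝ᵥ (N *ᵥ w ω)) ∂P ≤ ENNReal.ofReal N.trace := by
  -- Factoring `N` turns the form into a sum of squared projections on the rows of `R`, to each of
  -- which the covariance bound applies.
  obtain ⟨R, hR⟩ : ∃ R : Matrix κ κ ℝ, N = Rᵀ * R := by
    have h := (Matrix.nonneg_iff_posSemidef.1 (CFC.sqrt_nonneg N)).1.eq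
    rw [conjTranspose_eq_transpose_of_trivial] at h
    refine ⟨CFC.sqrt N, ?_⟩
    rw [h, CFC.sqrt_mul_sqrt_self N (Matrix.nonneg_iff_posSemidef.2 hN)]
  have ht : N.trace = ∑ r, R r ⬝ᵥ R r := by
    rw [hR, trace_mul_comm]
    simp [trace, mul_apply, dotProduct]
  simp only [hR, dotProduct_gram_mulVec] at ht ⊢
  rw [ht, ENNReal.ofReal_sum_of_nonneg fun r _ => by
    simpa using dotProduct_star_self_nonneg (R r)]
  calc _ = ∫⁻ ω, ∑ r, ENNReal.ofReal ((R r ⬝ᵥ w ω) ^ 2) ∂P :=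
        lintegral_congr fun ω => ENNReal.ofReal_sum_of_nonneg fun r _ => sq_nonneg _
    _ = ∑ r, ∫⁻ ω, ENNReal.ofReal ((R r ⬝ᵥ w ω) ^ 2) ∂P := by
        refine lintegral_finsetSum _ fun r _ => ?_
        simp only [dotProduct]
        fun_prop
    _ ≤ _ := Finset.sum_le_sum fun r _ => hcov _

theorem posSemidef_sum_vecMulVec (I : Finset ι) (w : ι → κ → ℝ) :
    (∑ i ∈ I, vecMulVec (w i) (w i)).PosSemidef :=
  Matrix.posSemidef_sum _ fun i _ => by simpa using posSemidef_vecMulVec_self_star (w i)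

/-- Trace moments of a sum of independent rank one matrices `wᵢ wᵢᵀ` with `‖wᵢ‖² ≤ L` and
covariance at most the identity. -/
theorem lintegral_trace_pow_le [IsProbabilityMeasure P] [DecidableEq ι] [DecidableEq κ]
    {w : ι → Ω → κ → ℝ} (hw : ∀ i, Measurable (w i))
    (hind : ∀ (I : Finset ι) (i : ι), i ∉ I →
      IndepFun (fun ω (k : I) => w k ω) (w i) P)
    (hcov : ∀ i x, ∫⁻ ω, ENNReal.ofReal ((x ⬝ᵥ w i ω) ^ 2) ∂P ≤ ENNReal.ofReal (x ⬝ᵥ x))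
    {L : ℝ} (hL : ∀ i ω, w i ω ⬝ᵥ w i ω ≤ L) (m : ℕ) :
    ∀ (a : ℕ) (I : Finset ι), (I.card : ℝ) ≤ L →
      ∫⁻ ω, ENNReal.ofReal (((∑ i ∈ I, vecMulVec (w i ω) (w i ω) +
        (a * L) • (1 : Matrix κ κ ℝ)) ^ m).trace) ∂P ≤
      ENNReal.ofReal (Fintype.card κ * ((a + m) * L) ^ m) := by
  -- The shift `a` and the index set `I` stay general, since the step for exponent `m + 1` calls the
  -- bound for `m` with one row fewer and one more unit of shift.
  induction m with
  | zero =>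
    intro a I _
    simp
  | succ m ih =>
    intro a I hI
    have hL0 : 0 ≤ L := le_trans (by positivity) hI
    set S : Finset ι → Ω → Matrix κ κ ℝ := fun I ω => ∑ i ∈ I, vecMulVec (w i ω) (w i ω) with hS
    have hpsd : ∀ (I : Finset ι) (b : ℕ) ω, (S I ω + (b * L) • (1 : Matrix κ κ ℝ)).PosSemidef :=
      fun I b ω => (posSemidef_sum_vecMulVec I fun i => w i ω).add
        (PosSemidef.one.smul (by positivity))
    have hSe : ∀ (I : Finset ι) ω, S I ω = ∑ k : I, vecMulVec (w k ω) (w k ω) := fun I ω =>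
      (Finset.sum_coe_sort I fun k => vecMulVec (w k ω) (w k ω)).symm
    have hwI : ∀ I : Finset ι, Measurable fun ω (k : I) => w k ω :=
      fun I => measurable_pi_lambda _ fun k => hw k
    have hmeas : ∀ (I : Finset ι) (b c : ℕ), Measurable fun ω =>
        ENNReal.ofReal (((S I ω + (b * L) • (1 : Matrix κ κ ℝ)) ^ c).trace) := fun I b c => by
      have : Continuous fun y : I → κ → ℝ =>
        ((∑ k, vecMulVec (y k) (y k) + (b * L) • (1 : Matrix κ κ ℝ)) ^ c).trace := by fun_prop
      simp only [hSe]
      exact (this.measurable.comp (hwI I)).ennreal_ofReal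
    have hpt : ∀ ω, ((S I ω + (a * L) • (1 : Matrix κ κ ℝ)) ^ (m + 1)).trace =
        ∑ i ∈ I, w i ω ⬝ᵥ ((S I ω + (a * L) • (1 : Matrix κ κ ℝ)) ^ m *ᵥ w i ω) +
          a * L * ((S I ω + (a * L) • (1 : Matrix κ κ ℝ)) ^ m).trace := by
      intro ω
      rw [pow_succ', add_mul, trace_add, smul_mul_assoc, one_mul, trace_smul, smul_eq_mul]
      congr 1
      nth_rewrite 1 [hS]
      simp only
      rw [Finset.sum_mul, trace_sum]
      refine Finset.sum_congr rfl fun i _ => ?_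
      rw [vecMulVec_mul, trace_vecMulVec, dotProduct_comm, ← dotProduct_mulVec]
    have hstep : ∀ i ∈ I, ∫⁻ ω, ENNReal.ofReal
        (w i ω ⬝ᵥ ((S I ω + (a * L) • (1 : Matrix κ κ ℝ)) ^ m *ᵥ w i ω)) ∂P ≤
        ENNReal.ofReal (Fintype.card κ * ((a + 1 + m) * L) ^ m) := by
      intro i hi
      -- Decoupling: `wᵢ` is deleted from the sum in exchange for a shift by `L`. The remaining
      -- matrix is independent of `wᵢ`, so the quadratic form averages to at most a trace.
      have h1 : ∀ ω, w i ω ⬝ᵥ ((S I ω + (a * L) • (1 : Matrix κ κ ℝ)) ^ m *ᵥ w i ω) ≤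
          w i ω ⬝ᵥ ((S (I.erase i) ω + ((a + 1 : ℕ) * L) • (1 : Matrix κ κ ℝ)) ^ m *ᵥ w i ω) := by
        intro ω
        have e : S I ω = S (I.erase i) ω + vecMulVec (w i ω) (w i ω) :=
          (Finset.sum_erase_add I _ hi).symm
        have := dotProduct_rankOne_pow_le (hpsd (I.erase i) a ω) (hL i ω) m
        rw [e, add_right_comm]
        refine this.trans_eq ?_
        rw [add_assoc, ← add_smul]
        push_cast
        rw [add_mul, one_mul]
      refine (lintegral_mono fun ω => ENNReal.ofReal_le_ofReal (h1 ω)).trans ?_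
      have h2 := lintegral_le_of_indepFun (P := P)
        (W := fun ω (k : (I.erase i : Finset ι)) => w k ω) (ξ := w i)
        (measurable_pi_lambda _ fun k => hw k) (hw i) (hind _ i (by simp))
        (F := fun y x => ENNReal.ofReal
          (x ⬝ᵥ ((∑ k, vecMulVec (y k) (y k) + ((a + 1 : ℕ) * L) • (1 : Matrix κ κ ℝ)) ^ m *ᵥ x)))
        (by
          refine (Continuous.measurable ?_).ennreal_ofReal
          fun_prop)
        (G := fun y => ENNReal.ofReal
          (((∑ k, vecMulVec (y k) (y k) + ((a + 1 : ℕ) * L) • (1 : Matrix κ κ ℝ)) ^ m).trace))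
        (by
          refine (Continuous.measurable ?_).ennreal_ofReal
          fun_prop)
        (fun y => lintegral_quadForm_le_trace (hw i) (hcov i) (PosSemidef.pow
          ((posSemidef_sum_vecMulVec _ y).add (PosSemidef.one.smul (by positivity))) m))
      simp only [← hSe] at h2
      refine h2.trans ((ih (a + 1) (I.erase i) ?_).trans_eq ?_)
      · exact le_trans (by exact_mod_cast Finset.card_erase_le) hI
      · push_cast
        ring_nf
    have hmid : ∫⁻ ω, ENNReal.ofReal (((S I ω + (a * L) • (1 : Matrix κ κ ℝ)) ^ m).trace) ∂P ≤
        ENNReal.ofReal (Fintype.card κ * ((a + 1 + m) * L) ^ m) := by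
      refine (ih a I hI).trans (ENNReal.ofReal_le_ofReal ?_)
      gcongr
      linarith
    have hnn : ∀ ω, ∀ i ∈ I, 0 ≤
        w i ω ⬝ᵥ ((S I ω + (a * L) • (1 : Matrix κ κ ℝ)) ^ m *ᵥ w i ω) := fun ω i _ => by
      simpa using ((hpsd I a ω).pow m).dotProduct_mulVec_nonneg (w i ω)
    have hmq : ∀ i ∈ I, Measurable fun ω => ENNReal.ofReal
        (w i ω ⬝ᵥ ((S I ω + (a * L) • (1 : Matrix κ κ ℝ)) ^ m *ᵥ w i ω)) := fun i hi => by
      have : Continuous fun y : I → κ → ℝ => y ⟨i, hi⟩ ⬝ᵥ ((∑ k, vecMulVec (y k) (y k) +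
        (a * L) • (1 : Matrix κ κ ℝ)) ^ m *ᵥ y ⟨i, hi⟩) := by fun_prop
      simp only [hSe]
      exact (this.measurable.comp (hwI I)).ennreal_ofReal
    calc ∫⁻ ω, ENNReal.ofReal (((S I ω + (a * L) • (1 : Matrix κ κ ℝ)) ^ (m + 1)).trace) ∂P
        = ∫⁻ ω, (∑ i ∈ I, ENNReal.ofReal
            (w i ω ⬝ᵥ ((S I ω + (a * L) • (1 : Matrix κ κ ℝ)) ^ m *ᵥ w i ω)) +
            ENNReal.ofReal (a * L) *
              ENNReal.ofReal (((S I ω + (a * L) • (1 : Matrix κ κ ℝ)) ^ m).trace)) ∂P := by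
          refine lintegral_congr fun ω => ?_
          rw [hpt, ENNReal.ofReal_add (Finset.sum_nonneg (hnn ω))
            (mul_nonneg (by positivity) ((hpsd I a ω).pow m).trace_nonneg),
            ENNReal.ofReal_sum_of_nonneg (hnn ω), ENNReal.ofReal_mul (by positivity)]
      _ = ∑ i ∈ I, ∫⁻ ω, ENNReal.ofReal
            (w i ω ⬝ᵥ ((S I ω + (a * L) • (1 : Matrix κ κ ℝ)) ^ m *ᵥ w i ω)) ∂P +
            ENNReal.ofReal (a * L) * ∫⁻ ω,
              ENNReal.ofReal (((S I ω + (a * L) • (1 : Matrix κ κ ℝ)) ^ m).trace) ∂P := by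
          rw [lintegral_add_right _ ((hmeas I a m).const_mul _), lintegral_finsetSum _ hmq,
            lintegral_const_mul _ (hmeas I a m)]
      _ ≤ ∑ i ∈ I, ENNReal.ofReal (Fintype.card κ * ((a + 1 + m) * L) ^ m) +
            ENNReal.ofReal (a * L) * ENNReal.ofReal (Fintype.card κ * ((a + 1 + m) * L) ^ m) :=
          add_le_add (Finset.sum_le_sum hstep) (mul_le_mul_right hmid _)
      _ ≤ ENNReal.ofReal (Fintype.card κ * ((a + (m + 1 : ℕ)) * L) ^ (m + 1)) := by
          rw [Finset.sum_const, nsmul_eq_mul, ← ENNReal.ofReal_natCast, ← ENNReal.ofReal_mul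
            (by positivity), ← ENNReal.ofReal_mul (by positivity), ← ENNReal.ofReal_add
            (by positivity) (by positivity)]
          -- At most `L` rows contribute one copy each and the shift contributes `a L` copies of the
          -- common bound. The total factor `(a + 1) L` is at most the missing factor `(a + 1 + m)
          -- L`.
          refine ENNReal.ofReal_le_ofReal ?_
          have e : ((a : ℝ) + (m + 1 : ℕ)) = a + 1 + m := by push_cast; ring
          rw [e, pow_succ]
          set T : ℝ := ((a + 1 + m) * L) ^ m with hT
          have hT0 : 0 ≤ T := by positivity
          have hc : (0 : ℝ) ≤ Fintype.card κ * T := by positivity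
          have hm : (0 : ℝ) ≤ m * L := by positivity
          nlinarith [mul_le_mul_of_nonneg_right hI hc, mul_nonneg hm hc]

end RowSums

/-! ### Row truncation and the operator norm of the design. -/

section DesignNorm

variable {Ω : Type*} [MeasurableSpace Ω] {P : Measure Ω}

theorem StdEntries.indepFun_of_disjoint {ι κ κ' : Type*} [Fintype κ] [Fintype κ']
    {ξ : Ω → ι → ℝ} {M : ℝ} (h : StdEntries P ξ M) {f : κ → ι} {g : κ' → ι}
    (hfg : ∀ a b, f a ≠ g b) :
    IndepFun (fun ω a => ξ ω (f a)) (fun ω b => ξ ω (g b)) P := by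
  classical
  have h1 := h.indep.indepFun_finset (Finset.univ.image f) (Finset.univ.image g)
    (by
      rw [Finset.disjoint_left]
      rintro _ ha hb
      obtain ⟨a, _, rfl⟩ := Finset.mem_image.1 ha
      obtain ⟨b, _, hb⟩ := Finset.mem_image.1 hb
      exact hfg a b hb.symm) h.measurable
  have m1 : Measurable fun (y : ↥(Finset.univ.image f) → ℝ) (a : κ) =>
      y ⟨f a, by simp⟩ := measurable_pi_lambda _ fun a => measurable_pi_apply _
  have m2 : Measurable fun (y : ↥(Finset.univ.image g) → ℝ) (a : κ') =>
      y ⟨g a, by simp⟩ := measurable_pi_lambda _ fun a => measurable_pi_apply _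
  exact h1.comp m1 m2

theorem meas_ge_le_of_lintegral_le {f : Ω → ℝ} (hf : Measurable f) {c B : ℝ} (hc : 0 < c)
    (h : ∫⁻ ω, ENNReal.ofReal (f ω) ∂P ≤ ENNReal.ofReal B) :
    P {ω | c ≤ f ω} ≤ ENNReal.ofReal (B / c) := by
  calc P {ω | c ≤ f ω} ≤ P {ω | ENNReal.ofReal c ≤ ENNReal.ofReal (f ω)} :=
        measure_mono fun ω hω => ENNReal.ofReal_le_ofReal hω
    _ ≤ (∫⁻ ω, ENNReal.ofReal (f ω) ∂P) / ENNReal.ofReal c :=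
        meas_ge_le_lintegral_div hf.ennreal_ofReal.aemeasurable (by simpa using hc) (by simp)
    _ ≤ ENNReal.ofReal B / ENNReal.ofReal c := by gcongr
    _ = _ := (ENNReal.ofReal_div_of_pos hc).symm

variable [IsProbabilityMeasure P]

theorem StdEntries.lintegral_dotProduct_sq {κ : Type*} [Fintype κ] {ξ : Ω → κ → ℝ} {M : ℝ}
    (h : StdEntries P ξ M) (x : κ → ℝ) :
    ∫⁻ ω, ENNReal.ofReal ((x ⬝ᵥ ξ ω) ^ 2) ∂P = ENNReal.ofReal (x ⬝ᵥ x) := by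
  classical
  have e : ∀ ω, (x ⬝ᵥ ξ ω) ^ 2 = ∑ i, ∑ j, x i * x j * (ξ ω i * ξ ω j) := fun ω => by
    rw [sq, dotProduct, Finset.sum_mul_sum]
    exact Finset.sum_congr rfl fun i _ => Finset.sum_congr rfl fun j _ => by ring
  have hi : ∀ i j, Integrable (fun ω => x i * x j * (ξ ω i * ξ ω j)) P :=
    fun i j => (h.integrable_mul i j).const_mul _
  have hi' : ∀ i ∈ Finset.univ, Integrable (fun ω => ∑ j, x i * x j * (ξ ω i * ξ ω j)) P :=
    fun i _ => integrable_finsetSum _ fun j _ => hi i j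
  have hI : Integrable (fun ω => (x ⬝ᵥ ξ ω) ^ 2) P := by
    simp only [e]
    exact integrable_finsetSum _ hi'
  rw [← ofReal_integral_eq_lintegral_ofReal hI (ae_of_all _ fun ω => sq_nonneg _)]
  congr 1
  simp only [e]
  rw [integral_finsetSum _ hi']
  simp_rw [integral_finsetSum _ fun j _ => hi _ j, integral_const_mul, h.integral_mul]
  simp [dotProduct]

/-- A random matrix with independent standardized entries has `‖Z v‖² ≤ s ‖v‖²` for all `v`, up
to an explicit probability. -/
theorem StdEntries.measure_not_opNorm_le {n p : ℕ} {Z : Ω → Fin n → Fin p → ℝ} {M : ℝ}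
    (h : StdEntries P (fun ω (x : Fin n × Fin p) => Z ω x.1 x.2) M) {L s : ℝ}
    (hn : (n : ℝ) ≤ L) (hp : (p : ℝ) < L) (hs : 0 < s) {k : ℕ} (hk : k ≠ 0) :
    P {ω | ¬ ∀ v, (Matrix.of (Z ω) *ᵥ v) ⬝ᵥ (Matrix.of (Z ω) *ᵥ v) ≤ s * (v ⬝ᵥ v)} ≤
      ENNReal.ofReal (n * ((M + 2) * p / (L - p) ^ 2)) +
        ENNReal.ofReal (p * (k * L) ^ k / s ^ k) := by
  have hLp : 0 < L - p := by linarith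
  have hL0 : 0 ≤ L := le_trans (by positivity) hn
  have hrow : ∀ i, StdEntries P (fun ω => Z ω i) M := fun i =>
    h.precomp (f := fun j => (i, j)) fun a b hab => (Prod.mk.inj hab).2
  have hZm : ∀ i, Measurable fun ω => Z ω i := fun i =>
    measurable_pi_lambda _ fun j => h.measurable (i, j)
  have htm : Measurable fun v : Fin p → ℝ => if v ⬝ᵥ v ≤ L then v else 0 := by
    refine Measurable.ite (measurableSet_le ?_ measurable_const) measurable_id measurable_const
    simp only [dotProduct]
    fun_prop
  -- Replacing long rows by zero bounds the lengths, preserves independence of rows and can only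
  -- decrease the second moments `E (x ⬝ᵥ wᵢ)²`. No recentring is needed, as only an upper bound on
  -- these moments enters.
  set w : Fin n → Ω → Fin p → ℝ := fun i ω => if Z ω i ⬝ᵥ Z ω i ≤ L then Z ω i else 0 with hw
  have hwm : ∀ i, Measurable (w i) := fun i => htm.comp (hZm i)
  have hwL : ∀ i ω, w i ω ⬝ᵥ w i ω ≤ L := fun i ω => by
    simp only [hw]
    split_ifs with hc
    · exact hc
    · simpa using hL0
  have hind : ∀ (I : Finset (Fin n)) (i : Fin n), i ∉ I →
      IndepFun (fun ω (k : I) => w k ω) (w i) P := by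
    intro I i hi
    have h1 := h.indepFun_of_disjoint (f := fun a : I × Fin p => ((a.1 : Fin n), a.2))
      (g := fun b : Fin p => (i, b)) (fun a b hab => hi ((Prod.mk.inj hab).1 ▸ a.1.2))
    have m1 : Measurable fun (y : I × Fin p → ℝ) (k : I) =>
        (fun v : Fin p → ℝ => if v ⬝ᵥ v ≤ L then v else 0) fun j => y (k, j) :=
      measurable_pi_lambda _ fun k => htm.comp
        (measurable_pi_lambda _ fun j => measurable_pi_apply _)
    exact h1.comp m1 htm
  have hcov : ∀ i x, ∫⁻ ω, ENNReal.ofReal ((x ⬝ᵥ w i ω) ^ 2) ∂P ≤ ENNReal.ofReal (x ⬝ᵥ x) := by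
    intro i x
    rw [← (hrow i).lintegral_dotProduct_sq x]
    refine lintegral_mono fun ω => ENNReal.ofReal_le_ofReal ?_
    simp only [hw]
    split_ifs
    · exact le_rfl
    · simpa using sq_nonneg _
  have hmom := lintegral_trace_pow_le hwm hind hcov hwL k 0 Finset.univ (by simpa using hn)
  simp only [CharP.cast_eq_zero, zero_mul, zero_smul, add_zero, zero_add, Fintype.card_fin] at hmom
  set T : Ω → Matrix (Fin p) (Fin p) ℝ := fun ω => ∑ i, vecMulVec (w i ω) (w i ω) with hT
  have hTm : Measurable fun ω => (T ω ^ k).trace := by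
    have : Continuous fun y : Fin n → Fin p → ℝ =>
        ((∑ i, vecMulVec (y i) (y i)) ^ k).trace := by fun_prop
    exact this.measurable.comp (measurable_pi_lambda _ hwm)
  -- Either some squared row length exceeds its mean `p` by `L - p`, or no row is truncated and `tr
  -- T ^ k` controls the top eigenvalue of `Zᵀ Z`. Chebyshev and Markov bound the two alternatives.
  have hsub : {ω | ¬ ∀ v, (Matrix.of (Z ω) *ᵥ v) ⬝ᵥ (Matrix.of (Z ω) *ᵥ v) ≤ s * (v ⬝ᵥ v)} ⊆
      (⋃ i, {ω | (L - p) ^ 2 ≤ (Z ω i ⬝ᵥ Z ω i - p) ^ 2}) ∪ {ω | s ^ k ≤ (T ω ^ k).trace} := by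
    intro ω hω
    by_contra hc
    simp only [Set.mem_union, Set.mem_iUnion, Set.mem_ofPred_eq, not_or, not_exists, not_le] at hc
    refine hω fun v => ?_
    have hwZ : ∀ i, w i ω = Z ω i := fun i => by
      have h1 := abs_lt_of_sq_lt_sq (hc.1 i) hLp.le
      simp only [hw]
      rw [if_pos]
      linarith [(abs_lt.1 h1).2]
    have hTZ : T ω = (Matrix.of (Z ω))ᵀ * Matrix.of (Z ω) := by
      ext a b
      simp [hT, Matrix.sum_apply, vecMulVec_apply, mul_apply, hwZ]
    have hpsd : (T ω).PosSemidef := posSemidef_sum_vecMulVec _ _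
    have := dotProduct_mulVec_le_of_trace_pow_le hpsd hs.le hk hc.2.le v
    rwa [hTZ, ← mulVec_mulVec, ← mulVec_dotProduct_eq] at this
  refine (measure_mono hsub).trans ((measure_union_le _ _).trans (add_le_add ?_ ?_))
  · refine (measure_iUnion_fintype_le _ _).trans ?_
    have : ∀ i, P {ω | (L - p) ^ 2 ≤ (Z ω i ⬝ᵥ Z ω i - p) ^ 2} ≤
        ENNReal.ofReal ((M + 2) * p / (L - p) ^ 2) := by
      intro i
      have h1 := (hrow i).lintegral_sqNorm_sub_trace_sq_le (1 : Matrix (Fin p) (Fin p) ℝ)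
      simp only [one_mulVec, transpose_one, mul_one, trace_one, Fintype.card_fin] at h1
      refine meas_ge_le_of_lintegral_le ?_ (by positivity) h1
      have := hZm i
      simp only [dotProduct]
      fun_prop
    refine (Finset.sum_le_sum fun i _ => this i).trans_eq ?_
    rw [Finset.sum_const, Finset.card_univ, Fintype.card_fin, nsmul_eq_mul,
      ENNReal.ofReal_mul (by positivity), ENNReal.ofReal_natCast]
  · exact meas_ge_le_of_lintegral_le hTm (by positivity) hmom

end DesignNorm

/-! ### The denominator of the plug-in estimators -/

section Denominator

variable {Ω : Type*} [MeasurableSpace Ω] {P : Measure Ω} [IsProbabilityMeasure P]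

/-- The eigenvalues are nonnegative, so their squares sum to at most the square of their sum. This
crude bound suffices, because the concentration below comes from the number of rows. -/
theorem trace_mul_self_le_sq_trace {ι : Type*} [Fintype ι] [DecidableEq ι] {A : Matrix ι ι ℝ}
    (hA : A.PosSemidef) : (A * A).trace ≤ A.trace ^ 2 := by
  have h1 := trace_pow_eq_sum hA.1 1
  rw [← sq, trace_pow_eq_sum hA.1 2]
  simp only [pow_one] at h1
  rw [h1]
  exact Finset.sum_sq_le_sq_sum_of_nonneg fun i _ => hA.eigenvalues_nonneg i

open scoped Kronecker in
/-- Concentration of `∑ᵢ ‖G ξᵢ‖²` over the rows `ξᵢ` of a random matrix. -/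
theorem StdEntries.lintegral_sum_sqNorm_sq_le {α ι κ : Type*} [Fintype α] [Fintype ι] [Fintype κ]
    {ξ : Ω → α × ι → ℝ} {M : ℝ} (h : StdEntries P ξ M) (G : Matrix κ ι ℝ) :
    ∫⁻ ω, ENNReal.ofReal ((∑ i, ∑ k, (∑ j, G k j * ξ ω (i, j)) ^ 2 -
        Fintype.card α * (G * Gᵀ).trace) ^ 2) ∂P ≤
      ENNReal.ofReal ((M + 2) * (Fintype.card α * ((G * Gᵀ) * (G * Gᵀ)).trace)) := by
  classical
  -- The block diagonal matrix `1 ⊗ G` applies `G` to every row of the stacked vector at once, so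
  -- the sum over rows is a single squared norm.
  have h1 := h.lintegral_sqNorm_sub_trace_sq_le ((1 : Matrix α α ℝ) ⊗ₖ G)
  have e1 : ((1 : Matrix α α ℝ) ⊗ₖ G) * ((1 : Matrix α α ℝ) ⊗ₖ G)ᵀ =
      (1 : Matrix α α ℝ) ⊗ₖ (G * Gᵀ) := by
    rw [← kroneckerMap_transpose, ← mul_kronecker_mul, transpose_one, one_mul]
  have e2 : ∀ v : α × ι → ℝ, (((1 : Matrix α α ℝ) ⊗ₖ G) *ᵥ v) ⬝ᵥ
      (((1 : Matrix α α ℝ) ⊗ₖ G) *ᵥ v) = ∑ i, ∑ k, (∑ j, G k j * v (i, j)) ^ 2 := by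
    intro v
    simp only [dotProduct, mulVec, Fintype.sum_prod_type, kroneckerMap_apply, one_apply, ite_mul,
      one_mul, zero_mul, sq]
    refine Finset.sum_congr rfl fun i _ => Finset.sum_congr rfl fun k _ => ?_
    have : ∑ x, ∑ x_1, (if i = x then G k x_1 * v (x, x_1) else 0) = ∑ j, G k j * v (i, j) := by
      rw [Finset.sum_eq_single i] <;> simp +contextual [eq_comm]
    rw [this]
  rw [e1, ← mul_kronecker_mul, one_mul, trace_kronecker, trace_kronecker, trace_one] at h1
  simpa only [e2] using h1

/-- Sums of squared bilinear forms `xᵢᵀ S wₖ` in independent groups of standardized vectors have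
the expected order. -/
theorem StdEntries.measure_sum_bilinear_sq_lt {α κ : Type*} [Fintype α] [Fintype κ] [Nonempty α]
    [Nonempty κ] {p : ℕ} {ZA : Ω → α × Fin p → ℝ} {ZB : Ω → κ × Fin p → ℝ} {M : ℝ}
    (hSA : StdEntries P ZA M) (hSB : StdEntries P ZB M) (hind : IndepFun ZB ZA P) (hM : 0 ≤ M)
    {S : Matrix (Fin p) (Fin p) ℝ} (hS : S.PosSemidef) (hpos : 0 < (S * S).trace) :
    P {ω | ∑ i, ∑ k, (∑ j, (∑ l, S j l * ZB ω (k, l)) * ZA ω (i, j)) ^ 2 <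
        (Fintype.card α : ℝ) * Fintype.card κ * (S * S).trace / 4} ≤
      ENNReal.ofReal (4 * (M + 2) / Fintype.card κ) +
        ENNReal.ofReal (32 * (M + 2) * (M + 3) / Fintype.card α) := by
  classical
  have hST : Sᵀ = S := by simpa using hS.1.eq
  set t := (S * S).trace with ht
  set a : ℝ := (Fintype.card α : ℝ) with ha
  set b : ℝ := (Fintype.card κ : ℝ) with hb
  have ha0 : 0 < a := by rw [ha]; exact_mod_cast Fintype.card_pos
  have hb1 : 1 ≤ b := by rw [hb]; exact_mod_cast Fintype.card_pos (α := κ)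
  clear_value a b
  have hb0 : 0 < b := by linarith
  have hZBm : Measurable ZB := measurable_pi_lambda _ hSB.measurable
  have hZAm : Measurable ZA := measurable_pi_lambda _ hSA.measurable
  -- First stage: `V = ∑ₖ ‖S wₖ‖²` depends on the block `ZB` only, has mean `b t`, and its variance
  -- carries one factor `b` instead of `b²`.
  obtain ⟨V, hV⟩ : ∃ V : (κ × Fin p → ℝ) → ℝ,
      ∀ w, V w = ∑ k, ∑ j, (∑ l, S j l * w (k, l)) ^ 2 := ⟨_, fun _ => rfl⟩
  have hVm : Measurable V := by
    rw [funext hV]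
    fun_prop
  have hV1 : ∫⁻ ω, ENNReal.ofReal ((V (ZB ω) - b * t) ^ 2) ∂P ≤
      ENNReal.ofReal ((M + 2) * (b * t ^ 2)) := by
    have h1 := hSB.lintegral_sum_sqNorm_sq_le S
    rw [hST, ← hb] at h1
    simp only [← hV] at h1
    refine h1.trans (ENNReal.ofReal_le_ofReal ?_)
    have : (S * S * (S * S)).trace ≤ t ^ 2 := by
      rw [ht]
      refine trace_mul_self_le_sq_trace ?_
      rw [← sq]
      exact hS.pow 2
    gcongr
  have hV2 : ∫⁻ ω, ENNReal.ofReal (V (ZB ω) ^ 2) ∂P ≤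
      ENNReal.ofReal (2 * (M + 3) * (b ^ 2 * t ^ 2)) := by
    calc ∫⁻ ω, ENNReal.ofReal (V (ZB ω) ^ 2) ∂P
        ≤ ∫⁻ ω, (ENNReal.ofReal 2 * ENNReal.ofReal ((V (ZB ω) - b * t) ^ 2) +
            ENNReal.ofReal (2 * (b * t) ^ 2)) ∂P := by
          refine lintegral_mono fun ω => ?_
          rw [← ENNReal.ofReal_mul (by norm_num), ← ENNReal.ofReal_add (by positivity)
            (by positivity)]
          refine ENNReal.ofReal_le_ofReal ?_
          nlinarith [sq_nonneg (V (ZB ω) - 2 * (b * t))]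
      _ = ENNReal.ofReal 2 * ∫⁻ ω, ENNReal.ofReal ((V (ZB ω) - b * t) ^ 2) ∂P +
            ENNReal.ofReal (2 * (b * t) ^ 2) := by
          rw [lintegral_add_right _ measurable_const, lintegral_const_mul' _ _ (by simp)]
          simp
      _ ≤ ENNReal.ofReal 2 * ENNReal.ofReal ((M + 2) * (b * t ^ 2)) +
            ENNReal.ofReal (2 * (b * t) ^ 2) := by gcongr
      _ ≤ _ := by
          rw [← ENNReal.ofReal_mul (by norm_num), ← ENNReal.ofReal_add (by positivity)
            (by positivity)]
          refine ENNReal.ofReal_le_ofReal ?_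
          have : b * t ^ 2 ≤ b ^ 2 * t ^ 2 := by
            refine mul_le_mul_of_nonneg_right ?_ (sq_nonneg t)
            nlinarith
          nlinarith [mul_le_mul_of_nonneg_left this (by linarith : 0 ≤ 2 * (M + 2))]
  obtain ⟨T, hT⟩ : ∃ T : (κ × Fin p → ℝ) → (α × Fin p → ℝ) → ℝ,
      ∀ w x, T w x = ∑ i, ∑ k, (∑ j, (∑ l, S j l * w (k, l)) * x (i, j)) ^ 2 :=
    ⟨_, fun _ _ => rfl⟩
  have hTm : Measurable fun q : (κ × Fin p → ℝ) × (α × Fin p → ℝ) =>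
      (T q.1 q.2 - a * V q.1) ^ 2 := by
    simp only [hT, hV]
    fun_prop
  have hT1 : ∫⁻ ω, ENNReal.ofReal ((T (ZB ω) (ZA ω) - a * V (ZB ω)) ^ 2) ∂P ≤
      ENNReal.ofReal ((M + 2) * a * (2 * (M + 3) * (b ^ 2 * t ^ 2))) := by
    refine (lintegral_le_of_indepFun hZBm hZAm hind
      (F := fun w x => ENNReal.ofReal ((T w x - a * V w) ^ 2)) hTm.ennreal_ofReal
      (G := fun w => ENNReal.ofReal ((M + 2) * a) * ENNReal.ofReal (V w ^ 2))
      (by fun_prop) fun w => ?_).trans ?_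
    -- Second stage, with `ZB` frozen: the rows of `G` are the vectors `S wₖ`, so `tr (G Gᵀ) = V`.
    -- The double sum is `∑ᵢ ‖G xᵢ‖²`, of conditional mean `a V` and variance at most `(M + 2) a
    -- V²`.
    · set G : Matrix κ (Fin p) ℝ := Matrix.of fun k j => ∑ l, S j l * w (k, l) with hG
      have h1 := hSA.lintegral_sum_sqNorm_sq_le G
      have hGV : (G * Gᵀ).trace = V w := by
        simp [hG, hV, trace, mul_apply, sq]
      have hGp : (G * Gᵀ).PosSemidef := by
        simpa using Matrix.posSemidef_self_mul_conjTranspose G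
      rw [← ha, hGV] at h1
      simp only [hG, of_apply, ← hT] at h1
      rw [← hG] at h1
      refine h1.trans ?_
      rw [← ENNReal.ofReal_mul (by positivity), mul_assoc]
      refine ENNReal.ofReal_le_ofReal ?_
      have := trace_mul_self_le_sq_trace hGp
      rw [hGV] at this
      gcongr
    · rw [lintegral_const_mul' _ _ (by simp), ENNReal.ofReal_mul (p := (M + 2) * a) (by positivity)]
      gcongr
  -- If `V > b t / 2` and `T` is within `a b t / 4` of `a V`, then `T > a b t / 4`.
  have hsub : {ω | ∑ i, ∑ k, (∑ j, (∑ l, S j l * ZB ω (k, l)) * ZA ω (i, j)) ^ 2 < a * b * t / 4} ⊆ {ω | (b * t / 2) ^ 2 ≤ (V (ZB ω) - b * t) ^ 2} ∪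
        {ω | (a * b * t / 4) ^ 2 ≤ (T (ZB ω) (ZA ω) - a * V (ZB ω)) ^ 2} := by
    intro ω hω
    rw [Set.mem_ofPred_eq, ← hT] at hω
    by_contra hc
    simp only [Set.mem_union, Set.mem_ofPred_eq, not_or, not_le] at hc
    have h1 := (abs_lt.1 (abs_lt_of_sq_lt_sq hc.1 (by positivity))).1
    have h2 := (abs_lt.1 (abs_lt_of_sq_lt_sq hc.2 (by positivity))).1
    have h3 : a * (b * t / 2) < a * V (ZB ω) := by
      refine mul_lt_mul_of_pos_left ?_ ha0
      linarith
    have h4 : a * (b * t / 2) = 2 * (a * b * t / 4) := by ring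
    linarith
  have m1 : Measurable fun ω => (V (ZB ω) - b * t) ^ 2 :=
    ((hVm.comp hZBm).sub_const _).pow_const 2
  have m2 : Measurable fun ω => (T (ZB ω) (ZA ω) - a * V (ZB ω)) ^ 2 :=
    hTm.comp (hZBm.prodMk hZAm)
  have k1 := meas_ge_le_of_lintegral_le m1 (c := (b * t / 2) ^ 2) (by positivity) hV1
  have k2 := meas_ge_le_of_lintegral_le m2 (c := (a * b * t / 4) ^ 2) (by positivity) hT1
  have e1 : (M + 2) * (b * t ^ 2) / (b * t / 2) ^ 2 = 4 * (M + 2) / b := by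
    field_simp
    norm_num
  have e2 : (M + 2) * a * (2 * (M + 3) * (b ^ 2 * t ^ 2)) / (a * b * t / 4) ^ 2 =
      32 * (M + 2) * (M + 3) / a := by
    field_simp
    norm_num
  rw [e1] at k1
  rw [e2] at k2
  exact (measure_mono hsub).trans ((measure_union_le _ _).trans (add_le_add k1 k2))

/-- The inner products between two disjoint groups of rows of `Z S Zᵀ` have a total square of the
expected order. -/
theorem StdEntries.measure_crossSum_lt {n p : ℕ} {Z : Ω → Fin n → Fin p → ℝ} {M : ℝ}
    (h : StdEntries P (fun ω (x : Fin n × Fin p) => Z ω x.1 x.2) M) (hM : 0 ≤ M)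
    {S : Matrix (Fin p) (Fin p) ℝ} (hS : S.PosSemidef) (hpos : 0 < (S * S).trace)
    (A : Finset (Fin n)) (hA : A.Nonempty) (hB : Aᶜ.Nonempty) :
    P {ω | ∑ i ∈ A, ∑ k ∈ Aᶜ, (Matrix.of (Z ω) * S * (Matrix.of (Z ω))ᵀ) i k ^ 2 <
        (A.card : ℝ) * (Aᶜ.card : ℝ) * (S * S).trace / 4} ≤
      ENNReal.ofReal (4 * (M + 2) / (Aᶜ.card : ℝ)) +
        ENNReal.ofReal (32 * (M + 2) * (M + 3) / A.card) := by
  have : Nonempty ↥A := hA.to_subtype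
  have : Nonempty ↥Aᶜ := hB.to_subtype
  have hSB := h.precomp (f := fun x : ↥Aᶜ × Fin p => ((x.1 : Fin n), x.2)) fun x y hxy => by
    obtain ⟨h1, h2⟩ := Prod.mk.inj hxy
    exact Prod.ext (Subtype.ext h1) h2
  have hSA := h.precomp (f := fun x : ↥A × Fin p => ((x.1 : Fin n), x.2)) fun x y hxy => by
    obtain ⟨h1, h2⟩ := Prod.mk.inj hxy
    exact Prod.ext (Subtype.ext h1) h2
  have hind := h.indepFun_of_disjoint
      (f := fun x : ↥Aᶜ × Fin p => ((x.1 : Fin n), x.2))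
      (g := fun x : ↥A × Fin p => ((x.1 : Fin n), x.2)) fun x y hxy => by
    have h1 := (Prod.mk.inj hxy).1
    have h2 := x.1.2
    rw [h1] at h2
    exact (Finset.mem_compl.1 h2) y.1.2
  have key := hSA.measure_sum_bilinear_sq_lt hSB hind hM hS hpos
  have hcross : ∀ ω, ∑ i ∈ A, ∑ k ∈ Aᶜ, (Matrix.of (Z ω) * S * (Matrix.of (Z ω))ᵀ) i k ^ 2 =
      ∑ i : ↥A, ∑ k : ↥Aᶜ, (∑ j, (∑ l, S j l * Z ω k l) * Z ω i j) ^ 2 := by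
    intro ω
    rw [← Finset.sum_coe_sort A]
    refine Finset.sum_congr rfl fun i _ => ?_
    rw [← Finset.sum_coe_sort Aᶜ]
    refine Finset.sum_congr rfl fun k _ => ?_
    congr 1
    rw [Matrix.mul_assoc]
    simp only [mul_apply, transpose_apply, of_apply]
    exact Finset.sum_congr rfl fun j _ => mul_comm _ _
  simp only [Fintype.card_coe] at key
  simpa only [hcross] using key

end Denominator

/-! ### The plug-in penalty -/

section Estimators

variable {n p : ℕ}

/-- The deviation of `‖y‖² / n` from its conditional mean given the design. -/
noncomputable def normErr (σ τ : ℝ) (X : Matrix (Fin n) (Fin p) ℝ) (y : Fin n → ℝ) : ℝ :=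
  (y ⬝ᵥ y) / (n : ℝ) - (τ ^ 2 * mHat1 X + σ ^ 2)

/-- The deviation of `‖Xᵀ y‖² / n²` from its conditional mean given the design. -/
noncomputable def gradErr (σ τ : ℝ) (X : Matrix (Fin n) (Fin p) ℝ) (y : Fin n → ℝ) : ℝ :=
  ((Xᵀ *ᵥ y) ⬝ᵥ (Xᵀ *ᵥ y)) / (n : ℝ) ^ 2 - (τ ^ 2 * mHat2 X + σ ^ 2 * (aspect n p * mHat1 X))

theorem mHat1_nonneg (X : Matrix (Fin n) (Fin p) ℝ) : 0 ≤ mHat1 X :=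
  div_nonneg (by simpa using trace_pow_nonneg (sampleCov_posSemidef X) 1) (by positivity)

theorem mHat1_le (hp : 0 < p) {X : Matrix (Fin n) (Fin p) ℝ} {s : ℝ}
    (h : ∀ v, v ⬝ᵥ (sampleCov X *ᵥ v) ≤ s * (v ⬝ᵥ v)) : mHat1 X ≤ s := by
  have h1 := trace_pow_le (sampleCov_posSemidef X) h 1
  simp only [pow_one, Fintype.card_fin] at h1
  rw [mHat1, div_le_iff₀ (by exact_mod_cast hp)]
  linarith

/-- Given `X`, the statistics have means `τ² m̂₁ + σ²` and `τ² m̂₂ + σ² γ m̂₁`. The estimators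
invert this linear system of determinant `m̃₂`, so their errors are the same linear combinations of
the deviations. -/
theorem tauSqHat_sub (σ τ : ℝ) (X : Matrix (Fin n) (Fin p) ℝ) (y : Fin n → ℝ)
    (h : mTilde2 X ≠ 0) : tauSqHat X y - τ ^ 2 =
      (gradErr σ τ X y - aspect n p * mHat1 X * normErr σ τ X y) / mTilde2 X := by
  have h' : mHat2 X - aspect n p * mHat1 X ^ 2 ≠ 0 := h
  simp only [tauSqHat, gradErr, normErr, mTilde2]
  generalize (y ⬝ᵥ y) / (n : ℝ) = a
  generalize ((Xᵀ *ᵥ y) ⬝ᵥ (Xᵀ *ᵥ y)) / (n : ℝ) ^ 2 = b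
  field_simp
  ring

theorem sigmaSqHat_sub (σ τ : ℝ) (X : Matrix (Fin n) (Fin p) ℝ) (y : Fin n → ℝ)
    (h : mTilde2 X ≠ 0) : sigmaSqHat X y - σ ^ 2 =
      normErr σ τ X y + (aspect n p * mHat1 X ^ 2 * normErr σ τ X y
        - mHat1 X * gradErr σ τ X y) / mTilde2 X := by
  have h' : mHat2 X - aspect n p * mHat1 X ^ 2 ≠ 0 := h
  simp only [sigmaSqHat, gradErr, normErr, mTilde2]
  generalize (y ⬝ᵥ y) / (n : ℝ) = a
  generalize ((Xᵀ *ᵥ y) ⬝ᵥ (Xᵀ *ᵥ y)) / (n : ℝ) ^ 2 = b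
  field_simp
  ring

/-- Clipping is 1-Lipschitz and fixes `y`; also both points lie in `[l, u]`. The second bound takes
over when the estimated quotient is uncontrolled. -/
theorem abs_clip_sub_le {x y l u : ℝ} (hy : y ∈ Set.Icc l u) :
    |min (max x l) u - y| ≤ |x - y| ∧ |min (max x l) u - y| ≤ u - l := by
  obtain ⟨h1, h2⟩ := hy
  rcases le_total x l with h | h
  · rw [max_eq_right h, min_eq_left (h1.trans h2)]
    constructor
    · rw [abs_of_nonpos (by linarith), abs_of_nonpos (by linarith)]
      linarith
    · rw [abs_of_nonpos (by linarith)]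
      linarith
  · rw [max_eq_left h]
    rcases le_total x u with h' | h'
    · rw [min_eq_left h']
      refine ⟨le_rfl, abs_le.2 ⟨by linarith, by linarith⟩⟩
    · rw [min_eq_right h']
      constructor
      · rw [abs_of_nonneg (by linarith), abs_of_nonneg (by linarith)]
        linarith
      · rw [abs_of_nonneg (by linarith)]
        linarith

/-- The plug-in penalty is close to the oracle penalty when the two errors are small. -/
theorem abs_lamHat_sub_lamStar_le {σ τ lam1 lam2 : ℝ} (hτ : 0 < τ)
    (hlam : lamStar σ τ n p ∈ Set.Icc lam1 lam2) {X : Matrix (Fin n) (Fin p) ℝ} {y : Fin n → ℝ}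
    {c g s : ℝ} (hc : 0 < c) (hc1 : c ≤ 1) (hg : 1 ≤ g) (hs : 1 ≤ s) (hm : c ≤ mTilde2 X)
    (hm1 : mHat1 X ≤ s) (hasp : aspect n p ≤ g) :
    |lamHat lam1 lam2 X y - lamStar σ τ n p| ≤
      (2 * g * (τ ^ 2 + σ ^ 2) / τ ^ 4 + 2 * (lam2 - lam1) / τ ^ 2) * (2 * g / c) * s ^ 2 *
        (|normErr σ τ X y| + |gradErr σ τ X y|) := by
  have hm0 : 0 < mTilde2 X := hc.trans_le hm
  have hasp0 : 0 ≤ aspect n p := by unfold aspect; positivity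
  have hm10 := mHat1_nonneg X
  have hlam12 : 0 ≤ lam2 - lam1 := by linarith [hlam.1, hlam.2]
  set a := normErr σ τ X y with ha
  set b := gradErr σ τ X y with hb
  set m := mHat1 X
  set γ := aspect n p
  set E := 2 * g / c * s ^ 2 * (|a| + |b|) with hE
  have hs2 : s ≤ s ^ 2 := by nlinarith
  have hs1 : 1 ≤ s ^ 2 := hs.trans hs2
  have hγm : γ * m ≤ g * s ^ 2 := by
    calc γ * m ≤ g * s := mul_le_mul hasp hm1 hm10 (by linarith)
      _ ≤ g * s ^ 2 := mul_le_mul_of_nonneg_left hs2 (by linarith)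
  have hγm2 : γ * m ^ 2 ≤ g * s ^ 2 :=
    mul_le_mul hasp (pow_le_pow_left₀ hm10 hm1 2) (by positivity) (by linarith)
  have hmg : m ≤ g * s ^ 2 := by nlinarith
  have h1g : 1 ≤ g * s ^ 2 := by nlinarith
  have hEτ : |tauSqHat X y - τ ^ 2| ≤ E := by
    rw [tauSqHat_sub σ τ X y hm0.ne', abs_div, abs_of_pos hm0]
    calc _ ≤ (g * s ^ 2 * (|a| + |b|)) / c := by
          refine div_le_div₀ (by positivity) ?_ hc hm
          refine (abs_sub _ _).trans ?_
          rw [abs_mul, abs_of_nonneg (mul_nonneg hasp0 hm10)]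
          nlinarith [abs_nonneg a, abs_nonneg b, mul_le_mul_of_nonneg_right hγm (abs_nonneg a),
            mul_le_mul_of_nonneg_right h1g (abs_nonneg b)]
      _ ≤ E := by
          have : 0 ≤ g * s ^ 2 * (|a| + |b|) / c := by positivity
          rw [hE]
          calc _ ≤ 2 * (g * s ^ 2 * (|a| + |b|) / c) := by linarith
            _ = _ := by ring
  have hEσ : |sigmaSqHat X y - σ ^ 2| ≤ E := by
    rw [sigmaSqHat_sub σ τ X y hm0.ne']
    have h1 : |(γ * m ^ 2 * a - m * b) / mTilde2 X| ≤ (g * s ^ 2 * (|a| + |b|)) / c := by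
      rw [abs_div, abs_of_pos hm0]
      refine div_le_div₀ (by positivity) ?_ hc hm
      refine (abs_sub _ _).trans ?_
      rw [abs_mul, abs_mul m, abs_of_nonneg (by positivity : 0 ≤ γ * m ^ 2), abs_of_nonneg hm10]
      nlinarith [mul_le_mul_of_nonneg_right hγm2 (abs_nonneg a),
        mul_le_mul_of_nonneg_right hmg (abs_nonneg b)]
    have h2 : |a| ≤ (g * s ^ 2 * (|a| + |b|)) / c := by
      rw [le_div_iff₀ hc]
      calc |a| * c ≤ |a| * 1 := mul_le_mul_of_nonneg_left hc1 (abs_nonneg a)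
        _ ≤ (|a| + |b|) * (g * s ^ 2) :=
          mul_le_mul (by linarith [abs_nonneg b]) h1g (by norm_num) (by positivity)
        _ = _ := by ring
    calc _ ≤ |a| + |(γ * m ^ 2 * a - m * b) / mTilde2 X| := abs_add_le _ _
      _ ≤ 2 * ((g * s ^ 2 * (|a| + |b|)) / c) := by linarith
      _ = E := by rw [hE]; ring
  have hE0 : 0 ≤ E := (abs_nonneg _).trans hEτ
  have hτ2 : 0 < τ ^ 2 := by positivity
  obtain ⟨hclip1, hclip2⟩ := abs_clip_sub_le (x := sigmaSqHat X y / tauSqHat X y * γ) hlam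
  have hgoal : |lamHat lam1 lam2 X y - lamStar σ τ n p| ≤
      (2 * g * (τ ^ 2 + σ ^ 2) / τ ^ 4 + 2 * (lam2 - lam1) / τ ^ 2) * E := by
    rw [add_mul]
    have hA : 0 ≤ 2 * g * (τ ^ 2 + σ ^ 2) / τ ^ 4 * E := by positivity
    have hB : 0 ≤ 2 * (lam2 - lam1) / τ ^ 2 * E := by positivity
    -- A small error keeps the denominator of the quotient above `τ² / 2`, where the quotient is
    -- Lipschitz. A large error makes the trivial bound `lam2 - lam1` at most `2 (lam2 - lam1) E /
    -- τ²`.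
    rcases le_total E (τ ^ 2 / 2) with h | h
    · refine (hclip1.trans ?_).trans (le_add_of_nonneg_right hB)
      have ht : τ ^ 2 / 2 ≤ tauSqHat X y := by
        have := (abs_le.1 hEτ).1
        linarith
      have ht0 : 0 < tauSqHat X y := by linarith
      have e : sigmaSqHat X y / tauSqHat X y * γ - lamStar σ τ n p =
          ((sigmaSqHat X y - σ ^ 2) * τ ^ 2 - σ ^ 2 * (tauSqHat X y - τ ^ 2)) * γ /
            (tauSqHat X y * τ ^ 2) := by
        rw [lamStar]
        change _ - _ * γ = _
        field_simp
        ring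
      rw [e, abs_div, abs_of_pos (by positivity : 0 < tauSqHat X y * τ ^ 2), abs_mul,
        abs_of_nonneg hasp0]
      have hnum : |(sigmaSqHat X y - σ ^ 2) * τ ^ 2 - σ ^ 2 * (tauSqHat X y - τ ^ 2)| ≤
          E * (τ ^ 2 + σ ^ 2) := by
        refine (abs_sub _ _).trans ?_
        rw [abs_mul, abs_mul, abs_of_pos hτ2, abs_of_nonneg (sq_nonneg σ)]
        nlinarith [mul_le_mul_of_nonneg_right hEσ hτ2.le,
          mul_le_mul_of_nonneg_left hEτ (sq_nonneg σ)]
      calc _ ≤ (E * (τ ^ 2 + σ ^ 2) * g) / (τ ^ 2 / 2 * τ ^ 2) := by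
            refine div_le_div₀ (by positivity) ?_ (by positivity) ?_
            · exact mul_le_mul hnum hasp hasp0 (by positivity)
            · exact mul_le_mul_of_nonneg_right ht hτ2.le
        _ = _ := by
            field_simp
    · refine (hclip2.trans ?_).trans (le_add_of_nonneg_left hA)
      rw [div_mul_eq_mul_div, le_div_iff₀ hτ2]
      nlinarith
  refine hgoal.trans_eq ?_
  rw [hE]
  ring

variable {Ω : Type*} [MeasurableSpace Ω] {P : Measure Ω} [IsProbabilityMeasure P]

/-- With `α = τ / √p` and `ς = σ`, the response is `[α X | ς 1] ξ` for the standardized effects `ξ`,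
so this product is its covariance given `X`. -/
theorem fromCols_mul_transpose (X : Matrix (Fin n) (Fin p) ℝ) (α ς : ℝ) :
    fromCols (α • X) (ς • (1 : Matrix (Fin n) (Fin n) ℝ)) *
      (fromCols (α • X) (ς • (1 : Matrix (Fin n) (Fin n) ℝ)))ᵀ =
      α ^ 2 • (X * Xᵀ) + ς ^ 2 • (1 : Matrix (Fin n) (Fin n) ℝ) := by
  rw [transpose_fromCols, fromCols_mul_fromRows]
  simp [smul_smul, sq]

/-- Conditional variance of `‖y‖² / n` for a fixed design. -/
theorem lintegral_normErr_sq_le (hn : 0 < n) (hp : 0 < p) {ξ : Ω → Fin p ⊕ Fin n → ℝ} {M : ℝ}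
    (hξ : StdEntries P ξ M) (σ τ : ℝ) (X : Matrix (Fin n) (Fin p) ℝ) :
    ∫⁻ ω, ENNReal.ofReal (normErr σ τ X (X *ᵥ ((τ / √p) • fun j => ξ ω (Sum.inl j)) +
      σ • fun i => ξ ω (Sum.inr i)) ^ 2) ∂P ≤
    ENNReal.ofReal ((M + 2) * (τ ^ 4 * mHat2 X / p + 2 * τ ^ 2 * σ ^ 2 * mHat1 X / n +
      σ ^ 4 / n)) := by
  have hn' : (0 : ℝ) < n := by exact_mod_cast hn
  have hp' : (0 : ℝ) < p := by exact_mod_cast hp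
  have hsn : √(n : ℝ) ^ 2 = n := Real.sq_sqrt hn'.le
  have hsp : √(p : ℝ) ^ 2 = p := Real.sq_sqrt hp'.le
  set F := fromCols ((τ / √p) • X) (σ • (1 : Matrix (Fin n) (Fin n) ℝ)) with hF
  have h1 := hξ.lintegral_sqNorm_sub_trace_sq_le ((√(n : ℝ))⁻¹ • F)
  have hFF : ((√(n : ℝ))⁻¹ • F) * ((√(n : ℝ))⁻¹ • F)ᵀ =
      (n : ℝ)⁻¹ • ((τ ^ 2 / p) • (X * Xᵀ) + σ ^ 2 • (1 : Matrix (Fin n) (Fin n) ℝ)) := by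
    rw [transpose_smul, Matrix.smul_mul, Matrix.mul_smul, smul_smul, hF, fromCols_mul_transpose,
      ← sq, inv_pow, hsn,
      div_pow, hsp]
  have hv : ∀ ω, ((√(n : ℝ))⁻¹ • F) *ᵥ ξ ω = (√(n : ℝ))⁻¹ •
      (X *ᵥ ((τ / √p) • fun j => ξ ω (Sum.inl j)) + σ • fun i => ξ ω (Sum.inr i)) := by
    intro ω
    rw [smul_mulVec, hF, fromCols_mulVec, smul_mulVec, smul_mulVec, one_mulVec, mulVec_smul]
    rfl
  have htr : ((n : ℝ)⁻¹ • ((τ ^ 2 / p) • (X * Xᵀ) +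
      σ ^ 2 • (1 : Matrix (Fin n) (Fin n) ℝ))).trace = τ ^ 2 * mHat1 X + σ ^ 2 := by
    rw [mHat1, sampleCov_trace]
    simp only [trace_smul, trace_add, trace_one, smul_eq_mul, Fintype.card_fin]
    field_simp
  have htr2 : (((n : ℝ)⁻¹ • ((τ ^ 2 / p) • (X * Xᵀ) + σ ^ 2 • (1 : Matrix (Fin n) (Fin n) ℝ))) *
      ((n : ℝ)⁻¹ • ((τ ^ 2 / p) • (X * Xᵀ) + σ ^ 2 • (1 : Matrix (Fin n) (Fin n) ℝ)))).trace =
      τ ^ 4 * mHat2 X / p + 2 * τ ^ 2 * σ ^ 2 * mHat1 X / n + σ ^ 4 / n := by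
    rw [mHat1, mHat2, sampleCov_trace, sampleCov_mul_trace]
    simp only [add_mul, mul_add, smul_mul_assoc, mul_smul_comm, mul_one, one_mul, smul_add,
      trace_smul, trace_add, trace_one, smul_eq_mul, Fintype.card_fin]
    field_simp
    ring
  rw [hFF, htr, htr2] at h1
  refine (lintegral_congr fun ω => ?_).trans_le h1
  have hdiv : ∀ x : ℝ, (√(n : ℝ))⁻¹ * ((√(n : ℝ))⁻¹ * x) = x / (n : ℝ) := fun x => by
    rw [← mul_assoc, ← sq, inv_pow, hsn, div_eq_inv_mul]
  rw [hv, normErr, smul_dotProduct, dotProduct_smul, smul_eq_mul, smul_eq_mul, hdiv]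

/-- Conditional variance of `‖Xᵀ y‖² / n²` for a fixed design. -/
theorem lintegral_gradErr_sq_le (hn : 0 < n) (hp : 0 < p) {ξ : Ω → Fin p ⊕ Fin n → ℝ} {M : ℝ}
    (hξ : StdEntries P ξ M) (σ τ : ℝ) (X : Matrix (Fin n) (Fin p) ℝ) :
    ∫⁻ ω, ENNReal.ofReal (gradErr σ τ X (X *ᵥ ((τ / √p) • fun j => ξ ω (Sum.inl j)) +
      σ • fun i => ξ ω (Sum.inr i)) ^ 2) ∂P ≤
    ENNReal.ofReal ((M + 2) * (τ ^ 4 / p ^ 2 * (sampleCov X ^ 4).trace +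
      2 * τ ^ 2 * σ ^ 2 / (p * n) * (sampleCov X ^ 3).trace +
      σ ^ 4 / n ^ 2 * (sampleCov X ^ 2).trace)) := by
  have hn' : (0 : ℝ) < n := by exact_mod_cast hn
  have hp' : (0 : ℝ) < p := by exact_mod_cast hp
  have hsp : √(p : ℝ) ^ 2 = p := Real.sq_sqrt hp'.le
  set F := fromCols ((τ / √p) • X) (σ • (1 : Matrix (Fin n) (Fin n) ℝ)) with hF
  -- `N ξ = n⁻¹ Xᵀ y`. Since `N Nᵀ` is a polynomial in `Σ̂`, its trace is the conditional mean and
  -- the trace of its square gives the variance bound.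
  set N := (n : ℝ)⁻¹ • (Xᵀ * F) with hN
  have h1 := hξ.lintegral_sqNorm_sub_trace_sq_le N
  set S := sampleCov X with hS
  have hNN : N * Nᵀ = (τ ^ 2 / p) • S ^ 2 + (σ ^ 2 / n) • S := by
    rw [hN, transpose_smul, Matrix.smul_mul, Matrix.mul_smul, smul_smul, transpose_mul, transpose_transpose,
      show Xᵀ * F * (Fᵀ * X) = Xᵀ * (F * Fᵀ) * X by simp only [Matrix.mul_assoc],
      hF, fromCols_mul_transpose, div_pow, hsp, hS, sq (sampleCov X), sampleCov]
    simp only [Matrix.mul_add, Matrix.add_mul, smul_add, Matrix.smul_mul, Matrix.mul_smul,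
      Matrix.mul_one, smul_smul, Matrix.mul_assoc]
    congr 2 <;> ring
  have hv : ∀ ω, N *ᵥ ξ ω = (n : ℝ)⁻¹ •
      (Xᵀ *ᵥ (X *ᵥ ((τ / √p) • fun j => ξ ω (Sum.inl j)) + σ • fun i => ξ ω (Sum.inr i))) := by
    intro ω
    rw [hN, smul_mulVec, ← mulVec_mulVec, hF, fromCols_mulVec, smul_mulVec, smul_mulVec,
      one_mulVec, mulVec_smul]
    rfl
  have htr : ((τ ^ 2 / p) • S ^ 2 + (σ ^ 2 / n) • S).trace =
      τ ^ 2 * mHat2 X + σ ^ 2 * (aspect n p * mHat1 X) := by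
    rw [mHat1, mHat2, aspect, ← hS, sq S]
    simp only [trace_smul, trace_add, smul_eq_mul]
    field_simp
  have htr2 : (((τ ^ 2 / p) • S ^ 2 + (σ ^ 2 / n) • S) *
      ((τ ^ 2 / p) • S ^ 2 + (σ ^ 2 / n) • S)).trace =
      τ ^ 4 / p ^ 2 * (S ^ 4).trace + 2 * τ ^ 2 * σ ^ 2 / (p * n) * (S ^ 3).trace +
      σ ^ 4 / n ^ 2 * (S ^ 2).trace := by
    have e4 : S ^ 2 * S ^ 2 = S ^ 4 := by rw [← pow_add]
    have e3 : S ^ 2 * S = S ^ 3 := (pow_succ S 2).symm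
    have e3' : S * S ^ 2 = S ^ 3 := (pow_succ' S 2).symm
    simp only [add_mul, mul_add, smul_mul_assoc, mul_smul_comm, e4, e3, e3', ← sq S, smul_add,
      trace_smul, trace_add, smul_eq_mul]
    field_simp
    ring
  rw [hNN, htr, htr2] at h1
  refine (lintegral_congr fun ω => ?_).trans_le h1
  have hdiv : ∀ x : ℝ, (n : ℝ)⁻¹ * ((n : ℝ)⁻¹ * x) = x / (n : ℝ) ^ 2 := fun x => by field_simp
  rw [hv, gradErr, smul_dotProduct, dotProduct_smul, smul_eq_mul, smul_eq_mul, hdiv]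

end Estimators

/-! ### Stability of gradient descent in the penalty -/

section Iterates

variable {n p : ℕ} {X : Matrix (Fin n) (Fin p) ℝ} {y : Fin n → ℝ} {θ : Fin p → ℝ}

/-- With step `η = (s + λ)⁻¹` one has `1 - η λ = η s`, so the penalty disappears from the affine map
and survives only in the scalar in front. -/
theorem rgd_succ_eq (hn : n ≠ 0) {s lam : ℝ} (hd : s + lam ≠ 0) (t : ℕ) :
    rgd X y lam (s + lam)⁻¹ θ (t + 1) = (s + lam)⁻¹ •
      (s • rgd X y lam (s + lam)⁻¹ θ t - sampleCov X *ᵥ rgd X y lam (s + lam)⁻¹ θ t +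
        (n : ℝ)⁻¹ • (Xᵀ *ᵥ y)) := by
  rw [rgd]
  generalize rgd X y lam (s + lam)⁻¹ θ t = b
  have hn' : (n : ℝ) ≠ 0 := by exact_mod_cast hn
  have hg : gradLoss X y lam b = lam • b + sampleCov X *ᵥ b - (n : ℝ)⁻¹ • (Xᵀ *ᵥ y) := by
    rw [gradLoss, sampleCov, smul_mulVec, ← mulVec_mulVec, mulVec_sub, smul_add, smul_smul,
      inv_mul_cancel_left₀ hn', smul_neg, smul_sub]
    abel
  rw [hg]
  nth_rewrite 1 [show b = (s + lam)⁻¹ • ((s + lam) • b) by rw [inv_smul_smul₀ hd]]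
  rw [← smul_sub]
  congr 1
  rw [add_smul]
  abel

/-- Hypotheses on the step: `s - Σ̂` has norm at most `r`, the contraction factor for penalties
`≥ l₀` is at most `q`, and the powers and the geometric sums of `q` up to time `T` are at most
`B`. -/
structure StepBound (X : Matrix (Fin n) (Fin p) ℝ) (s l₀ q B : ℝ) (T : ℕ) : Prop where
  step_nonneg : 0 ≤ s
  pen_pos : 0 < l₀
  rate_nonneg : 0 ≤ q
  norm_le : ∃ r, r ≤ q * (s + l₀) ∧ ∀ v, euNorm (s • v - sampleCov X *ᵥ v) ≤ r * euNorm v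
  pow_le : ∀ k ≤ T, q ^ k ≤ B
  sum_le : ∀ k ≤ T, ∑ j ∈ Finset.range k, q ^ j ≤ B

namespace StepBound

variable {s l₀ q B : ℝ} {T : ℕ}

theorem one_le (h : StepBound X s l₀ q B T) : 1 ≤ B := by simpa using h.pow_le 0 (Nat.zero_le _)

/-- The factor `r / (s + λ)` is largest at the smallest admissible penalty, so one rate `q` serves
all of them. -/
theorem euNorm_step_le (h : StepBound X s l₀ q B T) {lam : ℝ} (hl : l₀ ≤ lam) (v : Fin p → ℝ) :
    euNorm ((s + lam)⁻¹ • (s • v - sampleCov X *ᵥ v)) ≤ q * euNorm v := by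
  have hs := h.step_nonneg
  have hl0 := h.pen_pos
  have hq := h.rate_nonneg
  obtain ⟨r, hrq, hr⟩ := h.norm_le
  have hd : 0 < s + lam := by linarith
  rw [euNorm_smul, abs_of_pos (inv_pos.2 hd), inv_mul_le_iff₀ hd]
  calc _ ≤ r * euNorm v := hr v
    _ ≤ (q * (s + lam)) * euNorm v := by
      refine mul_le_mul_of_nonneg_right (hrq.trans ?_) (euNorm_nonneg v)
      exact mul_le_mul_of_nonneg_left (by linarith) hq
    _ = _ := by ring

theorem euNorm_rgd_le (h : StepBound X s l₀ q B T) (hn : n ≠ 0) {lam : ℝ} (hl : l₀ ≤ lam) {k : ℕ}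
    (hk : k ≤ T) : euNorm (rgd X y lam (s + lam)⁻¹ θ k) ≤
      B * (euNorm θ + euNorm ((n : ℝ)⁻¹ • (Xᵀ *ᵥ y)) / l₀) := by
  have hs := h.step_nonneg
  have hl0 := h.pen_pos
  have hq := h.rate_nonneg
  have hd : 0 < s + lam := by linarith
  set g := (n : ℝ)⁻¹ • (Xᵀ *ᵥ y) with hg
  have hg0 := euNorm_nonneg g
  have key : ∀ k, euNorm (rgd X y lam (s + lam)⁻¹ θ k) ≤
      q ^ k * euNorm θ + (∑ j ∈ Finset.range k, q ^ j) * (euNorm g / l₀) := by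
    intro k
    induction k with
    | zero => simp [rgd]
    | succ k ih =>
      rw [rgd_succ_eq hn hd.ne', smul_add]
      refine (euNorm_add_le _ _).trans ?_
      have h1 := h.euNorm_step_le hl (rgd X y lam (s + lam)⁻¹ θ k)
      have h2 : euNorm ((s + lam)⁻¹ • g) ≤ euNorm g / l₀ := by
        rw [euNorm_smul, abs_of_pos (inv_pos.2 hd), inv_mul_eq_div]
        exact div_le_div_of_nonneg_left hg0 hl0 (by linarith)
      rw [geom_sum_succ, pow_succ']
      nlinarith [mul_le_mul_of_nonneg_left ih hq]
  refine (key k).trans ?_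
  rw [mul_add]
  exact add_le_add (mul_le_mul_of_nonneg_right (h.pow_le k hk) (euNorm_nonneg θ))
    (mul_le_mul_of_nonneg_right (h.sum_le k hk) (by positivity))

/-- Discrete Gronwall: both iterations start at `θ`, and their difference obeys the same linear
recursion with a forcing term of size at most `E`, proportional to `|λ - λ'|`. -/
theorem euNorm_rgd_sub_le (h : StepBound X s l₀ q B T) (hn : n ≠ 0) {lam lam' : ℝ}
    (hl : l₀ ≤ lam) (hl' : l₀ ≤ lam') {k : ℕ} (hk : k ≤ T) :
    euNorm (rgd X y lam (s + lam)⁻¹ θ k - rgd X y lam' (s + lam')⁻¹ θ k) ≤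
      B * (|lam - lam'| *
        (q * (B * (euNorm θ + euNorm ((n : ℝ)⁻¹ • (Xᵀ *ᵥ y)) / l₀)) / l₀ +
          euNorm ((n : ℝ)⁻¹ • (Xᵀ *ᵥ y)) / l₀ ^ 2)) := by
  have hs := h.step_nonneg
  have hl0 := h.pen_pos
  have hq := h.rate_nonneg
  have hB := h.one_le
  have hd : 0 < s + lam := by linarith
  have hd' : 0 < s + lam' := by linarith
  have hbd := fun k (hk : k ≤ T) => h.euNorm_rgd_le (y := y) (θ := θ) hn hl' hk
  set g := (n : ℝ)⁻¹ • (Xᵀ *ᵥ y) with hg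
  have hg0 := euNorm_nonneg g
  have hθ0 := euNorm_nonneg θ
  set E := |lam - lam'| * (q * (B * (euNorm θ + euNorm g / l₀)) / l₀ + euNorm g / l₀ ^ 2) with hE
  have hE0 : 0 ≤ E := by positivity
  have key : ∀ k, k ≤ T →
      euNorm (rgd X y lam (s + lam)⁻¹ θ k - rgd X y lam' (s + lam')⁻¹ θ k) ≤
      (∑ j ∈ Finset.range k, q ^ j) * E := by
    intro k
    induction k with
    | zero => simp [rgd, euNorm_zero]
    | succ k ih =>
      intro hk
      have ih := ih (by omega)
      have hb' := hbd k (by omega)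
      rw [rgd_succ_eq hn hd.ne', rgd_succ_eq hn hd'.ne']
      set b := rgd X y lam (s + lam)⁻¹ θ k
      set b' := rgd X y lam' (s + lam')⁻¹ θ k
      have hc : (s + lam)⁻¹ - (s + lam')⁻¹ = (lam' - lam) * (s + lam)⁻¹ * (s + lam')⁻¹ := by
        field_simp
        ring
      -- The common linear map acts on `b - b'`; the change of the scalar `(s + λ)⁻¹` acts on the
      -- second iterate and on `g`.
      have e : (s + lam)⁻¹ • (s • b - sampleCov X *ᵥ b + g) -
          (s + lam')⁻¹ • (s • b' - sampleCov X *ᵥ b' + g) =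
          (s + lam)⁻¹ • (s • (b - b') - sampleCov X *ᵥ (b - b')) +
          (((lam' - lam) * (s + lam)⁻¹) • ((s + lam')⁻¹ • (s • b' - sampleCov X *ᵥ b')) +
            ((lam' - lam) * (s + lam)⁻¹ * (s + lam')⁻¹) • g) := by
        rw [smul_smul _ (s + lam')⁻¹, ← smul_add, ← hc, mulVec_sub, sub_smul, smul_sub s]
        simp only [smul_add, smul_sub]
        abel
      rw [e]
      refine (euNorm_add_le _ _).trans ?_
      have h1 := h.euNorm_step_le hl (b - b')
      have hinv : (s + lam)⁻¹ ≤ l₀⁻¹ := inv_anti₀ hl0 (by linarith)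
      have hinv' : (s + lam')⁻¹ ≤ l₀⁻¹ := inv_anti₀ hl0 (by linarith)
      have h2 : euNorm (((lam' - lam) * (s + lam)⁻¹) •
          ((s + lam')⁻¹ • (s • b' - sampleCov X *ᵥ b'))) ≤
          |lam - lam'| * (q * (B * (euNorm θ + euNorm g / l₀)) / l₀) := by
        rw [euNorm_smul, abs_mul, abs_sub_comm, abs_of_pos (inv_pos.2 hd), mul_assoc]
        refine mul_le_mul_of_nonneg_left ?_ (abs_nonneg _)
        rw [div_eq_inv_mul]
        refine mul_le_mul hinv ((h.euNorm_step_le hl' b').trans ?_) (euNorm_nonneg _)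
          (by positivity)
        exact mul_le_mul_of_nonneg_left hb' hq
      have h3 : euNorm (((lam' - lam) * (s + lam)⁻¹ * (s + lam')⁻¹) • g) ≤
          |lam - lam'| * (euNorm g / l₀ ^ 2) := by
        rw [euNorm_smul, abs_mul, abs_mul, abs_sub_comm, abs_of_pos (inv_pos.2 hd),
          abs_of_pos (inv_pos.2 hd'), mul_assoc, mul_assoc]
        refine mul_le_mul_of_nonneg_left ?_ (abs_nonneg _)
        calc (s + lam)⁻¹ * ((s + lam')⁻¹ * euNorm g) ≤ l₀⁻¹ * (l₀⁻¹ * euNorm g) := by gcongr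
          _ = _ := by field_simp
      have h4 : |lam - lam'| * (q * (B * (euNorm θ + euNorm g / l₀)) / l₀) +
          |lam - lam'| * (euNorm g / l₀ ^ 2) = E := by rw [hE]; ring
      have h5 := euNorm_add_le (((lam' - lam) * (s + lam)⁻¹) •
          ((s + lam')⁻¹ • (s • b' - sampleCov X *ᵥ b')))
          (((lam' - lam) * (s + lam)⁻¹ * (s + lam')⁻¹) • g)
      rw [geom_sum_succ]
      nlinarith [mul_le_mul_of_nonneg_left ih hq]
  exact (key k hk).trans (mul_le_mul_of_nonneg_right (h.sum_le k hk) hE0)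

end StepBound

/-- By symmetry the difference is `(v - w)ᵀ A (v + w)`. -/
theorem abs_quadForm_sub_le {A : Matrix (Fin p) (Fin p) ℝ} (hA : A.PosSemidef) {C : ℝ}
    (hC0 : 0 ≤ C) (hC : ∀ v, v ⬝ᵥ (A *ᵥ v) ≤ C * (v ⬝ᵥ v)) (v w : Fin p → ℝ) :
    |v ⬝ᵥ (A *ᵥ v) - w ⬝ᵥ (A *ᵥ w)| ≤ C * euNorm (v - w) * (euNorm v + euNorm w) := by
  have hT : Aᵀ = A := by simpa using hA.1.eq
  have hn : ∀ v, 0 ≤ v ⬝ᵥ (A *ᵥ v) := fun v => by simpa using hA.dotProduct_mulVec_nonneg v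
  have e : v ⬝ᵥ (A *ᵥ v) - w ⬝ᵥ (A *ᵥ w) = (v - w) ⬝ᵥ (A *ᵥ (v + w)) := by
    have hs : w ⬝ᵥ (A *ᵥ v) = v ⬝ᵥ (A *ᵥ w) := by
      rw [dotProduct_comm, mulVec_dotProduct_eq, hT]
    rw [mulVec_add, sub_dotProduct, dotProduct_add, dotProduct_add, hs]
    ring
  have h1 := euNorm_mulVec_le hA.1 hC0 (fun v => by rw [abs_of_nonneg (hn v)]; exact hC v) (v + w)
  rw [e]
  calc _ ≤ euNorm (v - w) * euNorm (A *ᵥ (v + w)) := abs_dotProduct_le_euNorm _ _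
    _ ≤ euNorm (v - w) * (C * (euNorm v + euNorm w)) := by
      refine mul_le_mul_of_nonneg_left (h1.trans ?_) (euNorm_nonneg _)
      exact mul_le_mul_of_nonneg_left (euNorm_add_le v w) hC0
    _ = _ := by ring

/-- The size `‖β‖ + ‖u‖ / √n` of the random effects. -/
noncomputable def effectSize (β : Fin p → ℝ) (u : Fin n → ℝ) : ℝ := euNorm β + euNorm u / √n

theorem effectSize_nonneg (β : Fin p → ℝ) (u : Fin n → ℝ) : 0 ≤ effectSize β u :=
  add_nonneg (euNorm_nonneg _) (div_nonneg (euNorm_nonneg _) (Real.sqrt_nonneg _))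

/-- The vector is `Σ̂ β + n⁻¹ Xᵀ u`, and `Σ̂ ≤ s` gives `‖Xᵀ‖ ≤ √(n s)`. The assumption `s ≥ 1`
absorbs `√s` into `s`. -/
theorem euNorm_grad_le (hn : n ≠ 0) {s : ℝ} (hs : 1 ≤ s)
    (h : ∀ v, v ⬝ᵥ (sampleCov X *ᵥ v) ≤ s * (v ⬝ᵥ v)) (β : Fin p → ℝ) (u : Fin n → ℝ) :
    euNorm ((n : ℝ)⁻¹ • (Xᵀ *ᵥ (X *ᵥ β + u))) ≤ s * effectSize β u := by
  have hn' : (0 : ℝ) < n := by exact_mod_cast Nat.pos_of_ne_zero hn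
  have hnn : ∀ v, 0 ≤ v ⬝ᵥ (sampleCov X *ᵥ v) := fun v => by
    simpa using (sampleCov_posSemidef X).dotProduct_mulVec_nonneg v
  have e : (n : ℝ)⁻¹ • (Xᵀ *ᵥ (X *ᵥ β + u)) = sampleCov X *ᵥ β + (n : ℝ)⁻¹ • (Xᵀ *ᵥ u) := by
    rw [sampleCov, smul_mulVec, ← mulVec_mulVec, mulVec_add, smul_add]
  have h1 := euNorm_mulVec_le (sampleCov_posSemidef X).1 (by linarith)
    (fun v => by rw [abs_of_nonneg (hnn v)]; exact h v) β
  have hX : ∀ v, euNorm (X *ᵥ v) ≤ √(n * s) * euNorm v := fun v => by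
    rw [euNorm_le_iff (mul_nonneg (Real.sqrt_nonneg _) (euNorm_nonneg v)), mul_pow,
      Real.sq_sqrt (by positivity), euNorm_sq]
    have := h v
    rw [dotProduct_sampleCov_mulVec, inv_mul_le_iff₀ hn'] at this
    linarith
  have h2 := euNorm_transpose_mulVec_le (Real.sqrt_nonneg _) hX u
  have h3 : euNorm ((n : ℝ)⁻¹ • (Xᵀ *ᵥ u)) ≤ s * (euNorm u / √n) := by
    rw [euNorm_smul, abs_of_pos (inv_pos.2 hn'), inv_mul_le_iff₀ hn']
    refine h2.trans ?_
    rw [Real.sqrt_mul hn'.le]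
    have hsn : √(n : ℝ) * √(n : ℝ) = n := Real.mul_self_sqrt hn'.le
    have hs' : √s ≤ s := by
      rw [Real.sqrt_le_left (by linarith)]
      nlinarith
    have hsn0 : 0 < √(n : ℝ) := Real.sqrt_pos.2 hn'
    have : (n : ℝ) * (s * (euNorm u / √n)) = √n * s * euNorm u := by
      field_simp
      rw [Real.sq_sqrt hn'.le]
      ring
    rw [this]
    have := euNorm_nonneg u
    gcongr
  rw [e, effectSize, mul_add]
  exact (euNorm_add_le _ _).trans (add_le_add h1 h3)

/-- A bound for the distance of the iterates to the signal. -/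
noncomputable def iterConst (B Θ s l₀ : ℝ) : ℝ := B * (Θ + s / l₀) + 1

/-- A Lipschitz constant of the iterates in the penalty. -/
noncomputable def gapConst (q B Θ s l₀ : ℝ) : ℝ :=
  B * (q * (B * (Θ + s / l₀)) / l₀ + s / l₀ ^ 2)

variable {s₁ l₀ q B s Θ C : ℝ} {T : ℕ}

theorem euNorm_rgd_sub_signal_le (h : StepBound X s₁ l₀ q B T) (hn : n ≠ 0) (hs : 1 ≤ s)
    (hcov : ∀ v, v ⬝ᵥ (sampleCov X *ᵥ v) ≤ s * (v ⬝ᵥ v)) (hθ : euNorm θ ≤ Θ) {lam : ℝ}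
    (hl : l₀ ≤ lam) {k : ℕ} (hk : k ≤ T) (β : Fin p → ℝ) (u : Fin n → ℝ) :
    euNorm (rgd X (X *ᵥ β + u) lam (s₁ + lam)⁻¹ θ k - β) ≤
      iterConst B Θ s l₀ * (1 + effectSize β u) := by
  have h1 := h.euNorm_rgd_le (y := X *ᵥ β + u) (θ := θ) hn hl hk
  have h2 := euNorm_grad_le hn hs hcov β u
  have hl0 := h.pen_pos
  have hB := h.one_le
  have hρ := effectSize_nonneg β u
  have hΘ : 0 ≤ Θ := (euNorm_nonneg _).trans hθ
  have hβ : euNorm β ≤ effectSize β u :=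
    le_add_of_nonneg_right (div_nonneg (euNorm_nonneg _) (Real.sqrt_nonneg _))
  refine (euNorm_sub_le _ _).trans ?_
  calc _ ≤ B * (Θ + s * effectSize β u / l₀) + effectSize β u :=
        add_le_add (h1.trans (by gcongr)) hβ
    _ ≤ _ := by
      have e : s * effectSize β u / l₀ = s / l₀ * effectSize β u := by ring
      rw [iterConst, e]
      have : 0 ≤ B * Θ * effectSize β u := by positivity
      have : 0 ≤ B * (s / l₀) := by positivity
      nlinarith

/-- Both the gap between the iterates and their distance to the signal grow linearly in `1 + ρ`,
which produces the square. -/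
theorem abs_loss_sub_le {A : Matrix (Fin p) (Fin p) ℝ} (hA : A.PosSemidef) (hC0 : 0 ≤ C)
    (hC : ∀ v, v ⬝ᵥ (A *ᵥ v) ≤ C * (v ⬝ᵥ v))
    (h : StepBound X s₁ l₀ q B T) (hn : n ≠ 0) (hs : 1 ≤ s)
    (hcov : ∀ v, v ⬝ᵥ (sampleCov X *ᵥ v) ≤ s * (v ⬝ᵥ v)) (hθ : euNorm θ ≤ Θ) {lam lam' : ℝ}
    (hl : l₀ ≤ lam) (hl' : l₀ ≤ lam') {k : ℕ} (hk : k ≤ T) (β : Fin p → ℝ) (u : Fin n → ℝ) :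
    |(rgd X (X *ᵥ β + u) lam (s₁ + lam)⁻¹ θ k - β) ⬝ᵥ
        (A *ᵥ (rgd X (X *ᵥ β + u) lam (s₁ + lam)⁻¹ θ k - β)) -
      (rgd X (X *ᵥ β + u) lam' (s₁ + lam')⁻¹ θ k - β) ⬝ᵥ
        (A *ᵥ (rgd X (X *ᵥ β + u) lam' (s₁ + lam')⁻¹ θ k - β))| ≤
      2 * C * gapConst q B Θ s l₀ * iterConst B Θ s l₀ * |lam - lam'| *
        (1 + effectSize β u) ^ 2 := by
  have h1 := abs_quadForm_sub_le hA hC0 hC (rgd X (X *ᵥ β + u) lam (s₁ + lam)⁻¹ θ k - β)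
    (rgd X (X *ᵥ β + u) lam' (s₁ + lam')⁻¹ θ k - β)
  rw [sub_sub_sub_cancel_right] at h1
  have h2 := euNorm_rgd_sub_signal_le h hn hs hcov hθ hl hk β u
  have h3 := euNorm_rgd_sub_signal_le h hn hs hcov hθ hl' hk β u
  have h4 := h.euNorm_rgd_sub_le (y := X *ᵥ β + u) (θ := θ) hn hl hl' hk
  have h5 := euNorm_grad_le hn hs hcov β u
  have hl0 := h.pen_pos
  have hB := h.one_le
  have hq := h.rate_nonneg
  have hρ := effectSize_nonneg β u
  have hΘ : 0 ≤ Θ := (euNorm_nonneg _).trans hθ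
  set ρ := effectSize β u
  set Δ := |lam - lam'| with hΔ
  have hΔ0 : 0 ≤ Δ := abs_nonneg _
  have h6 : euNorm (rgd X (X *ᵥ β + u) lam (s₁ + lam)⁻¹ θ k -
      rgd X (X *ᵥ β + u) lam' (s₁ + lam')⁻¹ θ k) ≤ gapConst q B Θ s l₀ * Δ * (1 + ρ) := by
    refine h4.trans ?_
    calc _ ≤ B * (Δ * (q * (B * (Θ + s * ρ / l₀)) / l₀ + s * ρ / l₀ ^ 2)) := by gcongr
      _ ≤ B * (Δ * (q * (B * ((Θ + s / l₀) * (1 + ρ))) / l₀ + s / l₀ ^ 2 * (1 + ρ))) := by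
        have e1 : Θ + s * ρ / l₀ ≤ (Θ + s / l₀) * (1 + ρ) := by
          have : s * ρ / l₀ = s / l₀ * ρ := by ring
          rw [this]
          have : 0 ≤ Θ * ρ := by positivity
          have : 0 ≤ s / l₀ := by positivity
          nlinarith
        have e2 : s * ρ / l₀ ^ 2 ≤ s / l₀ ^ 2 * (1 + ρ) := by
          have : s * ρ / l₀ ^ 2 = s / l₀ ^ 2 * ρ := by ring
          rw [this]
          gcongr
          linarith
        gcongr
      _ = _ := by
        rw [gapConst]
        ring
  have hD2 : 0 ≤ gapConst q B Θ s l₀ := by unfold gapConst; positivity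
  have hD1 : 0 ≤ iterConst B Θ s l₀ := by unfold iterConst; positivity
  calc _ ≤ C * (gapConst q B Θ s l₀ * Δ * (1 + ρ)) *
        (iterConst B Θ s l₀ * (1 + ρ) + iterConst B Θ s l₀ * (1 + ρ)) := by
        have := euNorm_nonneg (rgd X (X *ᵥ β + u) lam (s₁ + lam)⁻¹ θ k - β)
        have := euNorm_nonneg (rgd X (X *ᵥ β + u) lam' (s₁ + lam')⁻¹ θ k - β)
        refine h1.trans ?_
        gcongr
    _ = _ := by ring

theorem loss_le {A : Matrix (Fin p) (Fin p) ℝ} (hC0 : 0 ≤ C)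
    (hC : ∀ v, v ⬝ᵥ (A *ᵥ v) ≤ C * (v ⬝ᵥ v))
    (h : StepBound X s₁ l₀ q B T) (hn : n ≠ 0) (hs : 1 ≤ s)
    (hcov : ∀ v, v ⬝ᵥ (sampleCov X *ᵥ v) ≤ s * (v ⬝ᵥ v)) (hθ : euNorm θ ≤ Θ) {lam : ℝ}
    (hl : l₀ ≤ lam) {k : ℕ} (hk : k ≤ T) (β : Fin p → ℝ) (u : Fin n → ℝ) :
    (rgd X (X *ᵥ β + u) lam (s₁ + lam)⁻¹ θ k - β) ⬝ᵥ
        (A *ᵥ (rgd X (X *ᵥ β + u) lam (s₁ + lam)⁻¹ θ k - β)) ≤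
      C * iterConst B Θ s l₀ ^ 2 * (1 + effectSize β u) ^ 2 := by
  have h2 := euNorm_rgd_sub_signal_le h hn hs hcov hθ hl hk β u
  refine (hC _).trans ?_
  rw [← euNorm_sq, mul_assoc, ← mul_pow]
  have := euNorm_nonneg (rgd X (X *ᵥ β + u) lam (s₁ + lam)⁻¹ θ k - β)
  gcongr

/-- Without any assumption on the step the iterates grow at most geometrically. -/
theorem stepBound_of_cov_le (hs₁ : 0 ≤ s₁) (hl₀ : 0 < l₀) (hs : 1 ≤ s)
    (hcov : ∀ v, v ⬝ᵥ (sampleCov X *ᵥ v) ≤ s * (v ⬝ᵥ v)) (T : ℕ) :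
    StepBound X s₁ l₀ (1 + s / l₀) ((T + 1) * (1 + s / l₀) ^ T) T := by
  have hq : 1 ≤ 1 + s / l₀ := le_add_of_nonneg_right (by positivity)
  have hnn : ∀ v, 0 ≤ v ⬝ᵥ (sampleCov X *ᵥ v) := fun v => by
    simpa using (sampleCov_posSemidef X).dotProduct_mulVec_nonneg v
  -- The triangle inequality gives `r = s₁ + s`, and `r ≤ (1 + s / l₀) (s₁ + l₀)` for every `s₁ ≥
  -- 0`. The rate does not involve `s₁`, so no upper bound on it is needed.
  refine ⟨hs₁, hl₀, by linarith, ⟨s₁ + s, ?_, fun v => ?_⟩, fun k hk => ?_, fun k hk => ?_⟩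
  · have : (1 + s / l₀) * (s₁ + l₀) = s₁ + l₀ + s / l₀ * s₁ + s := by
      field_simp
      ring
    rw [this]
    have : 0 ≤ s / l₀ * s₁ := by positivity
    linarith
  · have h1 := euNorm_mulVec_le (q := s) (sampleCov_posSemidef X).1 (by linarith)
      (fun v => by rw [abs_of_nonneg (hnn v)]; exact hcov v) v
    refine (euNorm_sub_le _ _).trans ?_
    rw [euNorm_smul, abs_of_nonneg hs₁]
    linarith
  · have h1 := pow_le_pow_right₀ hq hk
    have : 0 ≤ (T : ℝ) * (1 + s / l₀) ^ T := by positivity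
    linarith
  · calc ∑ j ∈ Finset.range k, (1 + s / l₀) ^ j ≤ ∑ j ∈ Finset.range k, (1 + s / l₀) ^ T :=
          Finset.sum_le_sum fun j hj =>
            pow_le_pow_right₀ hq ((Finset.mem_range.1 hj).le.trans hk)
      _ = k * (1 + s / l₀) ^ T := by simp
      _ ≤ _ := by
        have : (k : ℝ) ≤ T + 1 := by exact_mod_cast hk.trans (Nat.le_succ T)
        gcongr

/-- A step at most the inverse of the largest eigenvalue makes the iteration a contraction. -/
theorem stepBound_of_cov_le_step {K : ℝ} (hs₁ : 0 ≤ s₁) (hl₀ : 0 < l₀) (hK : s₁ ≤ K)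
    (hcov : ∀ v, v ⬝ᵥ (sampleCov X *ᵥ v) ≤ s₁ * (v ⬝ᵥ v)) (T : ℕ) :
    StepBound X s₁ l₀ (K / (K + l₀)) ((K + l₀) / l₀) T := by
  have hK0 : 0 ≤ K := hs₁.trans hK
  have hnn : ∀ v, 0 ≤ v ⬝ᵥ (sampleCov X *ᵥ v) := fun v => by
    simpa using (sampleCov_posSemidef X).dotProduct_mulVec_nonneg v
  have hq0 : 0 ≤ K / (K + l₀) := by positivity
  have hq1 : K / (K + l₀) < 1 := by
    rw [div_lt_one (by positivity)]
    linarith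
  have hB : 1 ≤ (K + l₀) / l₀ := by
    rw [le_div_iff₀ hl₀]
    linarith
  -- Since `0 ≤ Σ̂ ≤ s₁`, the matrix `s₁ - Σ̂` has norm at most `s₁`, and `s₁ / (s₁ + l₀)` increases
  -- in `s₁`. The bound `(K + l₀) / l₀` is the full geometric series of this rate.
  refine ⟨hs₁, hl₀, hq0, ⟨s₁, ?_, fun v => ?_⟩, fun k _ => (pow_le_one₀ hq0 hq1.le).trans hB,
    fun k _ => ?_⟩
  · rw [div_mul_eq_mul_div, le_div_iff₀ (by positivity)]
    nlinarith
  · have hH : (s₁ • (1 : Matrix (Fin p) (Fin p) ℝ) - sampleCov X).IsHermitian :=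
      IsHermitian.sub (by simp [IsHermitian]) (sampleCov_posSemidef X).1
    have h1 := euNorm_mulVec_le hH hs₁ (fun v => ?_) v
    · rwa [sub_mulVec, smul_mulVec, one_mulVec] at h1
    · rw [sub_mulVec, smul_mulVec, one_mulVec, dotProduct_sub, dotProduct_smul, smul_eq_mul,
        abs_of_nonneg (by linarith [hcov v])]
      linarith [hnn v]
  · have h1 := geom_sum_eq hq1.ne k
    have h2 : (K / (K + l₀) - 1) = -(l₀ / (K + l₀)) := by
      field_simp
      ring
    rw [h1, h2, div_neg, ← neg_div, neg_sub, div_div_eq_mul_div]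
    have : 0 ≤ (K / (K + l₀)) ^ k := by positivity
    gcongr
    nlinarith

end Iterates

/-! ### Conditional expectations of close random variables -/

section CondGap

variable {Ω : Type*} {m m₀ : MeasurableSpace Ω} {P : Measure[m₀] Ω} [IsProbabilityMeasure P]

open scoped Classical in
/-- The conditional expectation of a variable dominated by `g` on a `m`-measurable event, as seen
through a majorant which is infinite off the event. -/
theorem setLIntegral_condLExp_piecewise (hm : m ≤ m₀) {S : Set Ω} (hS : MeasurableSet[m] S)
    (g : Ω → ℝ≥0∞) :
    ∫⁻ ω in S, condLExp m P (S.piecewise g fun _ => ∞) ω ∂P = ∫⁻ ω in S, g ω ∂P := by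
  rw [setLIntegral_condLExp hm P _ hS]
  exact setLIntegral_congr_fun (hm S hS) fun ω hω => Set.piecewise_eq_of_mem _ _ _ hω

/-- A conditional expectation is almost surely finite if it is integrable on measurable events that
exhaust the space. -/
theorem condLExp_ne_top_of_cover (hm : m ≤ m₀) {f : Ω → ℝ≥0∞} {S : ℕ → Set Ω}
    (hS : ∀ k, MeasurableSet[m] (S k)) (hcover : ∀ ω, ∃ k, ω ∈ S k)
    (hint : ∀ k, ∫⁻ ω in S k, f ω ∂P ≠ ∞) : ∀ᵐ ω ∂P, condLExp m P f ω ≠ ∞ := by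
  have h : ∀ k, ∀ᵐ ω ∂P, ω ∈ S k → condLExp m P f ω ≠ ∞ := by
    intro k
    rw [← ae_restrict_iff' (hm _ (hS k))]
    have h1 : ∫⁻ ω in S k, condLExp m P f ω ∂P ≠ ∞ := by
      rw [setLIntegral_condLExp hm P _ (hS k)]
      exact hint k
    filter_upwards [ae_lt_top' (by fun_prop) h1] with ω hω using hω.ne
  filter_upwards [ae_all_iff.2 h] with ω hω
  obtain ⟨k, hk⟩ := hcover ω
  exact hω k hk

/-- If two families of variables differ by at most `g` on a `m`-measurable event, then so do their
conditional expectations, up to the probability given by Markov's inequality. -/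
theorem measure_iSup_condLExp_gap_le (hm : m ≤ m₀) {ι : Type*} [Countable ι]
    {f₁ f₂ : ι → Ω → ℝ} {g : Ω → ℝ} (hg : Measurable g) {S : Set Ω} (hS : MeasurableSet[m] S)
    (hgap : ∀ i, ∀ ω ∈ S, |f₁ i ω - f₂ i ω| ≤ g ω)
    (hfin : ∀ i, ∀ᵐ ω ∂P, condLExp m P (fun ω => ENNReal.ofReal (f₁ i ω)) ω ≠ ∞ ∧
      condLExp m P (fun ω => ENNReal.ofReal (f₂ i ω)) ω ≠ ∞) {δ : ℝ} (hδ : 0 < δ) :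
    P {ω | ENNReal.ofReal δ ≤ ⨆ i, ENNReal.ofReal
      |(condLExp m P (fun ω => ENNReal.ofReal (f₁ i ω)) ω).toReal -
        (condLExp m P (fun ω => ENNReal.ofReal (f₂ i ω)) ω).toReal|} ≤
      P Sᶜ + (∫⁻ ω in S, ENNReal.ofReal (g ω) ∂P) / ENNReal.ofReal δ := by
  classical
  -- The value `∞` off `S` makes the domination hold on the whole space, so monotonicity of
  -- conditional expectation applies. The event `S` reappears only in the final integral.
  set G : Ω → ℝ≥0∞ := S.piecewise (fun ω => ENNReal.ofReal (g ω)) fun _ => ∞ with hG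
  have hGm : Measurable G := Measurable.piecewise (hm S hS) hg.ennreal_ofReal measurable_const
  have hdom : ∀ a b : Ω → ℝ, (∀ ω ∈ S, a ω ≤ b ω + g ω) →
      ∀ᵐ ω ∂P, condLExp m P (fun ω => ENNReal.ofReal (a ω)) ω ≤
        condLExp m P (fun ω => ENNReal.ofReal (b ω)) ω + condLExp m P G ω := by
    intro a b hab
    have h1 : (fun ω => ENNReal.ofReal (a ω)) ≤ᵐ[P] (fun ω => ENNReal.ofReal (b ω)) + G := by
      refine ae_of_all _ fun ω => ?_
      by_cases hω : ω ∈ S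
      · simp only [Pi.add_apply, hG, Set.piecewise_eq_of_mem _ _ _ hω]
        exact (ENNReal.ofReal_le_ofReal (hab ω hω)).trans ENNReal.ofReal_add_le
      · simp [hG, hω]
    filter_upwards [condLExp_mono (mΩ := m) h1,
      condLExp_add_right (mΩ := m) (fun ω => ENNReal.ofReal (b ω)) hGm.aemeasurable] with ω h2 h3
    rw [h3] at h2
    exact h2
  have hle : ∀ i, ∀ᵐ ω ∂P, ENNReal.ofReal
      |(condLExp m P (fun ω => ENNReal.ofReal (f₁ i ω)) ω).toReal -
        (condLExp m P (fun ω => ENNReal.ofReal (f₂ i ω)) ω).toReal| ≤ condLExp m P G ω := by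
    intro i
    filter_upwards [hfin i,
      hdom (f₁ i) (f₂ i) fun ω hω => by linarith [le_of_abs_le (hgap i ω hω)],
      hdom (f₂ i) (f₁ i) fun ω hω => by linarith [neg_le_of_abs_le (hgap i ω hω)]]
      with ω hf h1 h2
    generalize condLExp m P (fun ω => ENNReal.ofReal (f₁ i ω)) ω = a at *
    generalize condLExp m P (fun ω => ENNReal.ofReal (f₂ i ω)) ω = b at *
    generalize condLExp m P G ω = c at *
    by_cases hc : c = ∞
    · simp [hc]
    · have h3 := ENNReal.toReal_mono (ENNReal.add_ne_top.2 ⟨hf.2, hc⟩) h1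
      have h4 := ENNReal.toReal_mono (ENNReal.add_ne_top.2 ⟨hf.1, hc⟩) h2
      rw [ENNReal.toReal_add hf.2 hc] at h3
      rw [ENNReal.toReal_add hf.1 hc] at h4
      rw [← ENNReal.ofReal_toReal hc]
      refine ENNReal.ofReal_le_ofReal (abs_le.2 ⟨by linarith, by linarith⟩)
  have hsub : {ω | ENNReal.ofReal δ ≤ ⨆ i, ENNReal.ofReal
      |(condLExp m P (fun ω => ENNReal.ofReal (f₁ i ω)) ω).toReal -
        (condLExp m P (fun ω => ENNReal.ofReal (f₂ i ω)) ω).toReal|} ≤ᵐ[P]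
      (Sᶜ ∪ ({ω | ENNReal.ofReal δ ≤ condLExp m P G ω} ∩ S) : Set Ω) := by
    filter_upwards [ae_all_iff.2 hle] with ω hω hδω
    by_cases hωS : ω ∈ S
    · exact Or.inr ⟨hδω.trans (iSup_le hω), hωS⟩
    · exact Or.inl hωS
  refine (measure_mono_ae hsub).trans ((measure_union_le _ _).trans (add_le_add le_rfl ?_))
  have hGc : Measurable (condLExp m P G) := by fun_prop
  have h1 := meas_ge_le_lintegral_div (μ := P.restrict S) (f := condLExp m P G)
    (ε := ENNReal.ofReal δ) hGc.aemeasurable (by simpa using hδ) (by simp)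
  rw [Measure.restrict_apply (measurableSet_le measurable_const hGc)] at h1
  refine h1.trans_eq ?_
  rw [hG, setLIntegral_condLExp_piecewise hm hS]

end CondGap

/-! ### The model at a fixed sample size -/

section FixedSize

variable {Ω : Type*} [MeasurableSpace Ω] {P : Measure Ω} {n p : ℕ}

/-- The standardized random effects. -/
noncomputable def effectVec (σ τ : ℝ) (β : Ω → Fin p → ℝ) (u : Ω → Fin n → ℝ) (ω : Ω) :
    Fin p ⊕ Fin n → ℝ :=
  Sum.elim (fun j => √p / τ * β ω j) (fun i => σ⁻¹ * u ω i)

/-- The assumptions of the model at a fixed sample size. -/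
structure FixedModel (P : Measure Ω) (Sigma : Matrix (Fin p) (Fin p) ℝ)
    (Z : Ω → Fin n → Fin p → ℝ) (β : Ω → Fin p → ℝ) (u : Ω → Fin n → ℝ) (σ τ M C : ℝ) : Prop where
  n_pos : 0 < n
  p_pos : 0 < p
  sigma_pos : 0 < σ
  tau_pos : 0 < τ
  moment_nonneg : 0 ≤ M
  bound_nonneg : 0 ≤ C
  posSemidef : Sigma.PosSemidef
  quad_le : ∀ v, v ⬝ᵥ (Sigma *ᵥ v) ≤ C * (v ⬝ᵥ v)
  measurable_design : Measurable Z
  measurable_beta : Measurable β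
  measurable_noise : Measurable u
  design : StdEntries P (fun ω (x : Fin n × Fin p) => Z ω x.1 x.2) M
  effects : StdEntries P (effectVec σ τ β u) M
  indep : IndepFun Z (effectVec σ τ β u) P

namespace FixedModel

variable {Sigma : Matrix (Fin p) (Fin p) ℝ} {Z : Ω → Fin n → Fin p → ℝ} {β : Ω → Fin p → ℝ}
  {u : Ω → Fin n → ℝ} {σ τ M C : ℝ}

theorem beta_eq (h : FixedModel P Sigma Z β u σ τ M C) (ω : Ω) :
    β ω = (τ / √p) • fun j => effectVec σ τ β u ω (Sum.inl j) := by
  have hp : (0 : ℝ) < p := by exact_mod_cast h.p_pos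
  have := (Real.sqrt_pos.2 hp).ne'
  have := h.tau_pos.ne'
  ext j
  simp only [effectVec, Sum.elim_inl, Pi.smul_apply, smul_eq_mul]
  field_simp

theorem noise_eq (h : FixedModel P Sigma Z β u σ τ M C) (ω : Ω) :
    u ω = σ • fun i => effectVec σ τ β u ω (Sum.inr i) := by
  have := h.sigma_pos.ne'
  ext i
  simp only [effectVec, Sum.elim_inr, Pi.smul_apply, smul_eq_mul]
  field_simp

theorem measurable_design_fun (h : FixedModel P Sigma Z β u σ τ M C) :
    Measurable fun ω (i : Fin n) (j : Fin p) => RGD.design Sigma Z ω i j := by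
  have : Continuous fun z : Fin n → Fin p → ℝ =>
      (fun i j => (Matrix.of z * psdSqrt Sigma) i j : Fin n → Fin p → ℝ) := by
    simp only [mul_apply, of_apply]
    fun_prop
  exact this.measurable.comp h.measurable_design

theorem sigmaAlg_le (h : FixedModel P Sigma Z β u σ τ M C) :
    sigmaAlg (RGD.design Sigma Z) ≤ ‹MeasurableSpace Ω› :=
  h.measurable_design_fun.comap_le

theorem continuous_euNorm {ι : Type*} [Fintype ι] : Continuous fun v : ι → ℝ => euNorm v := by
  unfold euNorm
  fun_prop

theorem measurable_effectSize (h : FixedModel P Sigma Z β u σ τ M C) :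
    Measurable fun ω => effectSize (β ω) (u ω) := by
  unfold effectSize
  exact (continuous_euNorm.measurable.comp h.measurable_beta).add
    ((continuous_euNorm.measurable.comp h.measurable_noise).div_const _)

theorem continuous_normErr (σ τ : ℝ) : Continuous fun x : (Fin n → Fin p → ℝ) × (Fin n → ℝ) =>
    normErr σ τ (Matrix.of x.1) x.2 := by
  simp only [normErr, mHat1, sampleCov, trace, diag_apply, Matrix.smul_apply, mul_apply, transpose_apply,
    of_apply, dotProduct]
  fun_prop

theorem continuous_gradErr (σ τ : ℝ) : Continuous fun x : (Fin n → Fin p → ℝ) × (Fin n → ℝ) =>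
    gradErr σ τ (Matrix.of x.1) x.2 := by
  simp only [gradErr, mHat1, mHat2, sampleCov, trace, diag_apply, Matrix.smul_apply, mul_apply,
    transpose_apply, of_apply, dotProduct, mulVec]
  fun_prop

theorem continuous_response (Sigma : Matrix (Fin p) (Fin p) ℝ) (α ς : ℝ) :
    Continuous fun x : (Fin n → Fin p → ℝ) × (Fin p ⊕ Fin n → ℝ) =>
      ((fun i j => (Matrix.of x.1 * psdSqrt Sigma) i j : Fin n → Fin p → ℝ),
        (Matrix.of x.1 * psdSqrt Sigma) *ᵥ (α • fun j => x.2 (Sum.inl j)) +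
          ς • fun i => x.2 (Sum.inr i)) := by
  refine Continuous.prodMk ?_ ?_
  · simp only [mul_apply, of_apply]
    fun_prop
  · refine continuous_pi fun i => ?_
    simp only [mulVec, dotProduct, mul_apply, of_apply, Pi.add_apply, Pi.smul_apply]
    fun_prop

variable [IsProbabilityMeasure P]

/-- The random effects have a bounded fourth moment. -/
theorem lintegral_effectSize_le (h : FixedModel P Sigma Z β u σ τ M C) :
    ∫⁻ ω, ENNReal.ofReal ((1 + effectSize (β ω) (u ω)) ^ 4) ∂P ≤
      ENNReal.ofReal (27 * (1 + (τ ^ 4 + σ ^ 4) * M)) := by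
  have hn' : (0 : ℝ) < n := by exact_mod_cast h.n_pos
  have hp' : (0 : ℝ) < p := by exact_mod_cast h.p_pos
  set ξ := effectVec σ τ β u with hξ
  -- Cauchy-Schwarz for three terms, used twice: `3² · 3 = 27`.
  have hpow : ∀ a b : ℝ, (1 + (a + b)) ^ 4 ≤ 27 * (1 + (a ^ 2) ^ 2 + (b ^ 2) ^ 2) := by
    intro a b
    have h1 : (1 + (a + b)) ^ 2 ≤ 3 * (1 + a ^ 2 + b ^ 2) := by
      nlinarith [sq_nonneg (a - 1), sq_nonneg (b - 1), sq_nonneg (a - b)]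
    have h2 : (1 + a ^ 2 + b ^ 2) ^ 2 ≤ 3 * (1 + (a ^ 2) ^ 2 + (b ^ 2) ^ 2) := by
      nlinarith [sq_nonneg (a ^ 2 - 1), sq_nonneg (b ^ 2 - 1), sq_nonneg (a ^ 2 - b ^ 2)]
    have h3 := pow_le_pow_left₀ (sq_nonneg _) h1 2
    nlinarith
  have hb : ∀ ω, (euNorm (β ω) ^ 2) ^ 2 ≤ τ ^ 4 / p * ∑ j, ξ ω (Sum.inl j) ^ 4 := by
    intro ω
    rw [euNorm_sq, h.beta_eq ω, dotProduct]
    refine (sq_sum_le_card_mul_sum_sq).trans_eq ?_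
    rw [Finset.mul_sum, Finset.mul_sum]
    refine Finset.sum_congr rfl fun j _ => ?_
    have hsp : √(p : ℝ) ^ 2 = p := Real.sq_sqrt hp'.le
    have hsp0 : √(p : ℝ) ≠ 0 := (Real.sqrt_pos.2 hp').ne'
    simp only [Pi.smul_apply, smul_eq_mul, Finset.card_univ, Fintype.card_fin]
    have e : (τ / √p * ξ ω (Sum.inl j) * (τ / √p * ξ ω (Sum.inl j))) =
        τ ^ 2 / p * ξ ω (Sum.inl j) ^ 2 := by
      rw [show τ / √p * ξ ω (Sum.inl j) * (τ / √p * ξ ω (Sum.inl j)) =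
        τ ^ 2 / √p ^ 2 * ξ ω (Sum.inl j) ^ 2 by field_simp, hsp]
    rw [← hξ, e]
    field_simp
  have hu : ∀ ω, ((euNorm (u ω) / √n) ^ 2) ^ 2 ≤ σ ^ 4 / n * ∑ i, ξ ω (Sum.inr i) ^ 4 := by
    intro ω
    rw [div_pow, Real.sq_sqrt hn'.le, euNorm_sq, h.noise_eq ω, dotProduct, div_pow,
      div_le_iff₀ (by positivity)]
    refine (sq_sum_le_card_mul_sum_sq).trans_eq ?_
    rw [Finset.mul_sum, Finset.mul_sum, Finset.sum_mul]
    refine Finset.sum_congr rfl fun j _ => ?_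
    simp only [Pi.smul_apply, smul_eq_mul, Finset.card_univ, Fintype.card_fin, ← hξ]
    field_simp
  have hI : ∀ i, Integrable (fun ω => ξ ω i ^ 4) P := h.effects.integrable_fourth
  have hI1 : Integrable (fun ω => ∑ j, ξ ω (Sum.inl j) ^ 4) P :=
    integrable_finsetSum _ fun j _ => hI _
  have hI2 : Integrable (fun ω => ∑ i, ξ ω (Sum.inr i) ^ 4) P :=
    integrable_finsetSum _ fun j _ => hI _
  have hI3 : Integrable (fun ω => 27 * (1 + τ ^ 4 / p * ∑ j, ξ ω (Sum.inl j) ^ 4 +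
      σ ^ 4 / n * ∑ i, ξ ω (Sum.inr i) ^ 4)) P :=
    (((integrable_const _).add (hI1.const_mul _)).add (hI2.const_mul _)).const_mul _
  calc _ ≤ ∫⁻ ω, ENNReal.ofReal (27 * (1 + τ ^ 4 / p * ∑ j, ξ ω (Sum.inl j) ^ 4 +
        σ ^ 4 / n * ∑ i, ξ ω (Sum.inr i) ^ 4)) ∂P := by
        refine lintegral_mono fun ω => ENNReal.ofReal_le_ofReal ?_
        rw [effectSize]
        refine (hpow _ _).trans ?_
        linarith [hb ω, hu ω]
    _ = ENNReal.ofReal (∫ ω, 27 * (1 + τ ^ 4 / p * ∑ j, ξ ω (Sum.inl j) ^ 4 +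
        σ ^ 4 / n * ∑ i, ξ ω (Sum.inr i) ^ 4) ∂P) := by
        refine (ofReal_integral_eq_lintegral_ofReal hI3 (ae_of_all _ fun ω => ?_)).symm
        positivity
    _ ≤ _ := by
        refine ENNReal.ofReal_le_ofReal ?_
        rw [integral_const_mul, integral_add
          (f := fun ω => 1 + τ ^ 4 / p * ∑ j, ξ ω (Sum.inl j) ^ 4)
          ((integrable_const _).add (hI1.const_mul _)) (hI2.const_mul _),
          integral_add (f := fun _ => (1 : ℝ)) (integrable_const _) (hI1.const_mul _),
          integral_const_mul, integral_const_mul, integral_finsetSum _ fun j _ => hI _,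
          integral_finsetSum _ fun j _ => hI _]
        have s1 : ∑ j, ∫ ω, ξ ω (Sum.inl j) ^ 4 ∂P ≤ p * M := by
          refine (Finset.sum_le_sum fun j _ => h.effects.fourth_moment _).trans_eq ?_
          simp
        have s2 : ∑ i, ∫ ω, ξ ω (Sum.inr i) ^ 4 ∂P ≤ n * M := by
          refine (Finset.sum_le_sum fun j _ => h.effects.fourth_moment _).trans_eq ?_
          simp
        have t1 : τ ^ 4 / p * ∑ j, ∫ ω, ξ ω (Sum.inl j) ^ 4 ∂P ≤ τ ^ 4 * M := by
          refine (mul_le_mul_of_nonneg_left s1 (by positivity)).trans_eq ?_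
          field_simp
        have t2 : σ ^ 4 / n * ∑ i, ∫ ω, ξ ω (Sum.inr i) ^ 4 ∂P ≤ σ ^ 4 * M := by
          refine (mul_le_mul_of_nonneg_left s2 (by positivity)).trans_eq ?_
          field_simp
        simp only [integral_const, probReal_univ, smul_eq_mul, one_mul]
        linarith

/-- The mean square errors of the two statistics, on an event determined by the design where the
sample covariance is bounded by `s`. -/
theorem setLIntegral_errors_le (h : FixedModel P Sigma Z β u σ τ M C)
    {E : Set (Fin n → Fin p → ℝ)} (hE : MeasurableSet E) {s : ℝ} (hs : 1 ≤ s)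
    (hcov : ∀ x ∈ E, ∀ v, v ⬝ᵥ (sampleCov (Matrix.of x) *ᵥ v) ≤ s * (v ⬝ᵥ v)) :
    ∫⁻ ω in {ω | (fun i j => RGD.design Sigma Z ω i j) ∈ E}, ENNReal.ofReal
      (normErr σ τ (RGD.design Sigma Z ω) (response Sigma Z β u ω) ^ 2 +
        gradErr σ τ (RGD.design Sigma Z ω) (response Sigma Z β u ω) ^ 2) ∂P ≤
      ENNReal.ofReal (2 * (M + 2) * s ^ 4 *
        (τ ^ 4 / p + 2 * τ ^ 2 * σ ^ 2 / n + σ ^ 4 * (1 + aspect n p) / n)) := by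
  have hn' : (0 : ℝ) < n := by exact_mod_cast h.n_pos
  have hp' : (0 : ℝ) < p := by exact_mod_cast h.p_pos
  have hM := h.moment_nonneg
  set r : ℝ := τ ^ 4 / p + 2 * τ ^ 2 * σ ^ 2 / n + σ ^ 4 * (1 + aspect n p) / n with hr
  set ξ := effectVec σ τ β u with hξ
  have hξm : Measurable ξ := measurable_pi_lambda _ h.effects.measurable
  set D : (Fin n → Fin p → ℝ) → Fin n → Fin p → ℝ :=
    fun z i j => (Matrix.of z * psdSqrt Sigma) i j with hD
  have hDm : Measurable D := by
    have : Continuous D := by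
      simp only [hD, mul_apply, of_apply]
      fun_prop
    exact this.measurable
  set Y : (Fin n → Fin p → ℝ) × (Fin p ⊕ Fin n → ℝ) → Fin n → ℝ := fun x =>
    Matrix.of (D x.1) *ᵥ ((τ / √p) • fun j => x.2 (Sum.inl j)) +
      σ • fun i => x.2 (Sum.inr i) with hY
  have hDY : Continuous fun x => (D x.1, Y x) := continuous_response Sigma (τ / √p) σ
  -- With the indicator of the event inside the integrand, freezing the design needs the variance
  -- bound only for designs with `Σ̂ ≤ s`.
  set F : (Fin n → Fin p → ℝ) → (Fin p ⊕ Fin n → ℝ) → ℝ≥0∞ := fun z x =>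
    (D ⁻¹' E).indicator (fun _ => 1) z * ENNReal.ofReal
      (normErr σ τ (Matrix.of (D z)) (Y (z, x)) ^ 2 +
        gradErr σ τ (Matrix.of (D z)) (Y (z, x)) ^ 2) with hF
  have hnm : Measurable fun x => normErr σ τ (Matrix.of (D x.1)) (Y x) :=
    ((continuous_normErr σ τ).comp hDY).measurable
  have hgm : Measurable fun x => gradErr σ τ (Matrix.of (D x.1)) (Y x) :=
    ((continuous_gradErr σ τ).comp hDY).measurable
  have hFm : Measurable (Function.uncurry F) := by
    have h1 : Measurable fun x : (Fin n → Fin p → ℝ) × (Fin p ⊕ Fin n → ℝ) =>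
        (D ⁻¹' E).indicator (fun _ => (1 : ℝ≥0∞)) x.1 :=
      (measurable_const.indicator (hDm hE)).comp measurable_fst
    exact h1.mul ((hnm.pow_const 2).add (hgm.pow_const 2)).ennreal_ofReal
  have key := lintegral_le_of_indepFun h.measurable_design hξm h.indep hFm
    (G := fun _ => ENNReal.ofReal (2 * (M + 2) * s ^ 4 * r)) measurable_const (fun z => by
      by_cases hz : D z ∈ E
      · have hz' : z ∈ D ⁻¹' E := hz
        simp only [hF, Set.indicator_of_mem hz', one_mul]
        have hc := hcov _ hz
        have hm1 := mHat1_le h.p_pos hc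
        have hpsd := sampleCov_posSemidef (Matrix.of (D z))
        have ht2 := trace_pow_le hpsd hc 2
        have ht3 := trace_pow_le hpsd hc 3
        have ht4 := trace_pow_le hpsd hc 4
        have hm2 : mHat2 (Matrix.of (D z)) ≤ s ^ 2 := by
          rw [mHat2, div_le_iff₀ hp', ← sq]
          simpa [mul_comm] using ht2
        simp only [Fintype.card_fin] at ht2 ht3 ht4
        have b1 := lintegral_normErr_sq_le h.n_pos h.p_pos h.effects σ τ (Matrix.of (D z))
        have b2 := lintegral_gradErr_sq_le h.n_pos h.p_pos h.effects σ τ (Matrix.of (D z))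
        have hs24 : s ^ 2 ≤ s ^ 4 := pow_le_pow_right₀ hs (by norm_num)
        have hs14 : s ≤ s ^ 4 := le_self_pow₀ hs (by norm_num)
        have hs34 : s ^ 3 ≤ s ^ 4 := pow_le_pow_right₀ hs (by norm_num)
        have hs04 : 1 ≤ s ^ 4 := one_le_pow₀ hs
        have hasp : 0 ≤ aspect n p := by unfold aspect; positivity
        have c1 : τ ^ 4 * mHat2 (Matrix.of (D z)) / p +
            2 * τ ^ 2 * σ ^ 2 * mHat1 (Matrix.of (D z)) / n + σ ^ 4 / n ≤ s ^ 4 * r := by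
          have e : s ^ 4 * r = τ ^ 4 * s ^ 4 / p + 2 * τ ^ 2 * σ ^ 2 * s ^ 4 / n +
              σ ^ 4 * ((1 + aspect n p) * s ^ 4) / n := by rw [hr]; ring
          rw [e]
          have f1 := hm2.trans hs24
          have f2 := hm1.trans hs14
          have f3 : σ ^ 4 ≤ σ ^ 4 * ((1 + aspect n p) * s ^ 4) := by
            refine le_mul_of_one_le_right (by positivity) ?_
            nlinarith
          gcongr
        have c2 : τ ^ 4 / p ^ 2 * (sampleCov (Matrix.of (D z)) ^ 4).trace +
            2 * τ ^ 2 * σ ^ 2 / (p * n) * (sampleCov (Matrix.of (D z)) ^ 3).trace +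
            σ ^ 4 / n ^ 2 * (sampleCov (Matrix.of (D z)) ^ 2).trace ≤ s ^ 4 * r := by
          have g3 : (sampleCov (Matrix.of (D z)) ^ 3).trace ≤ p * s ^ 4 := ht3.trans (by gcongr)
          have g2 : (sampleCov (Matrix.of (D z)) ^ 2).trace ≤ p * s ^ 4 := ht2.trans (by gcongr)
          calc _ ≤ τ ^ 4 / p ^ 2 * (p * s ^ 4) + 2 * τ ^ 2 * σ ^ 2 / (p * n) * (p * s ^ 4) +
                σ ^ 4 / n ^ 2 * (p * s ^ 4) := by gcongr
            _ = s ^ 4 * (τ ^ 4 / p + 2 * τ ^ 2 * σ ^ 2 / n + σ ^ 4 * aspect n p / n) := by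
                rw [aspect]
                field_simp
            _ ≤ s ^ 4 * r := by
                rw [hr]
                gcongr
                linarith
        calc _ = ∫⁻ ω, (ENNReal.ofReal (normErr σ τ (Matrix.of (D z)) (Y (z, ξ ω)) ^ 2) +
              ENNReal.ofReal (gradErr σ τ (Matrix.of (D z)) (Y (z, ξ ω)) ^ 2)) ∂P :=
              lintegral_congr fun ω => ENNReal.ofReal_add (sq_nonneg _) (sq_nonneg _)
          _ = ∫⁻ ω, ENNReal.ofReal (normErr σ τ (Matrix.of (D z)) (Y (z, ξ ω)) ^ 2) ∂P +
              ∫⁻ ω, ENNReal.ofReal (gradErr σ τ (Matrix.of (D z)) (Y (z, ξ ω)) ^ 2) ∂P := by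
              refine lintegral_add_left ?_ _
              exact ((hnm.comp (measurable_const.prodMk hξm)).pow_const 2).ennreal_ofReal
          _ ≤ ENNReal.ofReal ((M + 2) * (s ^ 4 * r)) + ENNReal.ofReal ((M + 2) * (s ^ 4 * r)) := by
              refine add_le_add (b1.trans (ENNReal.ofReal_le_ofReal ?_))
                (b2.trans (ENNReal.ofReal_le_ofReal ?_))
              · gcongr
              · gcongr
          _ = _ := by
              have hr0 : 0 ≤ r := by positivity
              rw [← ENNReal.ofReal_add (by positivity) (by positivity)]
              congr 1
              ring
      · have hz' : z ∉ D ⁻¹' E := hz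
        simp [hF, Set.indicator_of_notMem hz'])
  rw [lintegral_const, measure_univ, mul_one] at key
  have hSm : MeasurableSet {ω | (fun i j => RGD.design Sigma Z ω i j) ∈ E} :=
    h.measurable_design_fun hE
  rw [← lintegral_indicator hSm]
  refine (lintegral_congr fun ω => ?_).trans_le key
  have hresp : response Sigma Z β u ω = Y (Z ω, ξ ω) := by
    rw [response, h.beta_eq ω, h.noise_eq ω]
    rfl
  by_cases hω : D (Z ω) ∈ E
  · have h1 : Z ω ∈ D ⁻¹' E := hω
    have h2 : ω ∈ {ω | (fun i j => RGD.design Sigma Z ω i j) ∈ E} := hω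
    rw [Set.indicator_of_mem h2]
    simp only [hresp, hF, Set.indicator_of_mem h1, one_mul]
    rfl
  · have h1 : Z ω ∉ D ⁻¹' E := hω
    have h2 : ω ∉ {ω | (fun i j => RGD.design Sigma Z ω i j) ∈ E} := hω
    rw [Set.indicator_of_notMem h2]
    simp only [hF, Set.indicator_of_notMem h1, zero_mul]

end FixedModel

end FixedSize

/-! ### Risk bounds at a fixed sample size -/

section FixedRisk

variable {Ω : Type*} [MeasurableSpace Ω] {P : Measure Ω} {n p : ℕ}

theorem of_entries (X : Matrix (Fin n) (Fin p) ℝ) : Matrix.of (fun i j => X i j) = X := by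
  ext i j
  rfl

/-- The set of designs whose sample covariance is bounded by `s`. -/
def covSet (n p : ℕ) (s : ℝ) : Set (Fin n → Fin p → ℝ) :=
  {x | ∀ v, v ⬝ᵥ (sampleCov (Matrix.of x) *ᵥ v) ≤ s * (v ⬝ᵥ v)}

theorem continuous_sampleCov : Continuous fun x : Fin n → Fin p → ℝ => sampleCov (Matrix.of x) := by
  refine continuous_pi fun i => continuous_pi fun j => ?_
  simp only [sampleCov, Matrix.smul_apply, mul_apply, transpose_apply, of_apply]
  fun_prop

/-- The pairs (design, threshold) form an intersection of closed sets, one for each `v`. The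
threshold may depend on the design, as is needed for `s₁`. -/
theorem measurableSet_mem_covSet {f : (Fin n → Fin p → ℝ) → ℝ} (hf : Measurable f) :
    MeasurableSet {x | x ∈ covSet n p (f x)} := by
  have hclosed : IsClosed {y : (Fin n → Fin p → ℝ) × ℝ | y.1 ∈ covSet n p y.2} := by
    have hset : {y : (Fin n → Fin p → ℝ) × ℝ | y.1 ∈ covSet n p y.2} =
        ⋂ v, {y | v ⬝ᵥ (sampleCov (Matrix.of y.1) *ᵥ v) ≤ y.2 * (v ⬝ᵥ v)} := by
      ext y
      simp [covSet]
    rw [hset]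
    refine isClosed_iInter fun v => isClosed_le ?_ (by fun_prop)
    exact continuous_const.dotProduct
      ((continuous_sampleCov.comp continuous_fst).matrix_mulVec continuous_const)
  exact (measurable_id.prodMk hf) hclosed.measurableSet

theorem measurableSet_covSet (s : ℝ) : MeasurableSet (covSet n p s) :=
  measurableSet_mem_covSet measurable_const

theorem measurableSet_mTilde2_ge (c : ℝ) :
    MeasurableSet {x : Fin n → Fin p → ℝ | c ≤ mTilde2 (Matrix.of x)} := by
  refine (isClosed_le continuous_const ?_).measurableSet
  have h := continuous_sampleCov (n := n) (p := p)
  unfold mTilde2 mHat2 mHat1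
  exact (((h.matrix_mul h).matrix_trace).div_const _).sub
    (continuous_const.mul ((h.matrix_trace.div_const _).pow 2))

/-- These sets exhaust the space; the shift by one keeps the bound at least `1`. -/
theorem exists_mem_covSet (x : Fin n → Fin p → ℝ) : ∃ k : ℕ, x ∈ covSet n p (k + 1) := by
  obtain ⟨k, hk⟩ := exists_nat_ge ‖Matrix.toEuclideanCLM (𝕜 := ℝ) (sampleCov (Matrix.of x))‖
  exact ⟨k, fun v => dotProduct_mulVec_le_of_norm_le (hk.trans (by linarith)) v⟩

variable {Sigma : Matrix (Fin p) (Fin p) ℝ} {Z : Ω → Fin n → Fin p → ℝ} {β : Ω → Fin p → ℝ}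
  {u : Ω → Fin n → ℝ} {σ τ M C : ℝ} {s₁ : (Fin n → Fin p → ℝ) → ℝ} {θ : Fin p → ℝ}

theorem le_lamHat {lam1 lam2 : ℝ} (h : lam1 ≤ lam2) (X : Matrix (Fin n) (Fin p) ℝ)
    (y : Fin n → ℝ) : lam1 ≤ lamHat lam1 lam2 X y :=
  le_min (le_max_right _ _) h

theorem lamStar_pos (hσ : 0 < σ) (hτ : 0 < τ) (hn : 0 < n) (hp : 0 < p) : 0 < lamStar σ τ n p := by
  unfold lamStar aspect
  positivity

/-- The loss after `t` steps of gradient descent, at a realization of the model. -/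
noncomputable def rgdLoss (Sigma : Matrix (Fin p) (Fin p) ℝ) (Z : Ω → Fin n → Fin p → ℝ)
    (β : Ω → Fin p → ℝ) (u : Ω → Fin n → ℝ) (s₁ : (Fin n → Fin p → ℝ) → ℝ) (θ : Fin p → ℝ)
    (lam : Ω → ℝ) (t : ℕ) (ω : Ω) : ℝ :=
  let b := rgd (design Sigma Z ω) (response Sigma Z β u ω) (lam ω)
    (s₁ (fun i j => design Sigma Z ω i j) + lam ω)⁻¹ θ t
  (b - β ω) ⬝ᵥ (Sigma *ᵥ (b - β ω))

/-- The constant of `abs_lamHat_sub_lamStar_le`. -/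
noncomputable def penConst (σ τ lam1 lam2 g c : ℝ) : ℝ :=
  (2 * g * (τ ^ 2 + σ ^ 2) / τ ^ 4 + 2 * (lam2 - lam1) / τ ^ 2) * (2 * g / c)

namespace FixedModel

theorem measurable_statistics (h : FixedModel P Sigma Z β u σ τ M C) :
    Measurable fun ω => ((fun i j => RGD.design Sigma Z ω i j : Fin n → Fin p → ℝ),
      response Sigma Z β u ω) := by
  have h1 := (continuous_response (n := n) Sigma (τ / √p) σ).measurable.comp
    (h.measurable_design.prodMk (measurable_pi_lambda _ h.effects.measurable))
  convert h1 using 2 with ω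
  rw [response, h.beta_eq ω, h.noise_eq ω]
  rfl

theorem measurable_normErr (h : FixedModel P Sigma Z β u σ τ M C) :
    Measurable fun ω => normErr σ τ (RGD.design Sigma Z ω) (response Sigma Z β u ω) := by
  have h1 := (continuous_normErr (n := n) (p := p) σ τ).measurable.comp h.measurable_statistics
  simpa only [Function.comp_def, of_entries] using h1

theorem measurable_gradErr (h : FixedModel P Sigma Z β u σ τ M C) :
    Measurable fun ω => gradErr σ τ (RGD.design Sigma Z ω) (response Sigma Z β u ω) := by
  have h1 := (continuous_gradErr (n := n) (p := p) σ τ).measurable.comp h.measurable_statistics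
  simpa only [Function.comp_def, of_entries] using h1

variable [IsProbabilityMeasure P]

/-- On the `X`-measurable event `Σ̂ ≤ k + 1` the loss is at most a constant times `(1 + ρ)⁴`, which
is integrable. Exhausting by these events gives finiteness without any integrability of the loss
over the whole space. -/
theorem rgdRisk_ne_top (h : FixedModel P Sigma Z β u σ τ M C) (hs₁ : ∀ x, 0 ≤ s₁ x) {l₀ : ℝ}
    (hl₀ : 0 < l₀) {lam : Ω → ℝ} (hlam : ∀ ω, l₀ ≤ lam ω) (θ : Fin p → ℝ) (t : ℕ) :
    ∀ᵐ ω ∂P, rgdRisk P Sigma Z β u s₁ θ lam t ω ≠ ∞ := by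
  refine condLExp_ne_top_of_cover (f := fun ω => ENNReal.ofReal (rgdLoss Sigma Z β u s₁ θ lam t ω))
    (S := fun k => {ω | (fun i j => RGD.design Sigma Z ω i j) ∈ covSet n p (k + 1)}) h.sigmaAlg_le
    (fun k => ⟨_, measurableSet_covSet (k + 1), rfl⟩) (fun ω => exists_mem_covSet _) fun k => ?_
  have hk : (1 : ℝ) ≤ k + 1 := by linarith [(Nat.cast_nonneg k : (0 : ℝ) ≤ k)]
  set B : ℝ := (t + 1) * (1 + (k + 1) / l₀) ^ t
  set A : ℝ := C * iterConst B (euNorm θ) (k + 1) l₀ ^ 2 with hA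
  have hA0 : 0 ≤ A := mul_nonneg h.bound_nonneg (sq_nonneg _)
  refine ne_of_lt (lt_of_le_of_lt (b := ∫⁻ ω, ENNReal.ofReal A *
    ENNReal.ofReal ((1 + effectSize (β ω) (u ω)) ^ 4) ∂P) ?_ ?_)
  · refine le_trans ?_ (setLIntegral_le_lintegral
      {ω | (fun i j => RGD.design Sigma Z ω i j) ∈ covSet n p (k + 1)} _)
    refine setLIntegral_mono' (h.measurable_design_fun (measurableSet_covSet _)) fun ω hω => ?_
    rw [← ENNReal.ofReal_mul hA0]
    refine ENNReal.ofReal_le_ofReal ?_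
    refine (loss_le h.bound_nonneg h.quad_le (stepBound_of_cov_le (hs₁ _) hl₀ hk hω t) h.n_pos.ne'
      hk hω le_rfl (hlam ω) le_rfl (β ω) (u ω)).trans ?_
    refine mul_le_mul_of_nonneg_left ?_ hA0
    exact pow_le_pow_right₀ (by linarith [effectSize_nonneg (β ω) (u ω)]) (by norm_num)
  · rw [lintegral_const_mul _ ((h.measurable_effectSize.const_add 1).pow_const 4).ennreal_ofReal]
    exact ENNReal.mul_lt_top ENNReal.ofReal_lt_top
      (h.lintegral_effectSize_le.trans_lt ENNReal.ofReal_lt_top)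

theorem pluginRisk_ne_top (h : FixedModel P Sigma Z β u σ τ M C) (hs₁ : ∀ x, 0 ≤ s₁ x)
    {lam1 lam2 : ℝ} (hlam1 : 0 < lam1) (hlam : lam1 ≤ lam2) (θ : Fin p → ℝ) (t : ℕ) :
    ∀ᵐ ω ∂P, pluginRisk P Sigma Z β u s₁ θ lam1 lam2 t ω ≠ ∞ :=
  h.rgdRisk_ne_top hs₁ hlam1 (fun _ => le_lamHat hlam _ _) θ t

theorem oracleRisk_ne_top (h : FixedModel P Sigma Z β u σ τ M C) (hs₁ : ∀ x, 0 ≤ s₁ x)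
    (θ : Fin p → ℝ) (t : ℕ) : ∀ᵐ ω ∂P, oracleRisk P Sigma Z β u s₁ θ σ τ t ω ≠ ∞ :=
  h.rgdRisk_ne_top hs₁ (lamStar_pos h.sigma_pos h.tau_pos h.n_pos h.p_pos) (fun _ => le_rfl) θ t

/-- On an event determined by the design, the risks with plug-in and with oracle penalty are
close, uniformly over a set of stopping times. -/
theorem measure_iSup_risk_gap_le (h : FixedModel P Sigma Z β u σ τ M C) (hs₁ : ∀ x, 0 ≤ s₁ x)
    {lam1 lam2 : ℝ} (hlam1 : 0 < lam1) (hlam : lamStar σ τ n p ∈ Set.Icc lam1 lam2) {Θ : ℝ}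
    (hθ : euNorm θ ≤ Θ) {ι : Type*} [Countable ι] (time : ι → ℕ) {E : Set (Fin n → Fin p → ℝ)}
    (hE : MeasurableSet E) {c g s q B : ℝ} (hc : 0 < c) (hc1 : c ≤ 1) (hg : 1 ≤ g) (hs : 1 ≤ s)
    (hasp : aspect n p ≤ g) (hcov : ∀ x ∈ E, x ∈ covSet n p s)
    (hm : ∀ x ∈ E, c ≤ mTilde2 (Matrix.of x))
    (hstep : ∀ x ∈ E, ∀ i, StepBound (Matrix.of x) (s₁ x) lam1 q B (time i)) {δ : ℝ} (hδ : 0 < δ)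
    {A : ℝ} (hA : 2 * C * gapConst q B Θ s lam1 * iterConst B Θ s lam1 *
      (penConst σ τ lam1 lam2 g c * s ^ 2) ≤ A) (hA0 : 0 ≤ A) :
    P {ω | ENNReal.ofReal δ ≤ ⨆ i, ENNReal.ofReal
      |(pluginRisk P Sigma Z β u s₁ θ lam1 lam2 (time i) ω).toReal -
        (oracleRisk P Sigma Z β u s₁ θ σ τ (time i) ω).toReal|} ≤
      P {ω | (fun i j => RGD.design Sigma Z ω i j) ∉ E} +
        ENNReal.ofReal (A * (√n * (2 * (M + 2) * s ^ 4 *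
          (τ ^ 4 / p + 2 * τ ^ 2 * σ ^ 2 / n + σ ^ 4 * (1 + aspect n p) / n)) +
            (√n)⁻¹ * (27 * (1 + (τ ^ 4 + σ ^ 4) * M))) / δ) := by
  have hn' : (0 : ℝ) < n := by exact_mod_cast h.n_pos
  have hsq : 0 < √(n : ℝ) := Real.sqrt_pos.2 hn'
  have hM := h.moment_nonneg
  obtain ⟨a, ha⟩ : ∃ a : Ω → ℝ, ∀ ω, a ω =
    normErr σ τ (RGD.design Sigma Z ω) (response Sigma Z β u ω) := ⟨_, fun _ => rfl⟩
  obtain ⟨b, hb⟩ : ∃ b : Ω → ℝ, ∀ ω, b ω =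
    gradErr σ τ (RGD.design Sigma Z ω) (response Sigma Z β u ω) := ⟨_, fun _ => rfl⟩
  obtain ⟨ρ, hρ⟩ : ∃ ρ : Ω → ℝ, ∀ ω, ρ ω = effectSize (β ω) (u ω) := ⟨_, fun _ => rfl⟩
  have ham : Measurable a := by
    rw [funext ha]
    exact h.measurable_normErr
  have hbm : Measurable b := by
    rw [funext hb]
    exact h.measurable_gradErr
  have hρm : Measurable ρ := by
    rw [funext hρ]
    exact h.measurable_effectSize
  have hI1 := h.setLIntegral_errors_le hE hs hcov
  have hI2 := h.lintegral_effectSize_le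
  simp only [← ha, ← hb] at hI1
  simp only [← hρ] at hI2
  have hr0 : 0 ≤ 2 * (M + 2) * s ^ 4 *
      (τ ^ 4 / p + 2 * τ ^ 2 * σ ^ 2 / n + σ ^ 4 * (1 + aspect n p) / n) := by
    have : 0 ≤ aspect n p := by unfold aspect; positivity
    positivity
  obtain ⟨r, hr⟩ : ∃ r : ℝ, r = 2 * (M + 2) * s ^ 4 *
    (τ ^ 4 / p + 2 * τ ^ 2 * σ ^ 2 / n + σ ^ 4 * (1 + aspect n p) / n) := ⟨_, rfl⟩
  rw [← hr] at hI1 hr0 ⊢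
  obtain ⟨S, hS⟩ : ∃ S : Set Ω, S = {ω | (fun i j => RGD.design Sigma Z ω i j) ∈ E} := ⟨_, rfl⟩
  have hSc : {ω | (fun i j => RGD.design Sigma Z ω i j) ∉ E} = Sᶜ := by rw [hS]; rfl
  have hSm : MeasurableSet[sigmaAlg (RGD.design Sigma Z)] S := ⟨E, hE, hS.symm⟩
  have hSE : ∀ ω ∈ S, (fun i j => RGD.design Sigma Z ω i j) ∈ E := fun ω hω => by rwa [hS] at hω
  rw [← hS] at hI1
  rw [hSc]
  obtain ⟨W, hW⟩ : ∃ W : Ω → ℝ, ∀ ω, W ω =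
    A * (√n * (a ω ^ 2 + b ω ^ 2) + (√n)⁻¹ * (1 + ρ ω) ^ 4) := ⟨_, fun _ => rfl⟩
  have hWm : Measurable W := by
    rw [funext hW]
    fun_prop
  refine (measure_iSup_condLExp_gap_le (P := P) h.sigmaAlg_le
    (f₁ := fun i => rgdLoss Sigma Z β u s₁ θ
      (fun ω => lamHat lam1 lam2 (RGD.design Sigma Z ω) (response Sigma Z β u ω)) (time i))
    (f₂ := fun i => rgdLoss Sigma Z β u s₁ θ (fun _ => lamStar σ τ n p) (time i))
    hWm hSm (fun i ω hω => ?_) (fun i => ?_) hδ).trans ?_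
  · replace hω := hSE ω hω
    have hω' := hcov _ hω
    refine (abs_loss_sub_le h.posSemidef h.bound_nonneg h.quad_le (hstep _ hω i) h.n_pos.ne' hs hω'
      hθ (le_lamHat (hlam.1.trans hlam.2) _ _) hlam.1 le_rfl (β ω) (u ω)).trans ?_
    rw [← hρ]
    have hB := (hstep _ hω i).one_le
    have hq := (hstep _ hω i).rate_nonneg
    have hΘ : 0 ≤ Θ := (norm_nonneg _).trans hθ
    have hC := h.bound_nonneg
    have hG : 0 ≤ 2 * C * gapConst q B Θ s lam1 * iterConst B Θ s lam1 := by
      unfold gapConst iterConst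
      positivity
    have hl : |lamHat lam1 lam2 (RGD.design Sigma Z ω) (response Sigma Z β u ω) -
        lamStar σ τ n p| ≤ penConst σ τ lam1 lam2 g c * s ^ 2 * (|a ω| + |b ω|) := by
      rw [ha, hb]
      exact abs_lamHat_sub_lamStar_le h.tau_pos hlam hc hc1 hg hs (hm _ hω)
        (mHat1_le h.p_pos hω') hasp
    have hQ : 0 ≤ (1 + ρ ω) ^ 2 := sq_nonneg _
    -- The weight `√n` balances the two terms: the squared deviations average to order `1 / n` and
    -- the fourth power to order one, so both products are of order `n^(-1/2)`.
    have hamgm : (|a ω| + |b ω|) * (1 + ρ ω) ^ 2 ≤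
        √n * (a ω ^ 2 + b ω ^ 2) + (√n)⁻¹ * (1 + ρ ω) ^ 4 := by
      rw [← sq_abs (a ω), ← sq_abs (b ω), show (1 + ρ ω) ^ 4 = ((1 + ρ ω) ^ 2) ^ 2 by ring]
      generalize |a ω| = x
      generalize |b ω| = y
      generalize (1 + ρ ω) ^ 2 = Q
      have h1 : √(n : ℝ) * (x ^ 2 + y ^ 2) + (√n)⁻¹ * Q ^ 2 - (x + y) * Q =
          √n * ((x - (√n)⁻¹ * Q / 2) ^ 2 + (y - (√n)⁻¹ * Q / 2) ^ 2) + (√n)⁻¹ * Q ^ 2 / 2 := by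
        field_simp
        ring
      have h2 : 0 ≤ √(n : ℝ) * ((x - (√n)⁻¹ * Q / 2) ^ 2 + (y - (√n)⁻¹ * Q / 2) ^ 2) +
        (√n)⁻¹ * Q ^ 2 / 2 := by positivity
      linarith
    calc _ ≤ 2 * C * gapConst q B Θ s lam1 * iterConst B Θ s lam1 *
          (penConst σ τ lam1 lam2 g c * s ^ 2 * (|a ω| + |b ω|)) * (1 + ρ ω) ^ 2 :=
          mul_le_mul_of_nonneg_right (mul_le_mul_of_nonneg_left hl hG) hQ
      _ = 2 * C * gapConst q B Θ s lam1 * iterConst B Θ s lam1 *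
          (penConst σ τ lam1 lam2 g c * s ^ 2) * ((|a ω| + |b ω|) * (1 + ρ ω) ^ 2) := by ring
      _ ≤ A * ((|a ω| + |b ω|) * (1 + ρ ω) ^ 2) := mul_le_mul_of_nonneg_right hA (by positivity)
      _ ≤ W ω := by
          rw [hW]
          exact mul_le_mul_of_nonneg_left hamgm hA0
  · filter_upwards [h.pluginRisk_ne_top hs₁ hlam1 (hlam.1.trans hlam.2) θ (time i),
      h.oracleRisk_ne_top hs₁ θ (time i)] with ω h1 h2 using ⟨h1, h2⟩
  · refine add_le_add le_rfl ?_
    rw [ENNReal.ofReal_div_of_pos hδ]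
    refine ENNReal.div_le_div_right ?_ _
    have hm1 : Measurable fun ω => ENNReal.ofReal (a ω ^ 2 + b ω ^ 2) :=
      ((ham.pow_const 2).add (hbm.pow_const 2)).ennreal_ofReal
    have hm2 : Measurable fun ω => ENNReal.ofReal ((1 + ρ ω) ^ 4) :=
      ((hρm.const_add 1).pow_const 4).ennreal_ofReal
    calc ∫⁻ ω in S, ENNReal.ofReal (W ω) ∂P
        = ∫⁻ ω in S, ENNReal.ofReal A * (ENNReal.ofReal √n * ENNReal.ofReal (a ω ^ 2 + b ω ^ 2) +
            ENNReal.ofReal (√n)⁻¹ * ENNReal.ofReal ((1 + ρ ω) ^ 4)) ∂P := by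
          refine lintegral_congr fun ω => ?_
          rw [hW, ENNReal.ofReal_mul hA0, ENNReal.ofReal_add (by positivity) (by positivity),
            ENNReal.ofReal_mul hsq.le, ENNReal.ofReal_mul (by positivity)]
      _ = ENNReal.ofReal A * (ENNReal.ofReal √n * ∫⁻ ω in S, ENNReal.ofReal (a ω ^ 2 + b ω ^ 2) ∂P +
            ENNReal.ofReal (√n)⁻¹ * ∫⁻ ω in S, ENNReal.ofReal ((1 + ρ ω) ^ 4) ∂P) := by
          rw [lintegral_const_mul' _ _ ENNReal.ofReal_ne_top,
            lintegral_add_left (hm1.const_mul _), lintegral_const_mul _ hm1,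
            lintegral_const_mul _ hm2]
      _ ≤ ENNReal.ofReal A * (ENNReal.ofReal √n * ENNReal.ofReal r +
            ENNReal.ofReal (√n)⁻¹ * ENNReal.ofReal (27 * (1 + (τ ^ 4 + σ ^ 4) * M))) := by
          gcongr
          exact (setLIntegral_le_lintegral _ _).trans hI2
      _ = _ := by
          rw [← ENNReal.ofReal_mul hsq.le, ← ENNReal.ofReal_mul (by positivity),
            ← ENNReal.ofReal_add (by positivity) (by positivity), ← ENNReal.ofReal_mul hA0]

end FixedModel

end FixedRisk

/-! ### The sequence of models -/

section Construction

variable {Ω : Type*} [MeasurableSpace Ω] {P : Measure Ω}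

/-- Two independent families of independent real variables form an independent family. -/
theorem iIndepFun_sumElim {ι κ : Type*} [Fintype ι] [Fintype κ] {f : ι → Ω → ℝ} {g : κ → Ω → ℝ}
    (hf : iIndepFun f P) (hg : iIndepFun g P)
    (hfg : IndepFun (fun ω i => f i ω) (fun ω k => g k ω) P) : iIndepFun (Sum.elim f g) P := by
  rw [iIndepFun_iff_measure_inter_preimage_eq_mul]
  intro S sets hS
  rw [Finset.prod_sum_eq_prod_toLeft_mul_prod_toRight]
  simp only [Sum.elim_inl, Sum.elim_inr]
  have hl : ∀ i ∈ S.toLeft, MeasurableSet (sets (Sum.inl i)) := fun i hi =>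
    hS _ (Finset.mem_toLeft.1 hi)
  have hr : ∀ i ∈ S.toRight, MeasurableSet (sets (Sum.inr i)) := fun i hi =>
    hS _ (Finset.mem_toRight.1 hi)
  rw [← (iIndepFun_iff_measure_inter_preimage_eq_mul.1 hf) S.toLeft hl,
    ← (iIndepFun_iff_measure_inter_preimage_eq_mul.1 hg) S.toRight hr]
  have h1 := hfg.measure_inter_preimage_eq_mul
    (⋂ i ∈ S.toLeft, (fun x : ι → ℝ => x i) ⁻¹' sets (Sum.inl i))
    (⋂ i ∈ S.toRight, (fun x : κ → ℝ => x i) ⁻¹' sets (Sum.inr i))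
    (Finset.measurableSet_biInter _ fun i hi => measurable_pi_apply i (hl i hi))
    (Finset.measurableSet_biInter _ fun i hi => measurable_pi_apply i (hr i hi))
  simp only [Set.preimage_iInter, Set.preimage_preimage] at h1
  refine Eq.trans (congrArg P ?_) h1
  ext ω
  simp only [Set.mem_iInter, Set.mem_inter_iff, Sum.forall, Finset.mem_toLeft, Finset.mem_toRight,
    Set.mem_preimage, Sum.elim_inl, Sum.elim_inr]

/-- Pointwise `x⁴ ≤ 1 + |x|^(4 + ε)`. -/
theorem integrable_pow_of_abs_rpow {f : Ω → ℝ} [IsProbabilityMeasure P] (hf : Measurable f)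
    {ε M : ℝ} (hε : 0 < ε) (h : Integrable (fun ω => |f ω| ^ (4 + ε)) P)
    (hM : ∫ ω, |f ω| ^ (4 + ε) ∂P ≤ M) :
    Integrable (fun ω => f ω ^ 4) P ∧ ∫ ω, f ω ^ 4 ∂P ≤ 1 + M := by
  have hle : ∀ x : ℝ, x ^ 4 ≤ 1 + |x| ^ (4 + ε) := by
    intro x
    rw [show x ^ 4 = |x| ^ 4 by rw [pow_abs, abs_of_nonneg (by positivity)]]
    rcases le_total |x| 1 with hx | hx
    · have := pow_le_one₀ (n := 4) (abs_nonneg x) hx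
      have := Real.rpow_nonneg (abs_nonneg x) (4 + ε)
      linarith
    · have : |x| ^ (4 : ℝ) ≤ |x| ^ (4 + ε) :=
        Real.rpow_le_rpow_of_exponent_le hx (by linarith)
      have h4 : |x| ^ (4 : ℝ) = |x| ^ (4 : ℕ) := by
        rw [← Real.rpow_natCast]
        norm_num
      exact (h4.symm.le.trans this).trans (le_add_of_nonneg_left zero_le_one)
  have h1 : Integrable (fun ω => 1 + |f ω| ^ (4 + ε)) P := (integrable_const _).add h
  have h2 : Integrable (fun ω => f ω ^ 4) P := by
    refine h1.mono' (hf.pow_const 4).aestronglyMeasurable (ae_of_all _ fun ω => ?_)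
    rw [Real.norm_eq_abs, abs_of_nonneg (by positivity)]
    exact hle _
  refine ⟨h2, (integral_mono h2 h1 fun ω => hle _).trans ?_⟩
  rw [integral_add (integrable_const _) h]
  simpa using hM

variable {p : ℕ → ℕ} {γ σ τ : ℝ}
  {Sigma : ∀ n, Matrix (Fin (p n)) (Fin (p n)) ℝ} {Z : ∀ n, Ω → Fin n → Fin (p n) → ℝ}
  {β : ∀ n, Ω → Fin (p n) → ℝ} {u : ∀ n, Ω → Fin n → ℝ}

/-- Joint independence of the triple is regrouped: the σ-algebra of `Z` (index `1`) is independent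
of the one generated by `u` and `β` together (indices `0` and `2`). -/
theorem RandomEffects.indepFun_design (hdesign : DesignEntries P p Z)
    (h : RandomEffects P p Z β u σ τ) {n : ℕ} (hn : 2 ≤ n) :
    IndepFun (Z n) (effectVec σ τ (β n) (u n)) P := by
  set m : Fin 3 → MeasurableSpace Ω := ![MeasurableSpace.comap (u n) inferInstance,
    MeasurableSpace.comap (Z n) inferInstance, MeasurableSpace.comap (β n) inferInstance] with hm
  have hle : ∀ i, m i ≤ ‹MeasurableSpace Ω› := by
    intro i
    fin_cases i
    · exact (h.measurable_noise n hn).comap_le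
    · exact (hdesign.measurable n hn).comap_le
    · exact (h.measurable_beta n hn).comap_le
  have key := indep_iSup_of_disjoint hle (h.jointly_indep n hn) (S := {1}) (T := {0, 2}) (by simp)
  rw [iSup_singleton] at key
  refine indep_of_indep_of_le_right key ?_
  rw [← measurable_iff_comap_le]
  have hu : Measurable[⨆ i ∈ ({0, 2} : Set (Fin 3)), m i] (u n) :=
    Measurable.mono (comap_measurable (u n)) (le_iSup₂_of_le (0 : Fin 3) (by simp) le_rfl) le_rfl
  have hb : Measurable[⨆ i ∈ ({0, 2} : Set (Fin 3)), m i] (β n) :=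
    Measurable.mono (comap_measurable (β n)) (le_iSup₂_of_le (2 : Fin 3) (by simp) le_rfl) le_rfl
  refine @measurable_pi_lambda _ _ _ (⨆ i ∈ ({0, 2} : Set (Fin 3)), m i) _ _ ?_
  rintro (j | i)
  · exact ((measurable_pi_apply j).comp hb).const_mul _
  · exact ((measurable_pi_apply i).comp hu).const_mul _

/-- Scaling by `√p / τ` turns the fourth moments of `β` into `p² E βⱼ⁴ / τ⁴`, which is what the
moment assumption bounds uniformly in `n`. -/
theorem RandomEffects.exists_stdEntries (hgrowth : ProportionalGrowth p γ)
    (h : RandomEffects P p Z β u σ τ) :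
    ∃ M : ℝ, ∀ n ≥ 2, StdEntries P (effectVec σ τ (β n) (u n)) M := by
  obtain ⟨ν₁, h₁⟩ := h.fourth_moment_beta
  obtain ⟨ν₂, h₂⟩ := h.fourth_moment_noise
  have hσ := h.sigma_pos
  have hτ := h.tau_pos
  refine ⟨max (ν₁ / τ ^ 4) (ν₂ / σ ^ 4), fun n hn => ?_⟩
  have hp : (0 : ℝ) < p n := by
    have := hgrowth.two_le n hn
    exact_mod_cast (by omega : 0 < p n)
  have hsp : √(p n : ℝ) ^ 2 = p n := Real.sq_sqrt hp.le
  have hsp4 : √(p n : ℝ) ^ 4 = (p n : ℝ) ^ 2 := by rw [show 4 = 2 * 2 from rfl, pow_mul, hsp]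
  have hb : ∀ j, Measurable fun ω => β n ω j := fun j =>
    (measurable_pi_apply j).comp (h.measurable_beta n hn)
  have hu : ∀ i, Measurable fun ω => u n ω i := fun i =>
    (measurable_pi_apply i).comp (h.measurable_noise n hn)
  refine ⟨?_, ?_, ?_, ?_, ?_, ?_⟩
  · rintro (j | i)
    · exact (hb j).const_mul _
    · exact (hu i).const_mul _
  · have hind : IndepFun (β n) (u n) P :=
      (h.jointly_indep n hn).indep (show (2 : Fin 3) ≠ 0 by decide)
    have h3 : iIndepFun (Sum.elim (fun j ω => √(p n) / τ * β n ω j) (fun i ω => σ⁻¹ * u n ω i))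
        P := by
      refine iIndepFun_sumElim ((h.indep_beta n hn).comp (fun _ x => √(p n) / τ * x) fun _ => ?_)
        ((h.indep_noise n hn).comp (fun _ x => σ⁻¹ * x) fun _ => ?_)
        (hind.comp (φ := fun x j => √(p n) / τ * x j) (ψ := fun x i => σ⁻¹ * x i) ?_ ?_) <;>
      fun_prop
    convert h3 using 2 with i
    rcases i with j | i <;> rfl
  · rintro (j | i)
    · simp only [effectVec, Sum.elim_inl, integral_const_mul, h.mean_beta n hn, mul_zero]
    · simp only [effectVec, Sum.elim_inr, integral_const_mul, h.mean_noise n hn, mul_zero]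
  · rintro (j | i)
    · simp only [effectVec, Sum.elim_inl, mul_pow, integral_const_mul,
        h.second_moment_beta n hn, div_pow, hsp]
      field_simp
    · simp only [effectVec, Sum.elim_inr, mul_pow, integral_const_mul,
        h.second_moment_noise n hn]
      field_simp
  · rintro (j | i)
    · simp only [effectVec, Sum.elim_inl, mul_pow]
      exact (h₁ n hn j).1.const_mul _
    · simp only [effectVec, Sum.elim_inr, mul_pow]
      exact (h₂ n hn i).1.const_mul _
  · rintro (j | i)
    · refine le_trans ?_ (le_max_left _ _)
      simp only [effectVec, Sum.elim_inl, mul_pow, integral_const_mul, div_pow, hsp4]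
      rw [div_mul_eq_mul_div]
      gcongr
      exact (h₁ n hn j).2
    · refine le_trans ?_ (le_max_right _ _)
      simp only [effectVec, Sum.elim_inr, mul_pow, integral_const_mul, inv_pow]
      rw [← div_eq_inv_mul]
      gcongr
      exact (h₂ n hn i).2

variable [IsProbabilityMeasure P]

theorem DesignEntries.exists_stdEntries (hdesign : DesignEntries P p Z) :
    ∃ M : ℝ, ∀ n ≥ 2, StdEntries P (fun ω (x : Fin n × Fin (p n)) => Z n ω x.1 x.2) M := by
  obtain ⟨ε, hε, M, hM⟩ := hdesign.moment
  have hmeas : ∀ n ≥ 2, ∀ i j, Measurable fun ω => Z n ω i j := fun n hn i j =>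
    (measurable_pi_apply j).comp ((measurable_pi_apply i).comp (hdesign.measurable n hn))
  have h4 := fun n hn i j => integrable_pow_of_abs_rpow (hmeas n hn i j) hε (hM n hn i j).1
    (hM n hn i j).2
  exact ⟨1 + M, fun n hn => ⟨fun x => hmeas n hn _ _, hdesign.indep n hn,
    fun x => hdesign.mean n hn _ _, fun x => hdesign.second_moment n hn _ _,
    fun x => (h4 n hn _ _).1, fun x => (h4 n hn _ _).2⟩⟩

/-- The constants `M` and `C` are shared by all `n`, which turns the fixed-size bounds into rates.
-/
theorem exists_fixedModel (hgrowth : ProportionalGrowth p γ) (hcov : BoundedCovariance p Sigma)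
    (hdesign : DesignEntries P p Z) (heffects : RandomEffects P p Z β u σ τ) :
    ∃ M C : ℝ, 0 ≤ M ∧ 0 ≤ C ∧
      ∀ n ≥ 2, FixedModel P (Sigma n) (Z n) (β n) (u n) σ τ M C := by
  obtain ⟨M₁, h₁⟩ := hdesign.exists_stdEntries
  obtain ⟨M₂, h₂⟩ := heffects.exists_stdEntries hgrowth
  obtain ⟨C, hC⟩ := hcov.bounded
  have hM0 : 0 ≤ max 0 (max M₁ M₂) := le_max_left _ _
  have hC0 : 0 ≤ C := (norm_nonneg _).trans (hC 2 le_rfl)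
  refine ⟨max 0 (max M₁ M₂), C, hM0, hC0, fun n hn => ?_⟩
  have hp := hgrowth.two_le n hn
  exact {
    n_pos := by omega
    p_pos := by omega
    sigma_pos := heffects.sigma_pos
    tau_pos := heffects.tau_pos
    moment_nonneg := hM0
    bound_nonneg := hC0
    posSemidef := hcov.posSemidef n hn
    quad_le := dotProduct_mulVec_le_of_norm_le (hC n hn)
    measurable_design := hdesign.measurable n hn
    measurable_beta := heffects.measurable_beta n hn
    measurable_noise := heffects.measurable_noise n hn
    design := { h₁ n hn with
      fourth_moment := fun i => ((h₁ n hn).fourth_moment i).trans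
        ((le_max_left _ _).trans (le_max_right _ _)) }
    effects := { h₂ n hn with
      fourth_moment := fun i => ((h₂ n hn).fourth_moment i).trans
        ((le_max_right _ _).trans (le_max_right _ _)) }
    indep := heffects.indepFun_design hdesign hn }

end Construction

/-! ### Events of high probability -/

section Events

variable {Ω : Type*} [MeasurableSpace Ω] {P : Measure Ω} [IsProbabilityMeasure P]

namespace FixedModel

variable {n p : ℕ} {Sigma : Matrix (Fin p) (Fin p) ℝ} {Z : Ω → Fin n → Fin p → ℝ}
  {β : Ω → Fin p → ℝ} {u : Ω → Fin n → ℝ} {σ τ M C : ℝ}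

/-- The sample covariance is bounded by `C x²` with high probability, if `x` is large. -/
theorem measure_notMem_covSet_le (h : FixedModel P Sigma Z β u σ τ M C) {g x : ℝ} (hg : 1 ≤ g)
    (hpg : (p : ℝ) ≤ g * n) (hx : 1 ≤ x) {k : ℕ} (hk : k ≠ 0) :
    P {ω | (fun i j => RGD.design Sigma Z ω i j) ∉ covSet n p (C * x ^ 2)} ≤
      ENNReal.ofReal ((M + 2) / x ^ 2) + ENNReal.ofReal (g * n * (2 * g * k) ^ k / x ^ k) := by
  have hn : (0 : ℝ) < n := by exact_mod_cast h.n_pos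
  have hp : (0 : ℝ) < p := by exact_mod_cast h.p_pos
  have hM := h.moment_nonneg
  have hgn : g * n ≤ g * n * x := le_mul_of_one_le_right (by positivity) hx
  have hgn0 : 0 < g * n * x := by positivity
  have hnL : (n : ℝ) ≤ 2 * (g * n * x) := by nlinarith
  have hpL : (p : ℝ) < 2 * (g * n * x) := by linarith
  -- The truncation level is `L = 2 g n x`, so `L - p ≥ g n x` and long rows cost at most `(M + 2) /
  -- x²`. The ratio `k L / (n x²) = 2 g k / x` makes the trace term decay like `x ^ (-k)`.
  have key := h.design.measure_not_opNorm_le (s := n * x ^ 2) hnL hpL (by positivity) hk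
  refine le_trans ?_
    (key.trans (add_le_add (ENNReal.ofReal_le_ofReal ?_) (ENNReal.ofReal_le_ofReal ?_)))
  · refine measure_mono fun ω hω hω' => hω fun v => ?_
    rw [of_entries, dotProduct_sampleCov_mulVec]
    have h1 := hω' (psdSqrt Sigma *ᵥ v)
    have e : (psdSqrt Sigma *ᵥ v) ⬝ᵥ (psdSqrt Sigma *ᵥ v) = v ⬝ᵥ (Sigma *ᵥ v) := by
      rw [mulVec_dotProduct_eq, psdSqrt_transpose, mulVec_mulVec, psdSqrt_mul_self h.posSemidef]
    rw [mulVec_mulVec, e] at h1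
    have h1' : (RGD.design Sigma Z ω *ᵥ v) ⬝ᵥ (RGD.design Sigma Z ω *ᵥ v) ≤
        n * x ^ 2 * (v ⬝ᵥ (Sigma *ᵥ v)) := h1
    calc (n : ℝ)⁻¹ * ((RGD.design Sigma Z ω *ᵥ v) ⬝ᵥ (RGD.design Sigma Z ω *ᵥ v))
        ≤ (n : ℝ)⁻¹ * (n * x ^ 2 * (C * (v ⬝ᵥ v))) := by
          gcongr
          exact h1'.trans (mul_le_mul_of_nonneg_left (h.quad_le v) (by positivity))
      _ = C * x ^ 2 * (v ⬝ᵥ v) := by field_simp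
  · have hL : g * n * x ≤ 2 * (g * n * x) - p := by linarith
    calc (n : ℝ) * ((M + 2) * p / (2 * (g * n * x) - p) ^ 2)
        ≤ n * ((M + 2) * (g * n) / (g * n * x) ^ 2) := by gcongr
      _ = (M + 2) / x ^ 2 / g := by field_simp
      _ ≤ (M + 2) / x ^ 2 := div_le_self (by positivity) hg
  · calc (p : ℝ) * (k * (2 * (g * n * x))) ^ k / (n * x ^ 2) ^ k
        = p * (2 * g * k) ^ k / x ^ k := by
          rw [mul_div_assoc, ← div_pow, mul_div_assoc (p : ℝ), ← div_pow]
          congr 2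
          field_simp
      _ ≤ _ := by gcongr

/-- The denominator of the plug-in estimators is bounded below with high probability. -/
theorem measure_mTilde2_lt_le (h : FixedModel P Sigma Z β u σ τ M C) (hn : 2 ≤ n) {κ : ℝ}
    (hκ : 0 < κ) (htr : κ * p ≤ (Sigma * Sigma).trace) :
    P {ω | mTilde2 (RGD.design Sigma Z ω) < κ / 36} ≤
      ENNReal.ofReal (12 * (M + 2) / n) + ENNReal.ofReal (96 * (M + 2) * (M + 3) / n) := by
  have hn0 : (0 : ℝ) < n := by exact_mod_cast h.n_pos
  have hp : (0 : ℝ) < p := by exact_mod_cast h.p_pos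
  have hM := h.moment_nonneg
  -- Half of the rows: for `n ≥ 2` both groups have at least `n / 3` elements, whence `1 / 36 = (1 /
  -- 3)² / 4`.
  obtain ⟨A, hA⟩ : ∃ A : Finset (Fin n), A.card = n / 2 := by
    obtain ⟨A, -, hA⟩ := Finset.exists_subset_card_eq
      (s := (Finset.univ : Finset (Fin n))) (n := n / 2) (by simpa using Nat.div_le_self n 2)
    exact ⟨A, hA⟩
  have hAc : Aᶜ.card = n - n / 2 := by rw [Finset.card_compl, Fintype.card_fin, hA]
  have h1 : (n : ℝ) / 3 ≤ A.card := by
    rw [hA, div_le_iff₀ (by norm_num)]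
    exact_mod_cast (by omega : n ≤ n / 2 * 3)
  have h2 : (n : ℝ) / 3 ≤ Aᶜ.card := by
    rw [hAc, div_le_iff₀ (by norm_num)]
    exact_mod_cast (by omega : n ≤ (n - n / 2) * 3)
  have hAn : A.Nonempty := Finset.card_pos.1 (by omega)
  have hBn : Aᶜ.Nonempty := Finset.card_pos.1 (by omega)
  have htr0 : 0 < (Sigma * Sigma).trace := lt_of_lt_of_le (by positivity) htr
  have key := h.design.measure_crossSum_lt hM h.posSemidef htr0 A hAn hBn
  have hXX : ∀ ω, RGD.design Sigma Z ω * (RGD.design Sigma Z ω)ᵀ =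
      Matrix.of (Z ω) * Sigma * (Matrix.of (Z ω))ᵀ := fun ω => by
    rw [RGD.design, transpose_mul, psdSqrt_transpose, Matrix.mul_assoc, ← Matrix.mul_assoc
      (psdSqrt Sigma), psdSqrt_mul_self h.posSemidef, Matrix.mul_assoc]
  refine le_trans ?_
    (key.trans (add_le_add (ENNReal.ofReal_le_ofReal ?_) (ENNReal.ofReal_le_ofReal ?_)))
  · refine measure_mono fun ω hω => ?_
    have h3 := (mTilde2_ge (RGD.design Sigma Z ω) h.n_pos h.p_pos A).trans_lt hω
    rw [div_lt_iff₀ (by positivity), hXX] at h3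
    refine h3.trans_le ?_
    calc κ / 36 * ((n : ℝ) ^ 2 * p) = n / 3 * (n / 3) * (κ * p) / 4 := by ring
      _ ≤ _ := by gcongr
  · calc 4 * (M + 2) / (Aᶜ.card : ℝ) ≤ 4 * (M + 2) / (n / 3) := by gcongr
      _ = _ := by field_simp; ring
  · calc 32 * (M + 2) * (M + 3) / (A.card : ℝ) ≤ 32 * (M + 2) * (M + 3) / (n / 3) := by gcongr
      _ = _ := by field_simp; ring

end FixedModel

variable {p : ℕ → ℕ} {γ σ τ : ℝ} {Sigma : ∀ n, Matrix (Fin (p n)) (Fin (p n)) ℝ} {H : Measure ℝ}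
  {Z : ∀ n, Ω → Fin n → Fin (p n) → ℝ} {β : ∀ n, Ω → Fin (p n) → ℝ} {u : ∀ n, Ω → Fin n → ℝ}
  {M C : ℝ}

theorem ProportionalGrowth.exists_bound (hgrowth : ProportionalGrowth p γ) :
    ∃ g : ℝ, 1 ≤ g ∧ ∀ᶠ n in atTop, aspect n (p n) ≤ g ∧ (p n : ℝ) ≤ g * n ∧
      (n : ℝ) ≤ g * p n := by
  have hγ := hgrowth.pos
  refine ⟨max 1 (max (γ + 1) (2 / γ)), le_max_left _ _, ?_⟩
  filter_upwards [hgrowth.tendsto.eventually_lt_const (show γ < γ + 1 by linarith),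
    hgrowth.tendsto.eventually_const_lt (show γ / 2 < γ by linarith), eventually_ge_atTop 1]
    with n h1 h2 hn
  have hn' : (0 : ℝ) < n := by exact_mod_cast hn
  have hp0 : (0 : ℝ) ≤ p n := Nat.cast_nonneg _
  have h3 : γ + 1 ≤ max 1 (max (γ + 1) (2 / γ)) := (le_max_left _ _).trans (le_max_right _ _)
  have h4 : 2 / γ ≤ max 1 (max (γ + 1) (2 / γ)) := (le_max_right _ _).trans (le_max_right _ _)
  refine ⟨h1.le.trans h3, ?_, ?_⟩
  · rw [aspect, div_lt_iff₀ hn'] at h1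
    exact h1.le.trans (mul_le_mul_of_nonneg_right h3 hn'.le)
  · rw [aspect, lt_div_iff₀ hn'] at h2
    refine le_trans ?_ (mul_le_mul_of_nonneg_right h4 hp0)
    rw [div_mul_eq_mul_div, le_div_iff₀ hγ]
    linarith

/-- The limiting spectral distribution keeps the traces of `Σₙ²` away from zero. -/
theorem SpectralLimit.exists_trace_sq_ge (hgrowth : ProportionalGrowth p γ)
    (hcov : BoundedCovariance p Sigma) (hlimit : SpectralLimit p Sigma H) :
    ∃ κ : ℝ, 0 < κ ∧ ∀ᶠ n in atTop, κ * p n ≤ (Sigma n * Sigma n).trace := by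
  have := hlimit.isProbabilityMeasure
  have h0 : cdf H 0 < 1 := lt_of_le_of_ne (cdf_le_one H 0) hlimit.cdf_zero_ne_one
  have hright : ∀ᶠ x in 𝓝[≥] (0 : ℝ), cdf H x < 1 :=
    ((cdf H).right_continuous 0).eventually_lt_const h0
  obtain ⟨e, he, hsub⟩ := mem_nhdsGE_iff_exists_Ico_subset.1 hright
  -- Weak convergence is usable only at continuity points; a monotone function has countably many
  -- discontinuities, while the interval is uncountable.
  obtain ⟨x, hx, hxc⟩ : ∃ x ∈ Set.Ioo (0 : ℝ) e, ContinuousAt (cdf H) x := by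
    by_contra! hne
    have hc : (Set.Ioo (0 : ℝ) e).Countable :=
      ((monotone_cdf H).countable_not_continuousAt).mono fun x hx => hne x hx
    exact (Cardinal.Real.Ioo_countable_iff.1 hc).not_gt he
  have hx1 : cdf H x < 1 := hsub ⟨hx.1.le, hx.2⟩
  refine ⟨x ^ 2 * ((1 - cdf H x) / 2), mul_pos (pow_pos hx.1 2) (by linarith), ?_⟩
  filter_upwards [(hlimit.tendsto x hxc).eventually_lt_const
    (show cdf H x < (1 + cdf H x) / 2 by linarith), eventually_ge_atTop 2] with n h1 hn
  have hp := hgrowth.two_le n hn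
  have h2 := trace_sq_ge_of_esd (hcov.posSemidef n hn) (by omega) hx.1.le
  rw [sq] at h2
  rw [← sq] at h2 ⊢
  refine le_trans ?_ h2
  rw [mul_comm, ← mul_assoc]
  exact mul_le_mul_of_nonneg_left (by linarith) (by positivity)

theorem tendsto_ofReal_div_pow_natCast {f : ℕ → ℝ} (hf : Tendsto f atTop atTop) (a : ℝ) :
    Tendsto (fun n => ENNReal.ofReal (a / f n)) atTop (𝓝 0) := by
  have := ENNReal.tendsto_ofReal (hf.const_div_atTop a)
  simpa using this

theorem tendsto_measure_mTilde2_lt (hgrowth : ProportionalGrowth p γ)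
    (hcov : BoundedCovariance p Sigma) (hlimit : SpectralLimit p Sigma H)
    (hmodel : ∀ n ≥ 2, FixedModel P (Sigma n) (Z n) (β n) (u n) σ τ M C) :
    ∃ c : ℝ, 0 < c ∧ c ≤ 1 ∧
      Tendsto (fun n => P {ω | mTilde2 (design (Sigma n) (Z n) ω) < c}) atTop (𝓝 0) := by
  obtain ⟨κ, hκ, htr⟩ := hlimit.exists_trace_sq_ge hgrowth hcov
  refine ⟨min (κ / 36) 1, lt_min (by positivity) one_pos, min_le_right _ _, ?_⟩
  have hlim := (tendsto_ofReal_div_pow_natCast tendsto_natCast_atTop_atTop (12 * (M + 2))).add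
    (tendsto_ofReal_div_pow_natCast tendsto_natCast_atTop_atTop (96 * (M + 2) * (M + 3)))
  rw [add_zero] at hlim
  refine tendsto_of_tendsto_of_tendsto_of_le_of_le' tendsto_const_nhds hlim
    (Eventually.of_forall fun n => zero_le) ?_
  filter_upwards [htr, eventually_ge_atTop 2] with n h1 hn
  refine le_trans ?_ ((hmodel n hn).measure_mTilde2_lt_le hn hκ h1)
  refine measure_mono fun ω hω => ?_
  rw [Set.mem_ofPred_eq] at hω ⊢
  exact hω.trans_le (min_le_left _ _)

/-- Any power gain in the threshold beats the dimension factor: a trace moment of order `k ≥ 2 / a`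
leaves `n · n^(-a k) ≤ 1 / n`. -/
theorem tendsto_measure_notMem_covSet (hgrowth : ProportionalGrowth p γ)
    (hmodel : ∀ n ≥ 2, FixedModel P (Sigma n) (Z n) (β n) (u n) σ τ M C) {a : ℝ} (ha : 0 < a) :
    Tendsto (fun n : ℕ => P {ω | (fun i j => design (Sigma n) (Z n) ω i j) ∉
      covSet n (p n) (C * ((n : ℝ) ^ a) ^ 2)}) atTop (𝓝 0) := by
  obtain ⟨g, hg, hbound⟩ := hgrowth.exists_bound
  obtain ⟨k, hk⟩ := exists_nat_ge (2 / a)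
  have hk2 : 2 ≤ k * a := by rwa [div_le_iff₀ ha] at hk
  have hk0 : k ≠ 0 := by
    rintro rfl
    norm_num at hk2
  have hpow : Tendsto (fun n : ℕ => (n : ℝ) ^ a) atTop atTop :=
    (tendsto_rpow_atTop ha).comp tendsto_natCast_atTop_atTop
  have hlim := (tendsto_ofReal_div_pow_natCast ((tendsto_pow_atTop two_ne_zero).comp hpow)
    (M + 2)).add (tendsto_ofReal_div_pow_natCast tendsto_natCast_atTop_atTop (g * (2 * g * k) ^ k))
  rw [add_zero] at hlim
  refine tendsto_of_tendsto_of_tendsto_of_le_of_le' tendsto_const_nhds hlim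
    (Eventually.of_forall fun n => zero_le) ?_
  filter_upwards [hbound, eventually_ge_atTop 2] with n h1 hn
  have hn1 : (1 : ℝ) ≤ n := by exact_mod_cast (by omega : 1 ≤ n)
  refine ((hmodel n hn).measure_notMem_covSet_le hg h1.2.1 (Real.one_le_rpow hn1 ha.le) hk0).trans
    (add_le_add le_rfl (ENNReal.ofReal_le_ofReal ?_))
  have h2 : (n : ℝ) ^ 2 ≤ ((n : ℝ) ^ a) ^ k := by
    rw [← Real.rpow_natCast _ k, ← Real.rpow_mul (by positivity), ← Real.rpow_natCast]
    exact Real.rpow_le_rpow_of_exponent_le hn1 (by push_cast; linarith)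
  calc g * n * (2 * g * k) ^ k / ((n : ℝ) ^ a) ^ k ≤ g * n * (2 * g * k) ^ k / (n : ℝ) ^ 2 := by
        gcongr
    _ = _ := by field_simp

end Events

/-! ### Convergence of the risk gap -/

section Convergence

theorem self_dotProduct_nonneg {ι : Type*} [Fintype ι] (v : ι → ℝ) : 0 ≤ v ⬝ᵥ v :=
  Finset.sum_nonneg fun _ _ => mul_self_nonneg _

/-- The constant in the rate of convergence of the risk gap. -/
noncomputable def gapRate (σ τ M g : ℝ) : ℝ :=
  2 * (M + 2) * (τ ^ 4 * g + 2 * τ ^ 2 * σ ^ 2 + σ ^ 4 * (1 + g)) + 27 * (1 + (τ ^ 4 + σ ^ 4) * M)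

theorem errors_le_gapRate {n p : ℕ} (hn : 0 < n) (hp : 0 < p) {σ τ M g s A : ℝ} (hM : 0 ≤ M)
    (hs : 1 ≤ s) (hA : 0 ≤ A) (hasp : aspect n p ≤ g) (hpg : (n : ℝ) ≤ g * p) :
    A * (√n * (2 * (M + 2) * s ^ 4 *
      (τ ^ 4 / p + 2 * τ ^ 2 * σ ^ 2 / n + σ ^ 4 * (1 + aspect n p) / n)) +
        (√n)⁻¹ * (27 * (1 + (τ ^ 4 + σ ^ 4) * M))) ≤ A * s ^ 4 / √n * gapRate σ τ M g := by
  have hn' : (0 : ℝ) < n := by exact_mod_cast hn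
  have hp' : (0 : ℝ) < p := by exact_mod_cast hp
  have hsq : 0 < √(n : ℝ) := Real.sqrt_pos.2 hn'
  have hs4 : 1 ≤ s ^ 4 := one_le_pow₀ hs
  have h1 : τ ^ 4 / p ≤ τ ^ 4 * g / n := by
    rw [div_le_div_iff₀ hp' hn', mul_assoc]
    gcongr
  have h2 : τ ^ 4 / p + 2 * τ ^ 2 * σ ^ 2 / n + σ ^ 4 * (1 + aspect n p) / n ≤
      (τ ^ 4 * g + 2 * τ ^ 2 * σ ^ 2 + σ ^ 4 * (1 + g)) / n := by
    rw [add_div, add_div]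
    gcongr
  have h3 : √(n : ℝ) / n = (√n)⁻¹ := by
    rw [Real.sqrt_div_self']
    simp
  have hT : 0 ≤ 27 * (1 + (τ ^ 4 + σ ^ 4) * M) := by positivity
  rw [gapRate]
  generalize 27 * (1 + (τ ^ 4 + σ ^ 4) * M) = T at hT ⊢
  calc _ ≤ A * (√n * (2 * (M + 2) * s ^ 4 *
        ((τ ^ 4 * g + 2 * τ ^ 2 * σ ^ 2 + σ ^ 4 * (1 + g)) / n)) +
          (√n)⁻¹ * (s ^ 4 * T)) := by
        gcongr
        exact le_mul_of_one_le_left hT hs4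
    _ = A * (2 * (M + 2) * s ^ 4 *
        ((τ ^ 4 * g + 2 * τ ^ 2 * σ ^ 2 + σ ^ 4 * (1 + g))) * (√(n : ℝ) / n) +
          (√n)⁻¹ * (s ^ 4 * T)) := by ring
    _ = _ := by
        rw [h3]
        ring

/-- The constants of the risk gap after `t` steps grow polynomially with the bound on the sample
covariance. -/
theorem exists_gap_const_le {C Θ l a : ℝ} (hC : 0 ≤ C) (hΘ : 0 ≤ Θ) (hl : 0 < l) (ha : 0 ≤ a)
    (t : ℕ) : ∃ K : ℝ, 0 ≤ K ∧ ∀ s ≥ 1,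
      2 * C * gapConst (1 + s / l) ((t + 1) * (1 + s / l) ^ t) Θ s l *
        iterConst ((t + 1) * (1 + s / l) ^ t) Θ s l * (a * s ^ 2) ≤ K * s ^ (3 * t + 5) := by
  obtain ⟨q, hq⟩ : ∃ q : ℝ, q = 1 + 1 / l := ⟨_, rfl⟩
  obtain ⟨b, hb⟩ : ∃ b : ℝ, b = (t + 1) * q ^ t := ⟨_, rfl⟩
  obtain ⟨e, he⟩ : ∃ e : ℝ, e = Θ + 1 / l := ⟨_, rfl⟩
  have hq0 : 0 ≤ q := by rw [hq]; positivity
  have hb0 : 0 ≤ b := by rw [hb]; positivity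
  have he0 : 0 ≤ e := by rw [he]; positivity
  refine ⟨2 * C * (b * (q * (b * e) / l + 1 / l ^ 2)) * (b * e + 1) * a, by positivity,
    fun s hs => ?_⟩
  have hs0 : 0 ≤ s := zero_le_one.trans hs
  have h1 : 1 + s / l ≤ q * s := by
    have : q * s = s + s / l := by rw [hq]; ring
    linarith
  have h2 : (t + 1) * (1 + s / l) ^ t ≤ b * s ^ t := by
    rw [hb, mul_assoc, ← mul_pow]
    gcongr
  have h3 : Θ + s / l ≤ e * s := by
    have : e * s = Θ * s + s / l := by rw [he]; ring
    nlinarith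
  have h4 : 1 ≤ s ^ (t + 1) := one_le_pow₀ hs
  have h5 : s ≤ s ^ (t + 1) := le_self_pow₀ hs (by omega)
  have h6 : gapConst (1 + s / l) ((t + 1) * (1 + s / l) ^ t) Θ s l ≤
      b * (q * (b * e) / l + 1 / l ^ 2) * s ^ (2 * t + 2) := by
    unfold gapConst
    calc _ ≤ b * s ^ t * (q * s * (b * s ^ t * (e * s)) / l + s * s ^ (t + 1) / l ^ 2) := by
          gcongr
          exact le_mul_of_one_le_right hs0 h4
      _ = _ := by ring
  have h7 : iterConst ((t + 1) * (1 + s / l) ^ t) Θ s l ≤ (b * e + 1) * s ^ (t + 1) := by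
    unfold iterConst
    calc _ ≤ b * s ^ t * (e * s) + s ^ (t + 1) := by gcongr
      _ = _ := by ring
  have h8 : 0 ≤ iterConst ((t + 1) * (1 + s / l) ^ t) Θ s l := by
    unfold iterConst
    positivity
  -- The exponents add up as `(2 t + 2) + (t + 1) + 2 = 3 t + 5`.
  calc _ ≤ 2 * C * (b * (q * (b * e) / l + 1 / l ^ 2) * s ^ (2 * t + 2)) *
        ((b * e + 1) * s ^ (t + 1)) * (a * s ^ 2) := by gcongr
    _ = _ := by ring

theorem penConst_nonneg {σ τ lam1 lam2 g c : ℝ} (hlam : lam1 ≤ lam2) (hg : 0 ≤ g) (hc : 0 ≤ c) :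
    0 ≤ penConst σ τ lam1 lam2 g c := by
  have : 0 ≤ lam2 - lam1 := sub_nonneg.2 hlam
  unfold penConst
  positivity

variable {Ω : Type*} [MeasurableSpace Ω] {P : Measure Ω} [IsProbabilityMeasure P]
  {p : ℕ → ℕ} {γ σ τ lam1 lam2 : ℝ} {Sigma : ∀ n, Matrix (Fin (p n)) (Fin (p n)) ℝ}
  {Z : ∀ n, Ω → Fin n → Fin (p n) → ℝ} {β : ∀ n, Ω → Fin (p n) → ℝ} {u : ∀ n, Ω → Fin n → ℝ}
  {s₁ : ∀ n, (Fin n → Fin (p n) → ℝ) → ℝ} {θ : ∀ n, Fin (p n) → ℝ} {M C : ℝ}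

/-- If the events `E n` have probability tending to one and the constants do not grow too fast,
the risk gap tends to zero in probability, uniformly over the stopping times considered. -/
theorem tendsto_measure_iSup_gap (hgrowth : ProportionalGrowth p γ)
    (hmodel : ∀ n ≥ 2, FixedModel P (Sigma n) (Z n) (β n) (u n) σ τ M C)
    (hlam1 : 0 < lam1) (hlam : σ ^ 2 / τ ^ 2 * γ ∈ Set.Ioo lam1 lam2)
    (hs₁ : ∀ n ≥ 2, ∀ x, 0 ≤ s₁ n x) {Θ : ℝ} (hθ : ∀ n ≥ 2, euNorm (θ n) ≤ Θ)
    {ι : Type*} [Countable ι] (time : ι → ℕ) {E : ∀ n, Set (Fin n → Fin (p n) → ℝ)}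
    (hE : ∀ n ≥ 2, MeasurableSet (E n)) {c g : ℝ} (hc : 0 < c) (hc1 : c ≤ 1) (hg : 1 ≤ g)
    (hbound : ∀ᶠ n in atTop, aspect n (p n) ≤ g ∧ (n : ℝ) ≤ g * p n) {s q B A : ℕ → ℝ}
    (hs : ∀ n ≥ 2, 1 ≤ s n) (hcov : ∀ n ≥ 2, ∀ x ∈ E n, x ∈ covSet n (p n) (s n))
    (hm : ∀ n ≥ 2, ∀ x ∈ E n, c ≤ mTilde2 (Matrix.of x))
    (hstep : ∀ n ≥ 2, ∀ x ∈ E n, ∀ i, StepBound (Matrix.of x) (s₁ n x) lam1 (q n) (B n) (time i))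
    (hA : ∀ n ≥ 2, 2 * C * gapConst (q n) (B n) Θ (s n) lam1 * iterConst (B n) Θ (s n) lam1 *
      (penConst σ τ lam1 lam2 g c * s n ^ 2) ≤ A n) (hA0 : ∀ n ≥ 2, 0 ≤ A n)
    (hEP : Tendsto (fun n => P {ω | (fun i j => design (Sigma n) (Z n) ω i j) ∉ E n}) atTop (𝓝 0))
    (hrate : Tendsto (fun n : ℕ => A n * s n ^ 4 / √n) atTop (𝓝 0)) {δ : ℝ} (hδ : 0 < δ) :
    Tendsto (fun n => P {ω | ENNReal.ofReal δ ≤ ⨆ i, ENNReal.ofReal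
      |(pluginRisk P (Sigma n) (Z n) (β n) (u n) (s₁ n) (θ n) lam1 lam2 (time i) ω).toReal -
        (oracleRisk P (Sigma n) (Z n) (β n) (u n) (s₁ n) (θ n) σ τ (time i) ω).toReal|})
      atTop (𝓝 0) := by
  have hlim := hEP.add (ENNReal.tendsto_ofReal ((hrate.mul_const (gapRate σ τ M g)).div_const δ))
  rw [zero_mul, zero_div, ENNReal.ofReal_zero, add_zero] at hlim
  -- The oracle penalty eventually enters the open truncation interval, so clipping cannot bias the
  -- plug-in penalty.
  have hstar : Tendsto (fun n => lamStar σ τ n (p n)) atTop (𝓝 (σ ^ 2 / τ ^ 2 * γ)) :=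
    hgrowth.tendsto.const_mul _
  refine tendsto_of_tendsto_of_tendsto_of_le_of_le' tendsto_const_nhds hlim
    (Eventually.of_forall fun n => zero_le) ?_
  filter_upwards [hbound, eventually_ge_atTop 2, hstar.eventually_mem (Ioo_mem_nhds hlam.1 hlam.2)]
    with n hb hn hl
  have h := hmodel n hn
  refine (h.measure_iSup_risk_gap_le (hs₁ n hn) hlam1 (Set.Ioo_subset_Icc_self hl) (hθ n hn) time
    (hE n hn) hc hc1 hg (hs n hn) hb.1 (hcov n hn) (hm n hn) (hstep n hn) hδ (hA n hn)
    (hA0 n hn)).trans (add_le_add le_rfl (ENNReal.ofReal_le_ofReal ?_))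
  exact div_le_div_of_nonneg_right (errors_le_gapRate h.n_pos h.p_pos h.moment_nonneg (hs n hn)
    (hA0 n hn) hb.1 hb.2) hδ.le

/-- For fixed `t` no contraction is available and the constants are powers of the covariance bound,
so this bound may grow only like a small power of `n`. -/
theorem tendsto_measure_gap (hgrowth : ProportionalGrowth p γ)
    (hmodel : ∀ n ≥ 2, FixedModel P (Sigma n) (Z n) (β n) (u n) σ τ M C) (hC : 0 ≤ C)
    (hlam1 : 0 < lam1) (hlam : σ ^ 2 / τ ^ 2 * γ ∈ Set.Ioo lam1 lam2)
    (hs₁ : ∀ n ≥ 2, ∀ x, 0 ≤ s₁ n x) {Θ : ℝ} (hθ : ∀ n ≥ 2, euNorm (θ n) ≤ Θ) {c : ℝ} (hc : 0 < c)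
    (hc1 : c ≤ 1)
    (hm : Tendsto (fun n => P {ω | mTilde2 (design (Sigma n) (Z n) ω) < c}) atTop (𝓝 0)) (t : ℕ)
    {δ : ℝ} (hδ : 0 < δ) :
    Tendsto (fun n => P {ω | ENNReal.ofReal δ ≤ ENNReal.ofReal
      |(pluginRisk P (Sigma n) (Z n) (β n) (u n) (s₁ n) (θ n) lam1 lam2 t ω).toReal -
        (oracleRisk P (Sigma n) (Z n) (β n) (u n) (s₁ n) (θ n) σ τ t ω).toReal|})
      atTop (𝓝 0) := by
  obtain ⟨g, hg, hbound⟩ := hgrowth.exists_bound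
  have hΘ : 0 ≤ Θ := (norm_nonneg _).trans (hθ 2 le_rfl)
  obtain ⟨K, hK, hKs⟩ := exists_gap_const_le hC hΘ hlam1
    (penConst_nonneg (σ := σ) (τ := τ) (hlam.1.trans hlam.2).le (zero_le_one.trans hg) hc.le) t
  -- With `s = (C + 1) n^(2a)`, the rate is a multiple of `s^(3t + 5) s⁴ / √n`. This choice makes
  -- `n^(2a (3t + 9)) = n^(1/4)`, leaving `n^(-1/4)`. The factor `C + 1` in place of `C` ensures `s
  -- ≥ 1`.
  obtain ⟨a, ha⟩ : ∃ a : ℝ, a = 1 / (8 * (3 * t + 9)) := ⟨_, rfl⟩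
  have ha0 : 0 < a := by rw [ha]; positivity
  have hx : ∀ n : ℕ, n ≥ 2 → (1 : ℝ) ≤ ((n : ℝ) ^ a) ^ 2 := fun n hn =>
    one_le_pow₀ (Real.one_le_rpow (by exact_mod_cast (by omega : 1 ≤ n)) ha0.le)
  have hs : ∀ n : ℕ, n ≥ 2 → (1 : ℝ) ≤ (C + 1) * ((n : ℝ) ^ a) ^ 2 := fun n hn => by
    nlinarith [hx n hn]
  have hcovE := tendsto_measure_notMem_covSet hgrowth hmodel ha0
  have hEP := hcovE.add hm
  rw [add_zero] at hEP
  have hrate : Tendsto (fun n : ℕ => K * ((C + 1) * ((n : ℝ) ^ a) ^ 2) ^ (3 * t + 5) *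
      ((C + 1) * ((n : ℝ) ^ a) ^ 2) ^ 4 / √n) atTop (𝓝 0) := by
    have h1 : Tendsto (fun n : ℕ => K * (C + 1) ^ (3 * t + 9) * (n : ℝ) ^ (-(1 / 4 : ℝ))) atTop
        (𝓝 0) := by
      have := ((tendsto_rpow_neg_atTop (show (0 : ℝ) < 1 / 4 by norm_num)).comp
        tendsto_natCast_atTop_atTop).const_mul (K * (C + 1) ^ (3 * t + 9))
      simpa using this
    refine h1.congr' ?_
    filter_upwards [eventually_gt_atTop 0] with n hn
    have hn' : (0 : ℝ) < n := by exact_mod_cast hn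
    have h2 : (((n : ℝ) ^ a) ^ 2) ^ (3 * t + 9) = (n : ℝ) ^ (1 / 4 : ℝ) := by
      rw [← pow_mul, ← Real.rpow_natCast, ← Real.rpow_mul hn'.le]
      congr 1
      rw [ha]
      push_cast
      field_simp
      norm_num
    have h3 : (n : ℝ) ^ (-(1 / 4 : ℝ)) = (n : ℝ) ^ (1 / 4 : ℝ) / √n := by
      rw [Real.sqrt_eq_rpow, ← Real.rpow_sub hn']
      norm_num
    rw [h3, ← h2]
    generalize C + 1 = D
    ring
  have key := tendsto_measure_iSup_gap hgrowth hmodel hlam1 hlam hs₁ hθ (ι := Unit) (fun _ => t)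
    (E := fun n => covSet n (p n) (C * ((n : ℝ) ^ a) ^ 2) ∩ {x | c ≤ mTilde2 (Matrix.of x)})
    (fun n _ => (measurableSet_covSet _).inter (measurableSet_mTilde2_ge c)) hc hc1 hg
    (hbound.mono fun n h => ⟨h.1, h.2.2⟩) (s := fun n => (C + 1) * ((n : ℝ) ^ a) ^ 2)
    (q := fun n => 1 + (C + 1) * ((n : ℝ) ^ a) ^ 2 / lam1)
    (B := fun n => (t + 1) * (1 + (C + 1) * ((n : ℝ) ^ a) ^ 2 / lam1) ^ t)
    (A := fun n => K * ((C + 1) * ((n : ℝ) ^ a) ^ 2) ^ (3 * t + 5)) hs ?_ ?_ ?_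
    (fun n hn => hKs _ (hs n hn)) (fun n hn => ?_) ?_ hrate hδ
  · simpa only [iSup_const] using key
  · intro n hn x hx' v
    refine (hx'.1 v).trans ?_
    have : 0 ≤ v ⬝ᵥ v := self_dotProduct_nonneg v
    gcongr
    linarith
  · exact fun n hn x hx' => hx'.2
  · intro n hn x hx' i
    refine stepBound_of_cov_le (hs₁ n hn x) hlam1 (hs n hn) (fun v => (hx'.1 v).trans ?_) t
    have : 0 ≤ v ⬝ᵥ v := self_dotProduct_nonneg v
    gcongr
    linarith
  · have := hs n hn
    positivity
  · refine tendsto_of_tendsto_of_tendsto_of_le_of_le tendsto_const_nhds hEP (fun n => zero_le)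
      fun n => ?_
    refine le_trans (measure_mono fun ω hω => ?_) (measure_union_le _ _)
    by_contra hne
    rw [Set.mem_union, not_or, Set.mem_ofPred_eq, Set.mem_ofPred_eq, not_not, not_lt] at hne
    refine hω ⟨hne.1, ?_⟩
    rw [Set.mem_ofPred_eq, of_entries]
    exact hne.2

theorem tendsto_measure_iSup_gap_of_sMax_lt (hgrowth : ProportionalGrowth p γ)
    (hmodel : ∀ n ≥ 2, FixedModel P (Sigma n) (Z n) (β n) (u n) σ τ M C) (hC : 0 ≤ C)
    (hlam1 : 0 < lam1) (hlam : σ ^ 2 / τ ^ 2 * γ ∈ Set.Ioo lam1 lam2)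
    (hs_meas : ∀ n ≥ 2, Measurable (s₁ n)) (hs₁ : ∀ n ≥ 2, ∀ x, 0 ≤ s₁ n x) {Θ : ℝ}
    (hθ : ∀ n ≥ 2, euNorm (θ n) ≤ Θ) {c : ℝ} (hc : 0 < c) (hc1 : c ≤ 1)
    (hm : Tendsto (fun n => P {ω | mTilde2 (design (Sigma n) (Z n) ω) < c}) atTop (𝓝 0))
    {K : ℝ} (hK : 0 < K)
    (hsmax : Tendsto (fun n => P {ω |
      sMax (sampleCov (design (Sigma n) (Z n) ω)) < s₁ n (fun i j => design (Sigma n) (Z n) ω i j) ∧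
        s₁ n (fun i j => design (Sigma n) (Z n) ω i j) < K}) atTop (𝓝 1))
    {δ : ℝ} (hδ : 0 < δ) :
    Tendsto (fun n => P {ω | ENNReal.ofReal δ ≤ ⨆ t : ℕ, ENNReal.ofReal
      |(pluginRisk P (Sigma n) (Z n) (β n) (u n) (s₁ n) (θ n) lam1 lam2 t ω).toReal -
        (oracleRisk P (Sigma n) (Z n) (β n) (u n) (s₁ n) (θ n) σ τ t ω).toReal|})
      atTop (𝓝 0) := by
  obtain ⟨g, hg, hbound⟩ := hgrowth.exists_bound
  have hΘ : 0 ≤ Θ := (norm_nonneg _).trans (hθ 2 le_rfl)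
  have hpen := penConst_nonneg (σ := σ) (τ := τ) (hlam.1.trans hlam.2).le (zero_le_one.trans hg)
    hc.le
  -- On `F` one has `Σ̂ ≤ s₁ ≤ K`, so the iteration contracts with constants independent of `n` and
  -- `t`. Unlike the event with `sMax`, `F` is directly seen to be measurable; it contains the
  -- designs of that event, so only monotonicity of `P` is needed there.
  obtain ⟨F, hF⟩ : ∃ F : ∀ n, Set (Fin n → Fin (p n) → ℝ), ∀ n, F n =
    {x | x ∈ covSet n (p n) (s₁ n x)} ∩ {x | s₁ n x ≤ K} := ⟨_, fun _ => rfl⟩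
  have hFm : ∀ n ≥ 2, MeasurableSet (F n) := fun n hn => by
    rw [hF]
    exact (measurableSet_mem_covSet (hs_meas n hn)).inter
      (measurableSet_le (hs_meas n hn) measurable_const)
  have hFP : Tendsto (fun n => P {ω | (fun i j => design (Sigma n) (Z n) ω i j) ∉ F n}) atTop
      (𝓝 0) := by
    have h1 := ENNReal.Tendsto.sub (tendsto_const_nhds (x := (1 : ℝ≥0∞)) (f := atTop)) hsmax
      (Or.inl ENNReal.one_ne_top)
    rw [tsub_self] at h1
    refine tendsto_of_tendsto_of_tendsto_of_le_of_le' tendsto_const_nhds h1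
      (Eventually.of_forall fun n => zero_le) ?_
    filter_upwards [eventually_ge_atTop 2] with n hn
    have hmeas : MeasurableSet {ω | (fun i j => design (Sigma n) (Z n) ω i j) ∈ F n} :=
      (hmodel n hn).measurable_design_fun (hFm n hn)
    have h2 : P {ω | (fun i j => design (Sigma n) (Z n) ω i j) ∉ F n} =
        1 - P {ω | (fun i j => design (Sigma n) (Z n) ω i j) ∈ F n} :=
      prob_compl_eq_one_sub hmeas
    rw [h2]
    refine tsub_le_tsub_left (measure_mono fun ω hω => ?_) _
    have h3 : (fun i j => design (Sigma n) (Z n) ω i j) ∈ F n := by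
      rw [hF]
      refine ⟨fun v => ?_, hω.2.le⟩
      rw [of_entries]
      refine (dotProduct_mulVec_le_sMax (sampleCov_posSemidef _).1 v).trans ?_
      exact mul_le_mul_of_nonneg_right hω.1.le (self_dotProduct_nonneg v)
    exact h3
  have hEP := hFP.add hm
  rw [add_zero] at hEP
  have hs : (1 : ℝ) ≤ max K 1 := le_max_right _ _
  have hA0 : 0 ≤ 2 * C * gapConst (K / (K + lam1)) ((K + lam1) / lam1) Θ (max K 1) lam1 *
      iterConst ((K + lam1) / lam1) Θ (max K 1) lam1 *
        (penConst σ τ lam1 lam2 g c * max K 1 ^ 2) := by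
    unfold gapConst iterConst
    positivity
  refine tendsto_measure_iSup_gap hgrowth hmodel hlam1 hlam hs₁ hθ (ι := ℕ) (fun t => t)
    (E := fun n => F n ∩ {x | c ≤ mTilde2 (Matrix.of x)})
    (fun n hn => (hFm n hn).inter (measurableSet_mTilde2_ge c)) hc hc1 hg
    (hbound.mono fun n h => ⟨h.1, h.2.2⟩) (s := fun _ => max K 1) (q := fun _ => K / (K + lam1))
    (B := fun _ => (K + lam1) / lam1) (fun _ _ => hs) ?_ (fun n hn x hx => hx.2) ?_
    (fun n hn => le_rfl) (fun _ _ => hA0) ?_ ?_ hδ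
  · rintro n hn x ⟨hx, -⟩ v
    rw [hF] at hx
    refine (hx.1 v).trans (mul_le_mul_of_nonneg_right ?_ (self_dotProduct_nonneg v))
    exact hx.2.trans (le_max_left _ _)
  · rintro n hn x ⟨hx, -⟩ t
    rw [hF] at hx
    exact stepBound_of_cov_le_step (hs₁ n hn x) hlam1 hx.2 hx.1 t
  · refine tendsto_of_tendsto_of_tendsto_of_le_of_le tendsto_const_nhds hEP (fun n => zero_le)
      fun n => ?_
    refine le_trans (measure_mono fun ω hω => ?_) (measure_union_le _ _)
    by_contra hne
    rw [Set.mem_union, not_or, Set.mem_ofPred_eq, Set.mem_ofPred_eq, not_not, not_lt] at hne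
    refine hω ⟨hne.1, ?_⟩
    rw [Set.mem_ofPred_eq, of_entries]
    exact hne.2
  · exact (Real.tendsto_sqrt_atTop.comp tendsto_natCast_atTop_atTop).const_div_atTop _

end Convergence

end RGD

/-! ### Finiteness, pointwise and uniform convergence of the risk gap. -/

theorem theorem3p9 {Ω : Type*} [MeasurableSpace Ω] (P : Measure Ω) [IsProbabilityMeasure P]
    (p : ℕ → ℕ) (γ σ τ lam1 lam2 : ℝ)
    (Sigma : ∀ n, Matrix (Fin (p n)) (Fin (p n)) ℝ) (H : Measure ℝ)
    (Z : ∀ n, Ω → Fin n → Fin (p n) → ℝ) (β : ∀ n, Ω → Fin (p n) → ℝ) (u : ∀ n, Ω → Fin n → ℝ)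
    (s₁ : ∀ n, (Fin n → Fin (p n) → ℝ) → ℝ) (θ : ∀ n, Fin (p n) → ℝ)
    (hgrowth : RGD.ProportionalGrowth p γ)
    (hcov : RGD.BoundedCovariance p Sigma)
    (hdesign : RGD.DesignEntries P p Z)
    (hlimit : RGD.SpectralLimit p Sigma H)
    (heffects : RGD.RandomEffects P p Z β u σ τ)
    (hlam1 : 0 < lam1)
    (hlam : σ ^ 2 / τ ^ 2 * γ ∈ Set.Ioo lam1 lam2)
    (hs_meas : ∀ n ≥ 2, Measurable (s₁ n))
    (hs_nonneg : ∀ n ≥ 2, ∀ x, 0 ≤ s₁ n x)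
    (hθ : ∃ C : ℝ, ∀ n ≥ 2, ‖WithLp.toLp 2 (θ n)‖ ≤ C) :
    -- both risks are almost surely finite
    (∀ n ≥ 2, ∀ t : ℕ, ∀ᵐ ω ∂P,
      RGD.pluginRisk P (Sigma n) (Z n) (β n) (u n) (s₁ n) (θ n) lam1 lam2 t ω ≠ ∞ ∧
      RGD.oracleRisk P (Sigma n) (Z n) (β n) (u n) (s₁ n) (θ n) σ τ t ω ≠ ∞) ∧
    -- convergence in probability, for every fixed number of iterations
    (∀ t : ℕ, TendstoInMeasure P (fun n ω =>
        |(RGD.pluginRisk P (Sigma n) (Z n) (β n) (u n) (s₁ n) (θ n) lam1 lam2 t ω).toReal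
          - (RGD.oracleRisk P (Sigma n) (Z n) (β n) (u n) (s₁ n) (θ n) σ τ t ω).toReal|)
      atTop (fun _ => 0)) ∧
    -- uniform convergence in probability, the supremum being taken in `[0, ∞]`
    (∀ K : ℝ, 0 < K →
      Tendsto (fun n => P {ω |
          RGD.sMax (RGD.sampleCov (RGD.design (Sigma n) (Z n) ω))
            < s₁ n (fun i j => RGD.design (Sigma n) (Z n) ω i j) ∧
          s₁ n (fun i j => RGD.design (Sigma n) (Z n) ω i j) < K}) atTop (𝓝 1) →
      ∀ δ : ℝ, 0 < δ →
        Tendsto (fun n => P {ω | ENNReal.ofReal δ ≤ ⨆ t : ℕ, ENNReal.ofReal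
          |(RGD.pluginRisk P (Sigma n) (Z n) (β n) (u n) (s₁ n) (θ n) lam1 lam2 t ω).toReal
            - (RGD.oracleRisk P (Sigma n) (Z n) (β n) (u n) (s₁ n) (θ n) σ τ t ω).toReal|})
          atTop (𝓝 0)) := by
  obtain ⟨M, C, -, hC, hmodel⟩ := RGD.exists_fixedModel hgrowth hcov hdesign heffects
  obtain ⟨c, hc, hc1, hm⟩ := RGD.tendsto_measure_mTilde2_lt hgrowth hcov hlimit hmodel
  obtain ⟨Θ, hΘ⟩ := hθ
  refine ⟨fun n hn t => ?_, fun t ε hε => ?_, fun K hK hsmax δ hδ => ?_⟩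
  · filter_upwards [(hmodel n hn).pluginRisk_ne_top (hs_nonneg n hn) hlam1
      (hlam.1.trans hlam.2).le (θ n) t, (hmodel n hn).oracleRisk_ne_top (hs_nonneg n hn) (θ n) t]
      with ω h1 h2 using ⟨h1, h2⟩
  -- Convergence in measure quantifies over `ε` in `(0, ∞]`; replacing `ε` by `min ε 1` gives a real
  -- threshold and only enlarges the event.
  · have hε1 : min ε 1 ≠ ∞ := ne_top_of_le_ne_top ENNReal.one_ne_top (min_le_right _ _)
    have hδ : 0 < (min ε 1).toReal :=
      ENNReal.toReal_pos (lt_min hε one_pos).ne' hε1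
    refine tendsto_of_tendsto_of_tendsto_of_le_of_le tendsto_const_nhds
      (RGD.tendsto_measure_gap hgrowth hmodel hC hlam1 hlam hs_nonneg hΘ hc hc1 hm t hδ)
      (fun n => zero_le) fun n => measure_mono fun ω hω => ?_
    rw [Set.mem_ofPred_eq, edist_dist, Real.dist_eq, sub_zero, abs_abs] at hω
    rw [Set.mem_ofPred_eq, ENNReal.ofReal_toReal hε1]
    exact (min_le_left _ _).trans hω
  · exact RGD.tendsto_measure_iSup_gap_of_sMax_lt hgrowth hmodel hC hlam1 hlam hs_meas hs_nonneg hΘ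
      hc hc1 hm hK hsmax hδ
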